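/- Let $m\ge 1$ be an integer, $n=2m+2$, $p_j=e^{2\pi i j/n}$ for $0\le j\le n-1$, and let $\rho>1$. Let $\mathcal W^{\ge0}_{\mathbb R}$ be the Banach space of power series $f(\lambda)=\sum_{k\ge0}f_k\lambda^k$ with real coefficients and $\|f\|_\rho=\sum_k|f_k|\rho^k<\infty$, and write $f^0=f_0$. For a parameter ${\bf x}=(r,a,b,c)\in\mathbb R\times(\mathcal W^{\ge0}_{\mathbb R})^3$ and $t\in\mathbb R$ consider on $\mathbb C\setminus\{p_0,\dots,p_{n-1}\}$ the potential $$\eta_t^{\bf x}=\begin{pmatrix}0&0\\ mrz^{m-1}&0\end{pmatrix}dz+t\sum_{j=0}^{n-1}A_j(\lambda)\frac{dz}{z-p_j},$$ $$A_0(\lambda)=\begin{pmatrix}a(\lambda)&\lambda^{-1}b(\lambda)\\ \lambda c(\lambda)&-a(\lambda)\end{pmatrix},\qquad A_{j+1}(\lambda)=D^{-1}A_j(-\lambda)D,\qquad D=\begin{pmatrix}e^{i\pi m/n}&0\\0&e^{-i\pi m/n}\end{pmatrix}.$$ Let $\gamma_0$ be the loop $\gamma_0(s)=2\sin(\pi s)\,e^{i\pi(2s-1)/n}$,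 $s\in[0,1]$, which is based at $0$ and encloses only $p_0=1$, once and counterclockwise, and let $\gamma_j=p_j\gamma_0$; the $\gamma_j$ generate $\pi_1(\mathbb C\setminus\{p_0,\dots,p_{n-1}\},0)$. Let $M_j=M_j(t,{\bf x})(\lambda)$ be the monodromy along $\gamma_j$ of the solution of $d\Phi=\Phi\,\eta_t^{\bf x}$, $\Phi(0)=\mathrm{Id}$, i.e. the value at the end point of $\gamma_j$ of the continuation of $\Phi$ along $\gamma_j$. For $t\neq0$ put $\widetilde M=\frac1t\log M_0$, where $\log(1+N)=\sum_{k\ge1}\frac{(-1)^{k+1}}{k}N^k$, and let $f^*(\lambda)=\overline{f(1/\overline\lambda)}$. Consider the system $$(\ast)\quad\left\{\begin{array}{l} \mathcal F:=\frac1{2\pi i}\bigl(\widetilde M_{11}+\widetilde M_{11}^*\bigr)=0 \text{ on } |\lambda|=1,\\[2pt] \mathcal G:=\frac1{2\pi i}\bigl(\widetilde M_{21}+\widetilde M_{12}^*\bigr)=0\text{ on } |\lambda|=1,\\[2pt] \mathcal H_1:=\frac1{2\pi i}\widetilde M_{12}(\lambda=1)=0,\\[2pt] \mathcal H_2:=\frac1{2\pi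 i}\widetilde M_{12}(\lambda=-1)=0,\\[2pt] \mathcal K:=(a^0)^2+b^0c^0=1.\end{array}\right.$$ Let ${\bf x}_0=(1,\lambda,\frac{\lambda^2-1}2,-2)$, and for $\delta>0$ let $U_\delta$ be the set of ${\bf x}=(r,a,b,c)$ with $|r-1|<\delta$, $\|a-\lambda\|_\rho<\delta$, $\|b-\frac{\lambda^2-1}{2}\|_\rho<\delta$, $\|c+2\|_\rho<\delta$. Then there is $\delta_0>0$ such that for every $\delta\in(0,\delta_0]$ there is $\varepsilon>0$ such that for all $t\in(0,\varepsilon)$: (1) there is exactly one ${\bf x}(t)\in U_\delta$ that solves $(\ast)$; (2) for ${\bf x}\in U_\delta$, the system $(\ast)$ holds if and only if $\eta_t^{\bf x}$ solves the monodromy problem in the following sense: for all $0\le j\le n-1$, $M_j(\lambda)\in SU(2)$ for all $|\lambda|=1$ and $M_j(1)$, $M_j(-1)$ are diagonal, and the constant Fourier coefficient of $\det A_0$ is $-1$. In particular $\eta_t^{{\bf x}(t)}$ solves the monodromy problem, and ${\bf x}(t)\to{\bf x}_0$ as $t\to0$. -/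

import Mathlib

noncomputable section

namespace DPW

open Complex

/-- The space of loops `f = ∑_{k ≥ 0} f_k μ^k` in the Wiener algebra of the annulus
`1/ρ < |μ| < ρ` that have no negative Fourier modes and satisfy `conj (f (conj μ)) = f μ`,
i.e. whose coefficients are real.  A loop is recorded by its Fourier coefficients `f_k`, `k ≥ 0`;
the condition is `∑ |f_k| ρ^k < ∞`. -/
def WienerPos (ρ : ℝ) : Submodule ℝ (ℕ → ℝ) where
  carrier := {f | Summable fun k => |f k| * |ρ| ^ k}
  zero_mem' := by simp
  add_mem' := by
    intro f g hf hg
    refine Summable.of_nonneg_of_le (fun k => by positivity) (fun k => ?_) (hf.add hg)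
    rw [← add_mul]
    exact mul_le_mul_of_nonneg_right (abs_add_le _ _) (by positivity)
  smul_mem' := by
    intro c f hf
    simpa [abs_mul, mul_assoc] using hf.mul_left |c|

/-- The norm `‖f‖_ρ = ∑ |f_k| ρ^k`. -/
def wienerNorm {ρ : ℝ} (f : WienerPos ρ) : ℝ := ∑' k, |f.1 k| * |ρ| ^ k

/-- The value `f(μ) = ∑ f_k μ^k` of a loop. -/
def ev {ρ : ℝ} (f : WienerPos ρ) (μ : ℂ) : ℂ := ∑' k, (f.1 k : ℂ) * μ ^ k

theorem mem_wienerPos_of_finite (ρ : ℝ) (f : ℕ → ℝ) (N : ℕ) (h : ∀ k, N ≤ k → f k = 0) :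
    f ∈ WienerPos ρ := by
  refine summable_of_ne_finset_zero (s := Finset.range N) (fun k hk => ?_)
  simp [h k (by simpa using hk)]

/-- The parameter vector `x = (r, a, b, c)`. -/
structure Param (ρ : ℝ) where
  r : ℝ
  a : WienerPos ρ
  b : WienerPos ρ
  c : WienerPos ρ

/-- The central value `r = 1`, `a = μ`, `b = (μ² - 1)/2`, `c = -2`. -/
def x₀ (ρ : ℝ) : Param ρ where
  r := 1
  a := ⟨fun k => if k = 1 then 1 else 0,
    mem_wienerPos_of_finite ρ _ 2 fun k hk => if_neg (by omega)⟩
  b := ⟨fun k => if k = 0 then -1 / 2 else if k = 2 then 1 / 2 else 0,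
    mem_wienerPos_of_finite ρ _ 3 fun k hk => by
      rw [if_neg (by omega), if_neg (by omega)]⟩
  c := ⟨fun k => if k = 0 then -2 else 0,
    mem_wienerPos_of_finite ρ _ 1 fun k hk => if_neg (by omega)⟩

/-- The open ball of radius `δ` around `x₀` in `ℝ × (W^{≥ 0}_ℝ)³`. -/
def nbhd (ρ δ : ℝ) : Set (Param ρ) :=
  {x | |x.r - (x₀ ρ).r| < δ ∧ wienerNorm (x.a - (x₀ ρ).a) < δ ∧
    wienerNorm (x.b - (x₀ ρ).b) < δ ∧ wienerNorm (x.c - (x₀ ρ).c) < δ}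

/-- The number `n = 2m + 2` of finite punctures. -/
def nn (m : ℕ) : ℕ := 2 * m + 2

/-- The punctures `p_j = exp (2πij/n)`. -/
def p (m j : ℕ) : ℂ := exp (2 * Real.pi * I * j / nn m)

/-- `D = diag (exp (iπm/n), exp (-iπm/n))`. -/
def D (m : ℕ) : Matrix (Fin 2) (Fin 2) ℂ :=
  !![exp (I * Real.pi * m / nn m), 0; 0, exp (-(I * Real.pi * m / nn m))]

/-- The residue matrices: `A_0 = (a, μ⁻¹ b; μ c, -a)` and `A_{j+1}(μ) = D⁻¹ A_j(-μ) D`. -/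
def A (m : ℕ) {ρ : ℝ} (x : Param ρ) : ℕ → ℂ → Matrix (Fin 2) (Fin 2) ℂ
  | 0 => fun μ => !![ev x.a μ, μ⁻¹ * ev x.b μ; μ * ev x.c μ, -ev x.a μ]
  | j + 1 => fun μ => (D m)⁻¹ * A m x j (-μ) * D m

/-- The potential `η_t^x(z, μ)`, i.e. the coefficient of `dz`. -/
def η (m : ℕ) {ρ : ℝ} (t : ℝ) (x : Param ρ) (z μ : ℂ) : Matrix (Fin 2) (Fin 2) ℂ :=
  !![0, 0; m * x.r * z ^ (m - 1), 0] +
    (t : ℂ) • ∑ j ∈ Finset.range (nn m), (z - p m j)⁻¹ • A m x j μ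

/-- The loop `γ_j : [0,1] → ℂ \ {p_0, …, p_{n-1}}` based at `0`.  It runs in the closed sector of
half-angle `π/n` around the ray through `p_j`, meets this ray only in `0` and `2 p_j`, and so
encloses, once and counterclockwise, the puncture `p_j` and no other.
These loops generate the fundamental group of the punctured plane with base point `0`; moreover
`γ_{j+1} = exp (2πi/n) γ_j`, and complex conjugation reverses `γ_0`. -/
def γ (m j : ℕ) (s : ℝ) : ℂ :=
  p m j * (2 * Real.sin (Real.pi * s)) * exp (I * Real.pi * (2 * s - 1) / nn m)

/-- `X` is the solution of `dΦ = Φ η`, `Φ = Id` at the base point `0`, continued along `γ_j`. -/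
def IsTransport (m : ℕ) {ρ : ℝ} (t : ℝ) (x : Param ρ) (j : ℕ) (μ : ℂ)
    (X : ℝ → Matrix (Fin 2) (Fin 2) ℂ) : Prop :=
  X 0 = 1 ∧ ∀ s ∈ Set.Icc (0 : ℝ) 1, ∀ i k : Fin 2,
    HasDerivWithinAt (fun u => X u i k)
      ((X s * (deriv (γ m j) s • η m t x (γ m j s) μ)) i k) (Set.Icc 0 1) s

open Classical in
/-- The monodromy `M_j(t)(μ)` along `γ_j` of the solution `Φ_t` of `dΦ = Φ η_t`, `Φ(0) = Id`: the
end value of the continuation along `γ_j`.  (The continuation exists and is unique on `[0,1]`, the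
equation being linear with continuous coefficients.) -/
def Mon (m : ℕ) {ρ : ℝ} (t : ℝ) (x : Param ρ) (j : ℕ) (μ : ℂ) : Matrix (Fin 2) (Fin 2) ℂ :=
  if h : ∃ X, IsTransport m t x j μ X then h.choose 1 else 0

/-- The logarithm of a matrix near the identity,
`log (1 + N) = N - N²/2 + N³/3 - …`. -/
def matLog (M : Matrix (Fin 2) (Fin 2) ℂ) : Matrix (Fin 2) (Fin 2) ℂ :=
  ∑' k : ℕ, ((-1) ^ k / (k + 1) : ℂ) • (M - 1) ^ (k + 1)

/-- `M̃(t) = (1/t) log M_0(t)`. -/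
def Mt (m : ℕ) {ρ : ℝ} (t : ℝ) (x : Param ρ) (μ : ℂ) : Matrix (Fin 2) (Fin 2) ℂ :=
  (1 / t : ℂ) • matLog (Mon m t x 0 μ)

/-- The involution `f*(μ) = conj (f (1 / conj μ))`. -/
def loopStar (f : ℂ → ℂ) (μ : ℂ) : ℂ :=
  (starRingEnd ℂ) (f (1 / (starRingEnd ℂ) μ))

def F (m : ℕ) {ρ : ℝ} (t : ℝ) (x : Param ρ) (μ : ℂ) : ℂ :=
  1 / (2 * Real.pi * I) * (Mt m t x μ 0 0 + loopStar (fun ν => Mt m t x ν 0 0) μ)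

def G (m : ℕ) {ρ : ℝ} (t : ℝ) (x : Param ρ) (μ : ℂ) : ℂ :=
  1 / (2 * Real.pi * I) * (Mt m t x μ 1 0 + loopStar (fun ν => Mt m t x ν 0 1) μ)

def H₁ (m : ℕ) {ρ : ℝ} (t : ℝ) (x : Param ρ) : ℂ :=
  1 / (2 * Real.pi * I) * Mt m t x 1 0 1

def H₂ (m : ℕ) {ρ : ℝ} (t : ℝ) (x : Param ρ) : ℂ :=
  1 / (2 * Real.pi * I) * Mt m t x (-1) 0 1

/-- `K(x) = (a⁰)² + b⁰ c⁰`, the constant Fourier coefficient of `-det A_0`. -/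
def K {ρ : ℝ} (x : Param ρ) : ℝ := x.a.1 0 ^ 2 + x.b.1 0 * x.c.1 0

/-- The system `F = 0`, `G = 0` (as loops on the unit circle), `H₁ = 0`, `H₂ = 0`, `K = 1`. -/
def IFTSystem (m : ℕ) {ρ : ℝ} (t : ℝ) (x : Param ρ) : Prop :=
  (∀ μ : ℂ, ‖μ‖ = 1 → F m t x μ = 0) ∧ (∀ μ : ℂ, ‖μ‖ = 1 → G m t x μ = 0) ∧
    H₁ m t x = 0 ∧ H₂ m t x = 0 ∧ K x = 1

/-- The potential `η_t^x` solves the monodromy problem: along every generator `γ_j` of the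
fundamental group the monodromy is in `SU(2)` for `μ` on the unit circle and diagonal for
`μ = ±1`; and `det A_0` is normalised to have constant Fourier coefficient `-1`. -/
def SolvesMonodromyProblem (m : ℕ) {ρ : ℝ} (t : ℝ) (x : Param ρ) : Prop :=
  (∀ j < nn m, ∀ μ : ℂ, ‖μ‖ = 1 → Mon m t x j μ ∈ Matrix.specialUnitaryGroup (Fin 2) ℂ) ∧
    (∀ j < nn m, (Mon m t x j 1).IsDiag ∧ (Mon m t x j (-1)).IsDiag) ∧
    Real.circleAverage (fun μ => (A m x 0 μ).det) 0 1 = -1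

end DPW

end

/-! Conjugating by the solution `Φ₀ = (1, 0; r z^m, 1)` of the equation at `t = 0` turns `dΦ = Φ η`
into `dY = t Y B(x)`, where `B(x)` is the conjugated sum of simple poles. Since `γ_0` is closed at
`0` and `Φ₀(0) = 1`, the gauge does not change `M_0`. So `M_0` is the end value of an equation with
small coefficient `t B(x)`, and to first order `log M_0` is `t ∫ B(x)`. By the residue theorem only
`p_0 = 1` contributes, and `log M_0 / (2πit)` tends to `Φ₀(1) A_0 Φ₀(1)⁻¹` (`totalInt_gauged`,
`central`). At `x₀`, for `μ = exp (iθ)`, this limit is `(cos θ, i sin θ; -i sin θ, -cos θ)`: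
hermitian, and diagonal at `μ = ±1`. Hence `x₀` solves the limiting system.

All this takes place in the Banach algebra of matrices over the Wiener algebra of Laurent series, so
that a single Volterra equation treats all `μ` on the circle at once. The limiting system is
polynomial in the parameter, and its linearisation at `x₀` is triangular in the coefficients apart
from finitely many low modes. It is inverted explicitly by `linInv` (`linInv_centralDeriv`), and
`linInv` annihilates exactly the data that satisfy the system (`linInv_eq_zero_iff`), so nothing is
lost by composing with it.

The map `B ↦ log (end value)` is strictly differentiable at `B = 0` with derivative the integral
(`hasStrictFDerivAt_odeLog`). After division by `t`, the system at time `t` therefore differs from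
the limiting one by a map of small Lipschitz constant, uniformly for small `t > 0`
(`norm_monLog_sub_le`). The composed system is a contractive perturbation of the identity on every
small ball around `x₀`, and the Banach fixed point theorem gives exactly one zero
(`exists_unique_zero_systemMap`). Differentiability in `t` is not needed.

Complex conjugation reverses `γ_0` and preserves the potential, so `conj M_0(conj μ) = M_0(μ)⁻¹`
(`conj_mon`), and `log M_0 / (2πit)` has real coefficients. This is why it suffices that `linInv`
sees real parts only.

For the equivalence with the monodromy problem, the logarithm near the identity is injective and
commutes with adjoint, adjugate and conjugation by `diag (1, -1)`: for determinant one, unitary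
means skew-hermitian logarithm, and diagonal means diagonal logarithm. The rotation symmetry
`η_rotate` carries the conditions from `γ_0` to all `γ_j`, and the mean value property identifies
the constant coefficient of `det A_0` with `-K`. -/

noncomputable section

namespace DPW

/-! ### Continuous linear maps out of `ℓ¹` -/

section Lift

variable {ι 𝕜 F : Type*} [RCLike 𝕜] [NormedAddCommGroup F] [NormedSpace 𝕜 F]

theorem l1_summable_norm {R : Type*} [NormedAddCommGroup R] (f : lp (fun _ : ι => R) 1) :
    Summable fun i => ‖f i‖ := by
  simpa using (lp.memℓp f).summable (by simp)

theorem l1_norm_eq_tsum {R : Type*} [NormedAddCommGroup R] (f : lp (fun _ : ι => R) 1) :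
    ‖f‖ = ∑' i, ‖f i‖ := by
  simpa using lp.norm_eq_tsum_rpow (by simp) f

theorem l1_summable_smul {v : ι → F} {C : ℝ} (hv : ∀ i, ‖v i‖ ≤ C)
    (f : lp (fun _ : ι => 𝕜) 1) : Summable fun i => ‖f i • v i‖ := by
  refine Summable.of_nonneg_of_le (fun _ => norm_nonneg _) (fun i => ?_)
    ((l1_summable_norm f).mul_right C)
  rw [norm_smul]
  exact mul_le_mul_of_nonneg_left (hv i) (norm_nonneg _)

variable [CompleteSpace F]

/-- The continuous linear map `f ↦ ∑ f_i v_i` on `ℓ¹` given by a bounded family `v`. -/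
def l1lift (v : ι → F) (C : ℝ) (hv : ∀ i, ‖v i‖ ≤ C) : lp (fun _ : ι => 𝕜) 1 →L[𝕜] F :=
  LinearMap.mkContinuous
    { toFun := fun f => ∑' i, f i • v i
      map_add' := fun f g => by
        rw [← Summable.tsum_add (l1_summable_smul hv f).of_norm (l1_summable_smul hv g).of_norm]
        exact tsum_congr fun i => by simp [add_smul]
      map_smul' := fun c f => by
        rw [RingHom.id_apply, ← Summable.tsum_const_smul _ (l1_summable_smul hv f).of_norm]
        exact tsum_congr fun i => by simp [mul_smul] } C fun f => by
    refine (norm_tsum_le_tsum_norm (l1_summable_smul hv f)).trans ?_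
    rw [l1_norm_eq_tsum, mul_comm, ← tsum_mul_right]
    refine (l1_summable_smul hv f).tsum_le_tsum (fun i => ?_) ((l1_summable_norm f).mul_right C)
    rw [norm_smul]
    exact mul_le_mul_of_nonneg_left (hv i) (norm_nonneg _)

theorem l1lift_apply (v : ι → F) (C : ℝ) (hv : ∀ i, ‖v i‖ ≤ C) (f : lp (fun _ : ι => 𝕜) 1) :
    l1lift v C hv f = ∑' i, f i • v i := rfl

theorem l1lift_hasSum (v : ι → F) (C : ℝ) (hv : ∀ i, ‖v i‖ ≤ C) (f : lp (fun _ : ι => 𝕜) 1) :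
    HasSum (fun i => f i • v i) (l1lift v C hv f) :=
  (l1_summable_smul hv f).of_norm.hasSum

theorem l1lift_norm_le [Nonempty ι] (v : ι → F) (C : ℝ) (hv : ∀ i, ‖v i‖ ≤ C) :
    ‖(l1lift v C hv : lp (fun _ : ι => 𝕜) 1 →L[𝕜] F)‖ ≤ C :=
  LinearMap.mkContinuous_norm_le _ ((norm_nonneg _).trans (hv (Classical.arbitrary ι))) _

variable [DecidableEq ι]

@[simp]
theorem l1lift_single (v : ι → F) (C : ℝ) (hv : ∀ i, ‖v i‖ ≤ C) (i : ι) (c : 𝕜) :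
    l1lift v C hv (lp.single 1 i c) = c • v i := by
  rw [l1lift_apply, tsum_eq_single i]
  · simp
  · intro j hj
    simp [hj]

theorem l1_ext {F : Type*} [AddCommMonoid F] [Module 𝕜 F] [TopologicalSpace F] [T2Space F]
    {f g : lp (fun _ : ι => 𝕜) 1 →L[𝕜] F}
    (h : ∀ i, f (lp.single 1 i 1) = g (lp.single 1 i 1)) : f = g := by
  refine lp.ext_continuousLinearMap (by simp) fun i => ?_
  ext
  simpa using h i

theorem l1_hasSum_single (f : lp (fun _ : ι => 𝕜) 1) :
    HasSum (fun i => f i • (lp.single 1 i 1 : lp (fun _ : ι => 𝕜) 1)) f := by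
  have h := lp.hasSum_single (E := fun _ : ι => 𝕜) (p := 1) (by simp) f
  refine Eq.mp (congrArg (fun F => HasSum F f) (funext fun k => ?_)) h
  rw [← lp.single_smul, smul_eq_mul, mul_one]

theorem l1_norm_single {R : Type*} [NormedAddCommGroup R] (i : ι) (c : R) :
    ‖(lp.single 1 i c : lp (fun _ : ι => R) 1)‖ = ‖c‖ := by
  rw [l1_norm_eq_tsum, tsum_eq_single i]
  · simp
  · intro j hj
    simp [hj]

end Lift

/-! ### The Wiener algebra of Laurent series on an annulus -/

/-- The Wiener algebra of Laurent series `∑ f_k μ^k` with `∑ |f_k| ρ^|k| < ∞`; an element is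
recorded by its normalised coefficients `f_k ρ^|k|`. -/
def Laurent (_ρ : ℝ) : Type := lp (fun _ : ℤ => ℂ) 1

/-- The weight `ρ^|k|`. -/
def wt (ρ : ℝ) (k : ℤ) : ℝ := ρ ^ k.natAbs

namespace Laurent

variable {ρ : ℝ}

instance : NormedAddCommGroup (Laurent ρ) := inferInstanceAs (NormedAddCommGroup (lp (fun _ : ℤ => ℂ) 1))
instance : NormedSpace ℂ (Laurent ρ) := inferInstanceAs (NormedSpace ℂ (lp (fun _ : ℤ => ℂ) 1))
instance : CompleteSpace (Laurent ρ) := inferInstanceAs (CompleteSpace (lp (fun _ : ℤ => ℂ) 1))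

/-- The normalised monomial `ρ^{-|k|} μ^k`. -/
def e (k : ℤ) : Laurent ρ := (lp.single 1 k (1 : ℂ) : lp (fun _ : ℤ => ℂ) 1)

theorem norm_e (k : ℤ) : ‖(e k : Laurent ρ)‖ = 1 := by
  refine (l1_norm_single (R := ℂ) k 1).trans ?_
  simp

variable {F : Type*} [NormedAddCommGroup F] [NormedSpace ℂ F] [CompleteSpace F]

/-- The continuous linear map that sends `e k` to `v k`. -/
def lift (v : ℤ → F) (C : ℝ) (hv : ∀ k, ‖v k‖ ≤ C) : Laurent ρ →L[ℂ] F :=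
  (l1lift v C hv : lp (fun _ : ℤ => ℂ) 1 →L[ℂ] F)

@[simp]
theorem lift_e (v : ℤ → F) (C : ℝ) (hv : ∀ k, ‖v k‖ ≤ C) (k : ℤ) :
    lift v C hv (e k : Laurent ρ) = v k :=
  (l1lift_single v C hv k (1 : ℂ)).trans (one_smul _ _)

theorem lift_norm_le (v : ℤ → F) (C : ℝ) (hv : ∀ k, ‖v k‖ ≤ C) :
    ‖(lift v C hv : Laurent ρ →L[ℂ] F)‖ ≤ C := l1lift_norm_le v C hv

theorem ext_clm {F : Type*} [AddCommMonoid F] [Module ℂ F] [TopologicalSpace F] [T2Space F]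
    {f g : Laurent ρ →L[ℂ] F} (h : ∀ k, f (e k) = g (e k)) : f = g :=
  l1_ext (𝕜 := ℂ) (ι := ℤ) h

/-- The coefficient of `μ^k`. -/
def coef (k : ℤ) (f : Laurent ρ) : ℂ :=
  (show lp (fun _ : ℤ => ℂ) 1 from f) k / wt ρ k

theorem wt_zero : wt ρ 0 = 1 := by simp [wt]

theorem wt_pos (h : 1 < ρ) (k : ℤ) : 0 < wt ρ k := pow_pos (by linarith) _

variable [hρ : Fact (1 < ρ)]

theorem one_le_wt (k : ℤ) : 1 ≤ wt ρ k := one_le_pow₀ hρ.out.le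

theorem wt_ne (k : ℤ) : (wt ρ k : ℂ) ≠ 0 := by
  exact_mod_cast (wt_pos hρ.out k).ne'

theorem wt_add_le (j k : ℤ) : wt ρ (j + k) ≤ wt ρ j * wt ρ k := by
  rw [wt, wt, wt, ← pow_add]
  exact pow_le_pow_right₀ hρ.out.le (Int.natAbs_add_le j k)

/-- The structure constants of the algebra with respect to the basis `e`. -/
def sc (ρ : ℝ) (j k : ℤ) : ℂ := ((wt ρ (j + k) / (wt ρ j * wt ρ k) : ℝ) : ℂ)

theorem norm_sc_le (j k : ℤ) : ‖sc ρ j k‖ ≤ 1 := by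
  have h1 := wt_pos hρ.out j
  have h2 := wt_pos hρ.out k
  have h3 := wt_pos hρ.out (j + k)
  rw [sc, Complex.norm_real, Real.norm_of_nonneg (by positivity), div_le_one (by positivity)]
  exact wt_add_le j k

/-- The multiplication of Laurent series as a bilinear map. -/
def mulL (ρ : ℝ) [Fact (1 < ρ)] : Laurent ρ →L[ℂ] Laurent ρ →L[ℂ] Laurent ρ :=
  lift (fun j => lift (fun k => sc ρ j k • e (j + k)) 1
    (fun k => by rw [norm_smul, norm_e, mul_one]; exact norm_sc_le j k)) 1
    (fun _ => lift_norm_le _ _ _)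

theorem mulL_e (j k : ℤ) : mulL ρ (e j) (e k) = sc ρ j k • e (j + k) := by
  rw [mulL, lift_e, lift_e]

theorem mulL_comm (f g : Laurent ρ) : mulL ρ f g = mulL ρ g f := by
  have : mulL ρ = (mulL ρ).flip := by
    refine ext_clm fun j => ext_clm fun k => ?_
    rw [ContinuousLinearMap.flip_apply, mulL_e, mulL_e, add_comm, sc, sc, add_comm j k,
      mul_comm (wt ρ j)]
  exact congrArg (fun B => B f g) this

/-- Both triple products are continuous trilinear maps, so it is enough to compare them on the basis
`e`, where either bracketing gives the constant `wt (i+j+k) / (wt i * wt j * wt k)`. -/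
theorem mulL_assoc (f g h : Laurent ρ) : mulL ρ (mulL ρ f g) h = mulL ρ f (mulL ρ g h) := by
  have : (ContinuousLinearMap.compL ℂ (Laurent ρ) (Laurent ρ) (Laurent ρ →L[ℂ] Laurent ρ) (mulL ρ)) ∘L mulL ρ
      = ((ContinuousLinearMap.compL ℂ (Laurent ρ) (Laurent ρ →L[ℂ] Laurent ρ)
        (Laurent ρ →L[ℂ] Laurent ρ)).flip (mulL ρ)) ∘L
        ((ContinuousLinearMap.compL ℂ (Laurent ρ) (Laurent ρ) (Laurent ρ)) ∘L mulL ρ) := by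
    refine ext_clm fun i => ext_clm fun j => ext_clm fun k => ?_
    simp only [ContinuousLinearMap.comp_apply, ContinuousLinearMap.compL_apply,
      ContinuousLinearMap.flip_apply, mulL_e, map_smul, smul_smul, _root_.smul_apply]
    rw [add_assoc]
    congr 1
    have h1 := (wt_pos hρ.out i).ne'
    have h2 := (wt_pos hρ.out j).ne'
    have h3 := (wt_pos hρ.out k).ne'
    have h4 := (wt_pos hρ.out (i + j)).ne'
    have h5 := (wt_pos hρ.out (j + k)).ne'
    rw [sc, sc, sc, sc, ← Complex.ofReal_mul, ← Complex.ofReal_mul, add_assoc]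
    congr 1
    field_simp
  exact congrArg (fun B => B f g h) this

theorem mulL_one (f : Laurent ρ) : mulL ρ (e 0) f = f := by
  have : mulL ρ (e 0) = ContinuousLinearMap.id ℂ (Laurent ρ) := by
    refine ext_clm fun k => ?_
    rw [mulL_e, zero_add, sc, wt_zero, zero_add, one_mul, div_self (wt_pos hρ.out k).ne']
    simp
  rw [this]; rfl

theorem norm_mulL_le (f g : Laurent ρ) : ‖mulL ρ f g‖ ≤ ‖f‖ * ‖g‖ := by
  refine ((mulL ρ).le_opNorm₂ f g).trans ?_
  have : ‖mulL ρ‖ ≤ 1 := lift_norm_le _ _ _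
  calc ‖mulL ρ‖ * ‖f‖ * ‖g‖ ≤ 1 * ‖f‖ * ‖g‖ := by gcongr
    _ = _ := by rw [one_mul]

instance : NormedCommRing (Laurent ρ) where
  __ := (inferInstance : NormedAddCommGroup (Laurent ρ))
  mul f g := mulL ρ f g
  one := e 0
  left_distrib f g h := (mulL ρ f).map_add g h
  right_distrib f g h := by
    change mulL ρ (f + g) h = mulL ρ f h + mulL ρ g h
    rw [map_add]; rfl
  zero_mul f := by change mulL ρ 0 f = 0; rw [map_zero]; rfl
  mul_zero f := (mulL ρ f).map_zero
  mul_assoc := mulL_assoc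
  one_mul := mulL_one
  mul_one f := (mulL_comm f (e 0)).trans (mulL_one f)
  mul_comm := mulL_comm
  norm_mul_le := norm_mulL_le

theorem mul_def (f g : Laurent ρ) : f * g = mulL ρ f g := rfl

theorem one_def : (1 : Laurent ρ) = e 0 := rfl

instance : NormedAlgebra ℂ (Laurent ρ) where
  toAlgebra := Algebra.ofModule
    (fun c f g => by rw [mul_def, mul_def, map_smul]; rfl)
    (fun c f g => by rw [mul_def, mul_def, map_smul])
  norm_smul_le := norm_smul_le

/-- Two Laurent series with the same coefficients are equal. -/
theorem ext_coef {f g : Laurent ρ} (h : ∀ k, coef k f = coef k g) : f = g := by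
  refine lp.ext (E := fun _ : ℤ => ℂ) (funext fun k => ?_)
  have := h k
  rw [coef, coef, div_left_inj' (wt_ne k)] at this
  exact this

theorem hasSum_e (f : Laurent ρ) : HasSum (fun k => (coef k f * wt ρ k) • (e k : Laurent ρ)) f := by
  have h := l1_hasSum_single (𝕜 := ℂ) (ι := ℤ) f
  refine Eq.mp (congrArg (fun F => HasSum F f) (funext fun k => ?_)) h
  exact congrArg (fun c : ℂ => c • (e k : Laurent ρ)) (div_mul_cancel₀ _ (wt_ne k)).symm

theorem summable_norm_coef_mul (f : Laurent ρ) : Summable fun k => ‖coef k f‖ * wt ρ k := by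
  refine (l1_summable_norm (R := ℂ) f).congr fun k => ?_
  have h1 := wt_pos hρ.out k
  rw [coef, norm_div, Complex.norm_real, Real.norm_of_nonneg h1.le, div_mul_cancel₀ _ h1.ne']

theorem summable_norm_coef (f : Laurent ρ) : Summable fun k => ‖coef k f‖ :=
  Summable.of_nonneg_of_le (fun _ => norm_nonneg _)
    (fun k => le_mul_of_one_le_right (norm_nonneg _) (one_le_wt k)) (summable_norm_coef_mul f)

/-- The coefficient of `μ^k` as a continuous linear functional. -/
def coefL (k : ℤ) : Laurent ρ →L[ℂ] ℂ :=
  lift (fun j => if j = k then (wt ρ k : ℂ)⁻¹ else 0) 1 fun j => by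
    split_ifs
    · rw [norm_inv, Complex.norm_real, Real.norm_of_nonneg (wt_pos hρ.out k).le]
      exact inv_le_one_of_one_le₀ (one_le_wt k)
    · simp

theorem coefL_apply (k : ℤ) (f : Laurent ρ) : coefL k f = coef k f := by
  refine ((coefL k).hasSum (hasSum_e f)).unique ?_
  have := hasSum_ite_eq k (coef k f)
  refine Eq.mp (congrArg (fun F => HasSum F _) (funext fun j => ?_)) this
  by_cases h : j = k
  · subst h
    simp [coefL, wt_ne j]
  · simp [coefL, h]

theorem coef_e (j k : ℤ) : coef k (e j : Laurent ρ) = if j = k then (wt ρ k : ℂ)⁻¹ else 0 := by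
  rw [← coefL_apply, coefL, lift_e]

/-- Evaluation at a point of the unit circle. -/
def evalL (μ : ℂ) (hμ : ‖μ‖ = 1) : Laurent ρ →L[ℂ] ℂ :=
  lift (fun k => (wt ρ k : ℂ)⁻¹ * μ ^ k) 1 fun k => by
    rw [norm_mul, norm_zpow, hμ, one_zpow, mul_one, norm_inv, Complex.norm_real,
      Real.norm_of_nonneg (wt_pos hρ.out k).le]
    exact inv_le_one_of_one_le₀ (one_le_wt k)

theorem evalL_e (μ : ℂ) (hμ : ‖μ‖ = 1) (k : ℤ) :
    evalL μ hμ (e k : Laurent ρ) = (wt ρ k : ℂ)⁻¹ * μ ^ k := lift_e _ _ _ _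

theorem norm_evalL_le (μ : ℂ) (hμ : ‖μ‖ = 1) (f : Laurent ρ) : ‖evalL μ hμ f‖ ≤ ‖f‖ := by
  refine ((evalL μ hμ).le_opNorm f).trans ?_
  exact mul_le_of_le_one_left (norm_nonneg _) (lift_norm_le _ _ _)

theorem evalL_hasSum (μ : ℂ) (hμ : ‖μ‖ = 1) (f : Laurent ρ) :
    HasSum (fun k => coef k f * μ ^ k) (evalL μ hμ f) := by
  refine Eq.mp (congrArg (fun F => HasSum F _) (funext fun k => ?_))
    ((evalL μ hμ).hasSum (hasSum_e f))
  rw [map_smul, evalL_e, smul_eq_mul, mul_assoc, mul_inv_cancel_left₀ (wt_ne k)]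

theorem evalL_mul (μ : ℂ) (hμ : ‖μ‖ = 1) (f g : Laurent ρ) :
    evalL μ hμ (f * g) = evalL μ hμ f * evalL μ hμ g := by
  have hμ0 : μ ≠ 0 := by rintro rfl; simp at hμ
  have : (ContinuousLinearMap.compL ℂ (Laurent ρ) (Laurent ρ) ℂ (evalL μ hμ)) ∘L mulL ρ
      = ((ContinuousLinearMap.mul ℂ ℂ).bilinearComp (evalL μ hμ) (evalL μ hμ)) := by
    refine ext_clm fun j => ext_clm fun k => ?_
    simp only [ContinuousLinearMap.comp_apply, ContinuousLinearMap.compL_apply, mulL_e, map_smul,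
      evalL_e, ContinuousLinearMap.bilinearComp_apply, ContinuousLinearMap.mul_apply', smul_eq_mul]
    have h1 := wt_ne (ρ := ρ) j
    have h2 := wt_ne (ρ := ρ) k
    have h3 := wt_ne (ρ := ρ) (j + k)
    rw [sc, zpow_add₀ hμ0]
    push_cast
    field_simp
  exact congrArg (fun B => B f g) this

theorem evalL_one (μ : ℂ) (hμ : ‖μ‖ = 1) : evalL μ hμ (1 : Laurent ρ) = 1 := by
  rw [one_def, evalL_e, wt_zero]
  simp

/-- Evaluation at a point of the unit circle, as a ring homomorphism. -/
def evalHom (μ : ℂ) (hμ : ‖μ‖ = 1) : Laurent ρ →+* ℂ where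
  toFun := evalL μ hμ
  map_one' := evalL_one μ hμ
  map_mul' := evalL_mul μ hμ
  map_zero' := map_zero _
  map_add' := map_add _

/-- The substitution `μ ↦ -μ`. -/
def negSubst : Laurent ρ →L[ℂ] Laurent ρ :=
  lift (fun k => ((-1 : ℂ) ^ k) • e k) 1 fun k => by
    rw [norm_smul, norm_e, norm_zpow]
    simp

theorem evalL_negSubst (μ : ℂ) (hμ : ‖μ‖ = 1) (hμ' : ‖-μ‖ = 1) (f : Laurent ρ) :
    evalL μ hμ (negSubst f) = evalL (-μ) hμ' f := by
  have : evalL μ hμ ∘L negSubst (ρ := ρ) = evalL (-μ) hμ' := by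
    refine ext_clm fun k => ?_
    rw [ContinuousLinearMap.comp_apply, negSubst, lift_e, map_smul, evalL_e, evalL_e, smul_eq_mul,
      show -μ = -1 * μ by ring, mul_zpow]
    ring
  exact congrArg (fun B => B f) this

/-- The monomial `μ^k`. -/
def mono (k : ℤ) : Laurent ρ := (wt ρ k : ℂ) • e k

theorem evalL_mono (μ : ℂ) (hμ : ‖μ‖ = 1) (k : ℤ) : evalL μ hμ (mono k : Laurent ρ) = μ ^ k := by
  rw [mono, map_smul, evalL_e, smul_eq_mul, mul_inv_cancel_left₀ (wt_ne k)]

theorem coef_mono_mul (j k : ℤ) (f : Laurent ρ) : coef k (mono j * f) = coef (k - j) f := by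
  have : coefL (ρ := ρ) k ∘L mulL ρ (mono j) = coefL (k - j) := by
    refine ext_clm fun i => ?_
    rw [ContinuousLinearMap.comp_apply, mono, map_smul, _root_.smul_apply, mulL_e, map_smul, map_smul,
      coefL_apply, coefL_apply, coef_e, coef_e]
    by_cases h : j + i = k
    · have h' : i = k - j := by omega
      subst h'
      have h1 := wt_ne (ρ := ρ) j
      have h2 := wt_ne (ρ := ρ) k
      have h3 := wt_ne (ρ := ρ) (k - j)
      rw [if_pos h, if_pos rfl, sc, h]
      simp only [smul_eq_mul]
      push_cast
      field_simp
    · rw [if_neg h, if_neg (by omega)]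
      simp
  rw [← coefL_apply, ← coefL_apply, ← this]
  rfl

end Laurent

/-! ### Uniqueness of Fourier coefficients -/

/-- An absolutely summable Laurent series that vanishes on the unit circle is zero. -/
theorem eq_zero_of_laurent_eq_zero {c : ℤ → ℂ} (hc : Summable fun k => ‖c k‖)
    (h : ∀ μ : ℂ, ‖μ‖ = 1 → HasSum (fun k => c k * μ ^ k) 0) : c = 0 := by
  have : Fact (0 < (1 : ℝ)) := ⟨one_pos⟩
  have hs : Summable fun k => c k • (fourier k : C(AddCircle (1 : ℝ), ℂ)) := by
    refine Summable.of_norm (hc.congr fun k => ?_)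
    rw [norm_smul, fourier_norm, mul_one]
  have h0 : HasSum (fun k => c k • (fourier k : C(AddCircle (1 : ℝ), ℂ))) 0 := by
    have h1 := hs.hasSum
    convert! h1
    ext x
    have h2 := (ContinuousMap.evalCLM ℂ x).hasSum h1
    have h3 := h (fourier 1 x) (by rw [fourier_one]; exact Circle.norm_coe _)
    refine h3.unique ?_
    convert! h2 using 2 with k
    simp [fourier_apply, AddCircle.toCircle_zsmul]
  -- In `L²` the characters are orthonormal, so pairing with the `n`-th one isolates `c n`.
  have h4 := (ContinuousMap.toLp 2 (AddCircle.haarAddCircle (T := 1)) ℂ).hasSum h0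
  funext n
  have h5 := (innerSL ℂ (fourierLp (T := 1) 2 n)).hasSum h4
  refine (HasSum.unique ?_ h5).trans (by simp)
  refine Eq.mp (congrArg (fun F => HasSum F _) (funext fun j => ?_)) (hasSum_ite_eq n (c n))
  rw [map_smul, map_smul]
  have h6 := (orthonormal_iff_ite.1 (orthonormal_fourier (T := 1))) n j
  change _ = c j • inner ℂ (fourierLp 2 n) (fourierLp 2 j)
  rw [h6]
  by_cases hj : j = n
  · simp [hj]
  · simp [hj, Ne.symm hj]

end DPW

namespace DPW

open Set MeasureTheory

/-! ### The logarithm series in a Banach algebra -/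

section Log

variable {𝔸 : Type*} [NormedRing 𝔸]

/-- Telescoping. The factor `k + 1` is what the denominators of the logarithm series cancel later.
-/
theorem norm_pow_succ_sub_pow_succ_le {N N' : 𝔸} {r : ℝ} (h : ‖N‖ ≤ r) (h' : ‖N'‖ ≤ r) (k : ℕ) :
    ‖N ^ (k + 1) - N' ^ (k + 1)‖ ≤ (k + 1) * r ^ k * ‖N - N'‖ := by
  have hr : 0 ≤ r := (norm_nonneg _).trans h
  induction k with
  | zero => simp
  | succ k ih =>
    have h1 : N ^ (k + 1 + 1) - N' ^ (k + 1 + 1)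
        = N * (N ^ (k + 1) - N' ^ (k + 1)) + (N - N') * N' ^ (k + 1) := by
      rw [mul_sub, sub_mul, ← pow_succ', ← pow_succ']
      abel
    have h2 : ‖N' ^ (k + 1)‖ ≤ r ^ (k + 1) :=
      (norm_pow_le' N' k.succ_pos).trans (pow_le_pow_left₀ (norm_nonneg _) h' _)
    rw [h1]
    calc _ ≤ ‖N‖ * ‖N ^ (k + 1) - N' ^ (k + 1)‖ + ‖N - N'‖ * ‖N' ^ (k + 1)‖ :=
          (norm_add_le _ _).trans (add_le_add (norm_mul_le _ _) (norm_mul_le _ _))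
      _ ≤ r * ((k + 1) * r ^ k * ‖N - N'‖) + ‖N - N'‖ * r ^ (k + 1) := by gcongr
      _ = _ := by push_cast; ring

variable [NormedAlgebra ℂ 𝔸]

/-- The logarithm series `log (1 + N) = N - N²/2 + N³/3 - …`. -/
def logOneAdd (N : 𝔸) : 𝔸 := ∑' k : ℕ, ((-1) ^ k / (k + 1) : ℂ) • N ^ (k + 1)

theorem norm_log_coeff (k : ℕ) : ‖((-1) ^ k / (k + 1) : ℂ)‖ = 1 / (k + 1 : ℝ) := by
  rw [norm_div, norm_pow, norm_neg, norm_one, one_pow]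
  congr 1
  exact_mod_cast Complex.norm_natCast (k + 1)

theorem logOneAdd_zero : logOneAdd (0 : 𝔸) = 0 := by simp [logOneAdd]

variable [CompleteSpace 𝔸]

theorem summable_logOneAdd {N : 𝔸} (h : ‖N‖ < 1) :
    Summable fun k : ℕ => ((-1) ^ k / (k + 1) : ℂ) • N ^ (k + 1) := by
  refine Summable.of_norm_bounded (summable_geometric_of_lt_one (norm_nonneg N) h) fun k => ?_
  rw [norm_smul, norm_log_coeff]
  have h1 : ‖N ^ (k + 1)‖ ≤ ‖N‖ ^ k := (norm_pow_le' N k.succ_pos).trans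
    (pow_le_pow_of_le_one (norm_nonneg _) h.le k.le_succ)
  have h2 : 1 / (k + 1 : ℝ) ≤ 1 := (div_le_one (by positivity)).2 (by simp)
  calc 1 / (k + 1 : ℝ) * ‖N ^ (k + 1)‖ ≤ 1 * ‖N‖ ^ k := by gcongr
    _ = _ := one_mul _

/-- The terms with `k = 0` are `N` and `N'`; what remains is dominated by the geometric series `∑
r^(k+1)`. Thus the logarithm is the identity up to a Lipschitz error, which yields both its
injectivity near `0` and its strict derivative at `0`. -/
theorem norm_logOneAdd_sub_le {N N' : 𝔸} {r : ℝ} (hr : r < 1) (h : ‖N‖ ≤ r) (h' : ‖N'‖ ≤ r) :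
    ‖logOneAdd N - logOneAdd N' - (N - N')‖ ≤ r / (1 - r) * ‖N - N'‖ := by
  have hr0 : 0 ≤ r := (norm_nonneg _).trans h
  have hs := summable_logOneAdd (h.trans_lt hr)
  have hs' := summable_logOneAdd (h'.trans_lt hr)
  have hd := hs.sub hs'
  have h1 : logOneAdd N - logOneAdd N' - (N - N')
      = ∑' k : ℕ, (((-1) ^ (k + 1) / ((k + 1 : ℕ) + 1) : ℂ) • N ^ (k + 1 + 1) -
        ((-1) ^ (k + 1) / ((k + 1 : ℕ) + 1) : ℂ) • N' ^ (k + 1 + 1)) := by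
    rw [logOneAdd, logOneAdd, ← hs.tsum_sub hs', hd.tsum_eq_zero_add]
    simp
  have hg : Summable fun k : ℕ => r ^ (k + 1) * ‖N - N'‖ :=
    ((summable_geometric_of_lt_one hr0 hr).mul_left r |>.congr fun k => by
      rw [pow_succ']).mul_right _
  have hb : ∀ k : ℕ, ‖((-1) ^ (k + 1) / ((k + 1 : ℕ) + 1) : ℂ) • N ^ (k + 1 + 1) -
        ((-1) ^ (k + 1) / ((k + 1 : ℕ) + 1) : ℂ) • N' ^ (k + 1 + 1)‖ ≤ r ^ (k + 1) * ‖N - N'‖ := by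
    intro k
    rw [← smul_sub, norm_smul, norm_log_coeff]
    have h2 := norm_pow_succ_sub_pow_succ_le h h' (k + 1)
    have h3 : (0 : ℝ) < (k + 1 : ℕ) + 1 := by positivity
    calc _ ≤ 1 / (((k + 1 : ℕ) : ℝ) + 1) * ((((k + 1 : ℕ) : ℝ) + 1) * r ^ (k + 1) * ‖N - N'‖) := by
          gcongr
      _ = _ := by field_simp
  rw [h1]
  refine (tsum_of_norm_bounded hg.hasSum hb).trans (le_of_eq ?_)
  rw [tsum_mul_right]
  congr 1
  simp_rw [pow_succ']
  rw [tsum_mul_left, tsum_geometric_of_lt_one hr0 hr, div_eq_mul_inv]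

theorem logOneAdd_injOn {N N' : 𝔸} {r : ℝ} (hr : r < 1 / 2) (h : ‖N‖ ≤ r) (h' : ‖N'‖ ≤ r)
    (he : logOneAdd N = logOneAdd N') : N = N' := by
  have h1 := norm_logOneAdd_sub_le (by linarith) h h'
  rw [he, sub_self, zero_sub, norm_neg] at h1
  have h2 : r / (1 - r) < 1 := by
    rw [div_lt_one] <;> linarith
  rw [← sub_eq_zero, ← norm_le_zero_iff]
  nlinarith [norm_nonneg (N - N')]

theorem hasStrictFDerivAt_logOneAdd :
    HasStrictFDerivAt (logOneAdd : 𝔸 → 𝔸) (ContinuousLinearMap.id ℂ 𝔸) 0 := by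
  refine .of_isLittleO (Asymptotics.IsLittleO.of_bound fun c hc => ?_)
  obtain ⟨r, hr0, hr1, hrc⟩ : ∃ r : ℝ, 0 < r ∧ r < 1 ∧ r / (1 - r) ≤ c := by
    -- The solution of `r / (1 - r) = c`.
    refine ⟨c / (1 + c), by positivity, ?_, ?_⟩
    · rw [div_lt_one] <;> linarith
    · have : 1 - c / (1 + c) = 1 / (1 + c) := by field_simp; ring
      rw [this]
      field_simp
      rfl
  have h1 : ∀ᶠ p : 𝔸 × 𝔸 in nhds (0, 0), ‖p.1‖ ≤ r ∧ ‖p.2‖ ≤ r := by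
    have : ∀ᶠ p : 𝔸 × 𝔸 in nhds (0 : 𝔸 × 𝔸), ‖p‖ < r := by
      have := Metric.ball_mem_nhds (0 : 𝔸 × 𝔸) hr0
      filter_upwards [this] with p hp
      simpa using hp
    filter_upwards [this] with p hp
    exact ⟨(norm_fst_le p).trans hp.le, (norm_snd_le p).trans hp.le⟩
  filter_upwards [h1] with p hp
  refine (norm_logOneAdd_sub_le hr1 hp.1 hp.2).trans ?_
  gcongr

/-- Only additivity and compatibility with the individual terms are required, so that
conjugate-linear maps (entrywise conjugation, adjoint) and product-reversing maps (adjoint,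
adjugate) are covered. -/
theorem map_logOneAdd {𝔹 : Type*} [NormedRing 𝔹] [NormedAlgebra ℂ 𝔹] (φ : 𝔸 →+ 𝔹)
    (hφ : Continuous φ) {N : 𝔸} (h : ‖N‖ < 1)
    (hφ' : ∀ k : ℕ, φ (((-1) ^ k / (k + 1) : ℂ) • N ^ (k + 1))
      = ((-1) ^ k / (k + 1) : ℂ) • φ N ^ (k + 1)) :
    φ (logOneAdd N) = logOneAdd (φ N) := by
  have h1 := (summable_logOneAdd h).hasSum.map φ hφ
  rw [logOneAdd, logOneAdd, ← h1.tsum_eq]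
  exact tsum_congr hφ'

end Log

/-! ### The algebra of paths -/

/-- The Banach algebra of continuous functions on `[0,1]` with values in `𝔸`. -/
def PathAlg (𝔸 : Type*) [NormedRing 𝔸] : Type _ := C(Icc (0 : ℝ) 1, 𝔸)

namespace PathAlg

variable {𝔸 : Type*} [NormedRing 𝔸]

instance : FunLike (PathAlg 𝔸) (Icc (0 : ℝ) 1) 𝔸 :=
  inferInstanceAs (FunLike C(Icc (0 : ℝ) 1, 𝔸) (Icc (0 : ℝ) 1) 𝔸)

instance : NormedRing (PathAlg 𝔸) := inferInstanceAs (NormedRing C(Icc (0 : ℝ) 1, 𝔸))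

instance [NormedAlgebra ℂ 𝔸] : NormedAlgebra ℂ (PathAlg 𝔸) :=
  inferInstanceAs (NormedAlgebra ℂ C(Icc (0 : ℝ) 1, 𝔸))

instance [CompleteSpace 𝔸] : CompleteSpace (PathAlg 𝔸) :=
  inferInstanceAs (CompleteSpace C(Icc (0 : ℝ) 1, 𝔸))

/-- The element of the path algebra given by a continuous function. -/
def mk (f : Icc (0 : ℝ) 1 → 𝔸) (hf : Continuous f) : PathAlg 𝔸 :=
  (⟨f, hf⟩ : C(Icc (0 : ℝ) 1, 𝔸))

@[simp]
theorem mk_apply (f : Icc (0 : ℝ) 1 → 𝔸) (hf : Continuous f) (s : Icc (0 : ℝ) 1) :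
    mk f hf s = f s := rfl

@[ext]
theorem ext {f g : PathAlg 𝔸} (h : ∀ s, f s = g s) : f = g := DFunLike.ext _ _ h

@[simp] theorem add_apply (f g : PathAlg 𝔸) (s) : (f + g) s = f s + g s := rfl
@[simp] theorem sub_apply (f g : PathAlg 𝔸) (s) : (f - g) s = f s - g s := rfl
@[simp] theorem mul_apply (f g : PathAlg 𝔸) (s) : (f * g) s = f s * g s := rfl
@[simp] theorem one_apply (s) : (1 : PathAlg 𝔸) s = 1 := rfl
@[simp] theorem zero_apply (s) : (0 : PathAlg 𝔸) s = 0 := rfl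
@[simp] theorem smul_apply [NormedAlgebra ℂ 𝔸] (c : ℂ) (f : PathAlg 𝔸) (s) :
    (c • f) s = c • f s := rfl

theorem continuous (f : PathAlg 𝔸) : Continuous f := ContinuousMap.continuous f

theorem norm_apply_le (f : PathAlg 𝔸) (s) : ‖f s‖ ≤ ‖f‖ := ContinuousMap.norm_coe_le_norm f s

theorem norm_le {f : PathAlg 𝔸} {C : ℝ} (hC : 0 ≤ C) (h : ∀ s, ‖f s‖ ≤ C) : ‖f‖ ≤ C :=
  (ContinuousMap.norm_le f hC).2 h

/-- Evaluation at a point of `[0,1]`. -/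
def evalAt [NormedAlgebra ℂ 𝔸] (s : Icc (0 : ℝ) 1) : PathAlg 𝔸 →L[ℂ] 𝔸 :=
  LinearMap.mkContinuous
    { toFun := fun f => f s, map_add' := fun _ _ => rfl, map_smul' := fun _ _ => rfl } 1
    fun f => by rw [one_mul]; exact norm_apply_le f s

@[simp]
theorem evalAt_apply [NormedAlgebra ℂ 𝔸] (s : Icc (0 : ℝ) 1) (f : PathAlg 𝔸) :
    evalAt s f = f s := rfl

theorem continuous_extend (f : PathAlg 𝔸) :
    Continuous fun u : ℝ => f (projIcc 0 1 zero_le_one u) :=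
  f.continuous.comp continuous_projIcc

end PathAlg

/-! ### The time-ordered exponential of a small coefficient -/

section Ode

variable {𝔸 : Type*} [NormedRing 𝔸] [NormedAlgebra ℂ 𝔸]

/-- The Volterra operator `f ↦ ∫₀ˢ f`. -/
def volterra : PathAlg 𝔸 →L[ℂ] PathAlg 𝔸 :=
  LinearMap.mkContinuous
    { toFun := fun f => .mk (fun s : Icc (0 : ℝ) 1 => ∫ u in (0 : ℝ)..s, f (projIcc 0 1 zero_le_one u))
        ((intervalIntegral.continuous_primitive
          (fun a b => (PathAlg.continuous_extend f).intervalIntegrable a b) 0).comp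
          continuous_subtype_val)
      map_add' := fun f g => by
        ext s
        exact intervalIntegral.integral_add ((PathAlg.continuous_extend f).intervalIntegrable _ _)
          ((PathAlg.continuous_extend g).intervalIntegrable _ _)
      map_smul' := fun c f => by
        ext s
        exact intervalIntegral.integral_smul c _ } 1 fun f => by
    rw [one_mul]
    refine PathAlg.norm_le (norm_nonneg f) fun s => ?_
    refine (intervalIntegral.norm_integral_le_of_norm_le_const (C := ‖f‖)
      fun u _ => f.norm_apply_le _).trans ?_
    rw [sub_zero, abs_of_nonneg s.2.1]
    exact mul_le_of_le_one_right (norm_nonneg _) s.2.2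

theorem norm_volterra_le : ‖(volterra : PathAlg 𝔸 →L[ℂ] PathAlg 𝔸)‖ ≤ 1 :=
  LinearMap.mkContinuous_norm_le _ zero_le_one _

/-- The operator `f ↦ ∫₀ˢ f B`. -/
def volterraMul : PathAlg 𝔸 →L[ℂ] PathAlg 𝔸 →L[ℂ] PathAlg 𝔸 :=
  (ContinuousLinearMap.compL ℂ _ _ _ volterra) ∘L (ContinuousLinearMap.mul ℂ (PathAlg 𝔸)).flip

theorem volterraMul_apply (B f : PathAlg 𝔸) : volterraMul B f = volterra (f * B) := rfl

theorem norm_volterraMul_le (B : PathAlg 𝔸) : ‖volterraMul B‖ ≤ ‖B‖ := by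
  refine ContinuousLinearMap.opNorm_le_bound _ (norm_nonneg _) fun f => ?_
  rw [volterraMul_apply]
  refine (volterra.le_opNorm _).trans ?_
  calc _ ≤ 1 * (‖f‖ * ‖B‖) := by
        gcongr
        · exact norm_volterra_le
        · exact norm_mul_le _ _
    _ = _ := by ring

/-- The solution of `Y' = Y B`, `Y 0 = 1` for a small continuous coefficient `B`. -/
def odeSol (B : PathAlg 𝔸) : PathAlg 𝔸 :=
  Ring.inverse (1 - volterraMul B) 1

/-- The end value of the solution of `Y' = Y B`, `Y 0 = 1`. -/
def odeEnd (B : PathAlg 𝔸) : 𝔸 := odeSol B ⟨1, by simp⟩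

/-- The integral over `[0,1]`. -/
def totalInt : PathAlg 𝔸 →L[ℂ] 𝔸 :=
  (PathAlg.evalAt (⟨1, by simp⟩ : Icc (0 : ℝ) 1)) ∘L volterra

theorem totalInt_apply (f : PathAlg 𝔸) :
    totalInt f = ∫ u in (0 : ℝ)..1, f (projIcc 0 1 zero_le_one u) := rfl

theorem odeEnd_zero : odeEnd (0 : PathAlg 𝔸) = 1 := by
  have h : volterraMul (0 : PathAlg 𝔸) = 0 := map_zero _
  rw [odeEnd, odeSol, h, sub_zero, Ring.inverse_one]
  rfl

/-- The solution of `Y' = Y B`, `Y 0 = 1`, as a function on the line. -/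
def odeFun (B : PathAlg 𝔸) (s : ℝ) : 𝔸 :=
  1 + ∫ u in (0 : ℝ)..s, (odeSol B * B) (projIcc 0 1 zero_le_one u)

theorem odeFun_zero (B : PathAlg 𝔸) : odeFun B 0 = 1 := by simp [odeFun]

/-- The logarithm of the end value of the solution of `Y' = Y B`, `Y 0 = 1`. -/
def odeLog (B : PathAlg 𝔸) : 𝔸 := logOneAdd (odeEnd B - 1)

theorem odeLog_zero : odeLog (0 : PathAlg 𝔸) = 0 := by
  rw [odeLog, odeEnd_zero, sub_self, logOneAdd_zero]

variable [CompleteSpace 𝔸]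

/-- Since `‖volterraMul B‖ ≤ ‖B‖ < 1`, the operator `1 - volterraMul B` is invertible by the Neumann
series. Applying it to its inverse at the constant path `1` is the integral equation. -/
theorem odeSol_eq {B : PathAlg 𝔸} (hB : ‖B‖ < 1) :
    odeSol B = 1 + volterra (odeSol B * B) := by
  have h : IsUnit (1 - volterraMul B) :=
    isUnit_one_sub_of_norm_lt_one ((norm_volterraMul_le B).trans_lt hB)
  have h1 := congrArg (fun T : PathAlg 𝔸 →L[ℂ] PathAlg 𝔸 => T 1)
    (Ring.mul_inverse_cancel _ h)
  have h2 : odeSol B - volterra (odeSol B * B) = 1 := h1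
  rw [← h2]
  abel

/-- Inversion has derivative `-id` at `1`, so the inverse of `1 - volterraMul B`, applied to `1`,
has derivative `B ↦ ∫₀ˢ B`; evaluate at `s = 1`. -/
theorem hasStrictFDerivAt_odeEnd :
    HasStrictFDerivAt (odeEnd : PathAlg 𝔸 → 𝔸) totalInt 0 := by
  have h1 : HasStrictFDerivAt (fun B : PathAlg 𝔸 => 1 - volterraMul B)
      (-volterraMul) 0 := by
    exact (volterraMul (𝔸 := 𝔸)).hasStrictFDerivAt.const_sub 1
  have h2 := hasStrictFDerivAt_ringInverse (𝕜 := ℂ)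
    (1 : (PathAlg 𝔸 →L[ℂ] PathAlg 𝔸)ˣ)
  have h3 : ((1 : (PathAlg 𝔸 →L[ℂ] PathAlg 𝔸)ˣ) :
      PathAlg 𝔸 →L[ℂ] PathAlg 𝔸) = 1 - volterraMul (0 : PathAlg 𝔸) := by
    simp
  rw [h3] at h2
  have h4 := h2.comp (0 : PathAlg 𝔸) h1
  have h5 := ((PathAlg.evalAt (⟨1, by simp⟩ : Icc (0 : ℝ) 1)) ∘L
    ((ContinuousLinearMap.apply ℂ (PathAlg 𝔸)) (1 : PathAlg 𝔸))).hasStrictFDerivAt.comp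
    (0 : PathAlg 𝔸) h4
  refine h5.congr_fderiv ?_
  ext B
  simp [totalInt, volterraMul_apply, ContinuousLinearMap.mulLeftRight_apply]

theorem odeFun_eq {B : PathAlg 𝔸} (hB : ‖B‖ < 1) (s : Icc (0 : ℝ) 1) :
    odeFun B s = odeSol B s := by
  conv_rhs => rw [odeSol_eq hB]
  rfl

theorem odeFun_one {B : PathAlg 𝔸} (hB : ‖B‖ < 1) : odeFun B 1 = odeEnd B :=
  odeFun_eq hB ⟨1, by simp⟩

/-- The integrand is extended beyond `[0,1]` by its end values, so it is continuous on the line and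
the derivative is two-sided even at the end points. -/
theorem hasDerivAt_odeFun {B : PathAlg 𝔸} (hB : ‖B‖ < 1) (s : Icc (0 : ℝ) 1) :
    HasDerivAt (odeFun B) (odeFun B s * B s) s := by
  have h := PathAlg.continuous_extend (odeSol B * B)
  have h1 := (intervalIntegral.integral_hasDerivAt_right (h.intervalIntegrable 0 s)
    h.stronglyMeasurable.stronglyMeasurableAtFilter h.continuousAt).const_add (1 : 𝔸)
  refine h1.congr_deriv ?_
  rw [odeFun_eq hB, projIcc_val]
  rfl

theorem hasStrictFDerivAt_odeLog :
    HasStrictFDerivAt (odeLog : PathAlg 𝔸 → 𝔸) totalInt 0 := by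
  have h1 : HasStrictFDerivAt (fun B : PathAlg 𝔸 => odeEnd B - 1) totalInt 0 := by
    exact (hasStrictFDerivAt_odeEnd (𝔸 := 𝔸)).sub_const 1
  have h2 : HasStrictFDerivAt (logOneAdd : 𝔸 → 𝔸) (ContinuousLinearMap.id ℂ 𝔸)
      (odeEnd (0 : PathAlg 𝔸) - 1) := by
    rw [odeEnd_zero, sub_self]
    exact hasStrictFDerivAt_logOneAdd
  exact (h2.comp (0 : PathAlg 𝔸) h1).congr_fderiv (by ext; rfl)

/-- For small coefficients the solution exists, its end value is close to `1`, and the logarithm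
of the end value differs from the integral of the coefficient by a map of small Lipschitz
constant. -/
theorem exists_odeLog_approx {c : ℝ} (hc : 0 < c) {κ : ℝ} (hκ : 0 < κ) :
    ∃ r > 0, r ≤ 1 ∧ ∀ B B' : PathAlg 𝔸, ‖B‖ < r → ‖B'‖ < r →
      ‖odeEnd B - 1‖ < κ ∧ ‖odeLog B - odeLog B' - totalInt (B - B')‖ ≤ c * ‖B - B'‖ := by
  have h1 := (hasStrictFDerivAt_odeLog (𝔸 := 𝔸)).isLittleO.def hc
  have h2 : ∀ᶠ B : PathAlg 𝔸 in nhds 0, ‖odeEnd B - 1‖ < κ := by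
    have h3 := (hasStrictFDerivAt_odeEnd (𝔸 := 𝔸)).continuousAt
    have h4 := Metric.tendsto_nhds.1 h3 κ hκ
    filter_upwards [h4] with B hB
    rwa [odeEnd_zero, dist_eq_norm] at hB
  obtain ⟨r₁, hr₁, H₁⟩ := Metric.eventually_nhds_iff.1 h1
  obtain ⟨r₂, hr₂, H₂⟩ := Metric.eventually_nhds_iff.1 h2
  -- The cap `1` keeps the coefficients in the range where the integral equation is solvable.
  refine ⟨min 1 (min r₁ r₂), by positivity, min_le_left _ _, fun B B' hB hB' => ⟨?_, ?_⟩⟩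
  · refine H₂ ?_
    rw [dist_zero_right]
    exact hB.trans_le ((min_le_right _ _).trans (min_le_right _ _))
  · refine H₁ (y := (B, B')) ?_
    have h5 : min 1 (min r₁ r₂) ≤ r₁ := (min_le_right _ _).trans (min_le_left _ _)
    rw [Prod.dist_eq, max_lt_iff]
    exact ⟨by simpa using hB.trans_le h5, by simpa using hB'.trans_le h5⟩

end Ode

end DPW

namespace DPW

open Matrix
open scoped Matrix.Norms.Operator ComplexConjugate

/-! ### Two by two matrices near the identity -/

section TwoByTwo

variable {R : Type*} [NormedRing R]

theorem norm_entry_le (A : Matrix (Fin 2) (Fin 2) R) (i j : Fin 2) : ‖A i j‖ ≤ ‖A‖ := by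
  rw [linfty_opNorm_def]
  have h1 : ‖A i j‖₊ ≤ ∑ k, ‖A i k‖₊ :=
    Finset.single_le_sum (f := fun k => ‖A i k‖₊) (fun _ _ => zero_le) (Finset.mem_univ j)
  have h2 : ∑ k, ‖A i k‖₊ ≤ Finset.univ.sup fun i => ∑ k, ‖A i k‖₊ :=
    Finset.le_sup (f := fun i => ∑ k, ‖A i k‖₊) (Finset.mem_univ i)
  exact_mod_cast h1.trans h2

theorem norm_le_of_entry_le {A : Matrix (Fin 2) (Fin 2) R} {c : ℝ} (hc : 0 ≤ c)
    (h : ∀ i j, ‖A i j‖ ≤ c) : ‖A‖ ≤ 2 * c := by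
  lift c to NNReal using hc
  rw [linfty_opNorm_def]
  have : (Finset.univ.sup fun i => ∑ k, ‖A i k‖₊) ≤ 2 * c := by
    refine Finset.sup_le fun i _ => ?_
    rw [Fin.sum_univ_two, two_mul]
    exact add_le_add (h i 0) (h i 1)
  exact_mod_cast this

end TwoByTwo

theorem matLog_eq (M : Matrix (Fin 2) (Fin 2) ℂ) : matLog M = logOneAdd (M - 1) := rfl

/-- The adjugate of a two by two matrix, as an additive map. -/
def adjHom : Matrix (Fin 2) (Fin 2) ℂ →+ Matrix (Fin 2) (Fin 2) ℂ where
  toFun := adjugate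
  map_zero' := by simp
  map_add' A B := by
    ext i j; fin_cases i <;> fin_cases j <;> simp [adjugate_fin_two, add_comm]

theorem adjHom_apply (A : Matrix (Fin 2) (Fin 2) ℂ) : adjHom A = adjugate A := rfl

/-- In size two the adjugate is linear. It reverses products, which does not matter for powers of
one matrix. -/
theorem logOneAdd_adjugate {N : Matrix (Fin 2) (Fin 2) ℂ} (h : ‖N‖ < 1) :
    logOneAdd (adjugate N) = adjugate (logOneAdd N) := by
  refine (map_logOneAdd adjHom ?_ h fun k => ?_).symm
  · exact continuous_id.matrix_adjugate
  · rw [adjHom_apply, adjHom_apply, adjugate_smul, adjugate_pow]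
    simp

theorem star_log_coeff (k : ℕ) :
    conj ((-1) ^ k / (k + 1) : ℂ) = ((-1) ^ k / (k + 1) : ℂ) := by
  simp

theorem logOneAdd_conjTranspose {N : Matrix (Fin 2) (Fin 2) ℂ} (h : ‖N‖ < 1) :
    logOneAdd Nᴴ = (logOneAdd N)ᴴ := by
  refine (map_logOneAdd (conjTransposeAddEquiv (Fin 2) (Fin 2) ℂ).toAddMonoidHom ?_ h
    fun k => ?_).symm
  · exact continuous_id.matrix_conjTranspose
  · change (_ • _)ᴴ = _ • (Nᴴ) ^ (k + 1)
    rw [conjTranspose_smul, conjTranspose_pow]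
    congr 1
    exact star_log_coeff k

theorem logOneAdd_map_conj {N : Matrix (Fin 2) (Fin 2) ℂ} (h : ‖N‖ < 1) :
    logOneAdd (N.map conj) = (logOneAdd N).map conj := by
  refine (map_logOneAdd ((starRingEnd ℂ).mapMatrix : Matrix (Fin 2) (Fin 2) ℂ →+* _).toAddMonoidHom
    ?_ h fun k => ?_).symm
  · exact continuous_id.matrix_map Complex.continuous_conj
  · change (starRingEnd ℂ).mapMatrix _ = _ • ((starRingEnd ℂ).mapMatrix N) ^ (k + 1)
    rw [← map_pow]
    ext i j
    simp

/-- Conjugation by `diag (1, -1)`. -/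
def flipSign (A : Matrix (Fin 2) (Fin 2) ℂ) : Matrix (Fin 2) (Fin 2) ℂ :=
  !![1, 0; 0, -1] * A * !![1, 0; 0, -1]

theorem flipSign_eq (A : Matrix (Fin 2) (Fin 2) ℂ) :
    flipSign A = !![A 0 0, -A 0 1; -A 1 0, A 1 1] := by
  ext i j
  simp only [flipSign, Matrix.mul_apply, Fin.sum_univ_two]
  fin_cases i <;> fin_cases j <;> simp

theorem flipSign_pow (A : Matrix (Fin 2) (Fin 2) ℂ) (k : ℕ) :
    flipSign (A ^ k) = flipSign A ^ k := by
  have h : (!![1, 0; 0, -1] : Matrix (Fin 2) (Fin 2) ℂ) * !![1, 0; 0, -1] = 1 := by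
    ext i j; fin_cases i <;> fin_cases j <;> simp
  induction k with
  | zero => simp [flipSign, h]
  | succ k ih =>
    rw [pow_succ, pow_succ, ← ih]
    simp only [flipSign]
    calc _ = !![1, 0; 0, -1] * A ^ k * 1 * A * !![1, 0; 0, -1] := by simp [mul_assoc]
      _ = _ := by rw [← h]; simp only [mul_assoc]

theorem logOneAdd_flipSign {N : Matrix (Fin 2) (Fin 2) ℂ} (h : ‖N‖ < 1) :
    logOneAdd (flipSign N) = flipSign (logOneAdd N) := by
  let φ : Matrix (Fin 2) (Fin 2) ℂ →+ Matrix (Fin 2) (Fin 2) ℂ :=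
    { toFun := flipSign
      map_zero' := by simp [flipSign]
      map_add' := fun A B => by rw [flipSign, flipSign, flipSign, mul_add, add_mul] }
  refine (map_logOneAdd φ ?_ h fun k => ?_).symm
  · exact (continuous_const.matrix_mul continuous_id).matrix_mul continuous_const
  · change flipSign _ = _ • flipSign N ^ (k + 1)
    rw [← flipSign_pow]
    rw [flipSign, flipSign, Matrix.mul_smul, Matrix.smul_mul]

theorem flipSign_eq_self_iff (A : Matrix (Fin 2) (Fin 2) ℂ) :
    flipSign A = A ↔ A 0 1 = 0 ∧ A 1 0 = 0 := by
  rw [flipSign_eq]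
  constructor
  · intro h
    have h1 := congrFun₂ h 0 1
    have h2 := congrFun₂ h 1 0
    simp only [of_apply, cons_val', cons_val_zero, cons_val_one, cons_val_fin_one] at h1 h2
    exact ⟨self_eq_neg.1 h1.symm, self_eq_neg.1 h2.symm⟩
  · rintro ⟨h1, h2⟩
    ext i j; fin_cases i <;> fin_cases j <;> simp [h1, h2]

/-- The trace of the powers of a two by two matrix in terms of its eigenvalues. -/
theorem trace_pow_eq {N : Matrix (Fin 2) (Fin 2) ℂ} {α β : ℂ} (h1 : α + β = N.trace)
    (h2 : α * β = N.det) (k : ℕ) : (N ^ k).trace = α ^ k + β ^ k := by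
  -- Cayley–Hamilton; it gives a two-step recursion, hence the induction on pairs of consecutive
  -- powers.
  have hN : N * N = (α + β) • N - (α * β) • (1 : Matrix (Fin 2) (Fin 2) ℂ) := by
    rw [h1, h2, trace_fin_two, det_fin_two]
    ext i j
    fin_cases i <;> fin_cases j <;> simp [mul_apply, Fin.sum_univ_two] <;> ring
  have hk : ∀ k : ℕ, (N ^ k).trace = α ^ k + β ^ k ∧ (N ^ (k + 1)).trace = α ^ (k + 1) + β ^ (k + 1) := by
    intro k
    induction k with
    | zero => simp [h1]; norm_num
    | succ k ih =>
      refine ⟨ih.2, ?_⟩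
      rw [pow_succ, pow_succ, mul_assoc, hN, mul_sub, Matrix.mul_smul, Matrix.mul_smul, ← pow_succ, mul_one,
        trace_sub, trace_smul, trace_smul, ih.1, ih.2]
      simp only [smul_eq_mul]
      ring
  exact (hk k).1

/-- Entries of size at most `1/8` give `|tr| ≤ 1/4` and `|det| ≤ 1/32`, and `α² = tr · α - det` then
excludes `|α| ≥ 1/2`. -/
theorem norm_lt_half_of_root {N : Matrix (Fin 2) (Fin 2) ℂ} (hN : ‖N‖ ≤ 1 / 8) {α β : ℂ}
    (h1 : α + β = N.trace) (h2 : α * β = N.det) : ‖α‖ < 1 / 2 := by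
  have hij := fun i j => (norm_entry_le N i j).trans hN
  have ht : ‖N.trace‖ ≤ 1 / 4 := by
    rw [trace_fin_two]
    linarith [norm_add_le (N 0 0) (N 1 1), hij 0 0, hij 1 1]
  have hm : ∀ i j k l, ‖N i j * N k l‖ ≤ 1 / 64 := fun i j k l => by
    rw [norm_mul]
    nlinarith [hij i j, hij k l, norm_nonneg (N i j), norm_nonneg (N k l)]
  have hd : ‖N.det‖ ≤ 1 / 32 := by
    rw [det_fin_two]
    linarith [norm_sub_le (N 0 0 * N 1 1) (N 0 1 * N 1 0), hm 0 0 1 1, hm 0 1 1 0]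
  have h3 : α ^ 2 = N.trace * α - N.det := by rw [← h1, ← h2]; ring
  have h4 : ‖α‖ ^ 2 ≤ 1 / 4 * ‖α‖ + 1 / 32 := by
    rw [← norm_pow, h3]
    refine (norm_sub_le _ _).trans ?_
    rw [norm_mul]
    nlinarith [norm_nonneg α]
  nlinarith [norm_nonneg α]

theorem hasSum_log_coeff {α : ℂ} (h : ‖α‖ < 1) :
    HasSum (fun k : ℕ => ((-1) ^ k / (k + 1) : ℂ) * α ^ (k + 1)) (Complex.log (1 + α)) := by
  have h1 := Complex.hasSum_taylorSeries_log h
  rw [← hasSum_nat_add_iff' 1] at h1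
  simp only [Finset.sum_range_one] at h1
  convert! h1 using 1
  · ext k
    push_cast
    ring
  · simp

/-- `tr log M = 0` for a matrix `M` of determinant `1` near the identity. -/
theorem trace_logOneAdd {N : Matrix (Fin 2) (Fin 2) ℂ} (hN : ‖N‖ ≤ 1 / 8) (hd : (1 + N).det = 1) :
    (logOneAdd N).trace = 0 := by
  -- The eigenvalues `α`, `β` of `N`, from the quadratic formula. No diagonalisation is needed,
  -- since the trace of each power depends on them alone.
  obtain ⟨α, hα⟩ : ∃ α : ℂ, α ^ 2 - N.trace * α + N.det = 0 := by
    obtain ⟨s, hs⟩ := IsAlgClosed.exists_eq_mul_self (N.trace ^ 2 - 4 * N.det)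
    refine ⟨(N.trace + s) / 2, ?_⟩
    linear_combination (-1 / 4) * hs
  obtain ⟨β, hβ⟩ : ∃ β : ℂ, α + β = N.trace := ⟨N.trace - α, by ring⟩
  have hαβ : α * β = N.det := by
    rw [← hβ] at hα
    linear_combination -hα
  have ha := norm_lt_half_of_root hN hβ hαβ
  have hb := norm_lt_half_of_root hN ((add_comm β α).trans hβ) ((mul_comm β α).trans hαβ)
  have h1 : (1 + α) * (1 + β) = 1 := by
    rw [det_fin_two] at hd
    rw [trace_fin_two] at hβ
    rw [det_fin_two] at hαβ
    simp only [Matrix.add_apply, one_apply_eq, ne_eq, zero_ne_one, one_ne_zero, not_false_eq_true,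
      one_apply_ne, zero_add] at hd
    linear_combination hβ + hαβ + hd
  have h2 := (summable_logOneAdd (hN.trans_lt (by norm_num))).hasSum.map
    (traceAddMonoidHom (Fin 2) ℂ) (continuous_id.matrix_trace)
  have h3 := (hasSum_log_coeff (ha.trans (by norm_num))).add (hasSum_log_coeff (hb.trans (by norm_num)))
  have h4 : (logOneAdd N).trace = Complex.log (1 + α) + Complex.log (1 + β) := by
    refine h2.unique ?_
    refine Eq.mp (congrArg (fun F => HasSum F _) (funext fun k => ?_)) h3
    change _ = (_ • _ : Matrix (Fin 2) (Fin 2) ℂ).trace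
    rw [trace_smul, trace_pow_eq hβ hαβ, smul_eq_mul, mul_add]
  have h5 : 1 + β = (1 + α)⁻¹ := eq_inv_of_mul_eq_one_right h1
  rw [h4, h5, Complex.log_inv, add_neg_cancel]
  -- `log z⁻¹ = -log z` could fail only on the negative axis, and `|α| < 1/2` keeps `1 + α` in the
  -- right half-plane.
  intro h6
  have h7 : 0 < (1 + α).re := by
    have := (abs_le.1 (Complex.abs_re_le_norm α)).1
    simp
    linarith
  rw [Complex.arg_eq_pi_iff] at h6
  linarith [h6.1]

/-- The logarithm is trace-free, and on trace-free two by two matrices the adjugate is negation. For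
determinant one this says `log M⁻¹ = -log M`. -/
theorem logOneAdd_adjugate_eq_neg {N : Matrix (Fin 2) (Fin 2) ℂ} (hN : ‖N‖ ≤ 1 / 8)
    (hd : (1 + N).det = 1) : logOneAdd (adjugate N) = -logOneAdd N := by
  have h := trace_logOneAdd hN hd
  rw [trace_fin_two] at h
  rw [logOneAdd_adjugate (hN.trans_lt (by norm_num)), adjugate_fin_two]
  ext i j
  fin_cases i <;> fin_cases j <;> simp
  · linear_combination h
  · linear_combination h

/-- The norm is the maximal row sum, which transposition does not preserve. Passing through the
entries costs a factor two; the result stays below the radius `1/2` of injectivity of the logarithm.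
-/
theorem norm_conjTranspose_le {N : Matrix (Fin 2) (Fin 2) ℂ} (hN : ‖N‖ ≤ 1 / 8) : ‖Nᴴ‖ ≤ 1 / 4 := by
  refine (norm_le_of_entry_le (by norm_num : (0 : ℝ) ≤ 1 / 8) fun i j => ?_).trans (by norm_num)
  rw [conjTranspose_apply, norm_star]
  exact (norm_entry_le N j i).trans hN

theorem norm_adjugate_le {N : Matrix (Fin 2) (Fin 2) ℂ} (hN : ‖N‖ ≤ 1 / 8) :
    ‖adjugate N‖ ≤ 1 / 4 := by
  refine (norm_le_of_entry_le (by norm_num : (0 : ℝ) ≤ 1 / 8) fun i j => ?_).trans (by norm_num)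
  have := fun i j => (norm_entry_le N i j).trans hN
  rw [adjugate_fin_two]
  fin_cases i <;> fin_cases j <;> simp <;> simpa using this _ _

theorem norm_flipSign_le {N : Matrix (Fin 2) (Fin 2) ℂ} (hN : ‖N‖ ≤ 1 / 8) :
    ‖flipSign N‖ ≤ 1 / 4 := by
  refine (norm_le_of_entry_le (by norm_num : (0 : ℝ) ≤ 1 / 8) fun i j => ?_).trans (by norm_num)
  have := fun i j => (norm_entry_le N i j).trans hN
  rw [flipSign_eq]
  fin_cases i <;> fin_cases j <;> simp <;> simpa using this _ _

theorem adjugate_one_add (N : Matrix (Fin 2) (Fin 2) ℂ) : adjugate (1 + N) = 1 + adjugate N := by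
  rw [← adjHom_apply, map_add, adjHom_apply, adjHom_apply, adjugate_one]

/-- A matrix of determinant `1` near the identity is unitary if and only if its logarithm is
skew-hermitian. -/
theorem mem_specialUnitary_iff_log {M : Matrix (Fin 2) (Fin 2) ℂ} (hM : ‖M - 1‖ ≤ 1 / 8)
    (hd : M.det = 1) :
    M ∈ specialUnitaryGroup (Fin 2) ℂ ↔ (matLog M)ᴴ = -matLog M := by
  obtain ⟨N, rfl⟩ : ∃ N, M = 1 + N := ⟨M - 1, by simp⟩
  rw [add_sub_cancel_left] at hM
  have hN1 : ‖N‖ < 1 := hM.trans_lt (by norm_num)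
  rw [matLog_eq, add_sub_cancel_left, ← logOneAdd_conjTranspose hN1,
    ← logOneAdd_adjugate_eq_neg hM hd, mem_specialUnitaryGroup_iff, mem_unitaryGroup_iff']
  constructor
  · rintro ⟨h, -⟩
    have h1 : (1 + N)ᴴ = adjugate (1 + N) := by
      have h2 := mul_adjugate (1 + N)
      rw [hd, one_smul] at h2
      calc (1 + N)ᴴ = star (1 + N) * ((1 + N) * adjugate (1 + N)) := by rw [h2, mul_one]; rfl
        _ = _ := by rw [← mul_assoc, h, one_mul]
    rw [adjugate_one_add, conjTranspose_add, conjTranspose_one, add_right_inj] at h1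
    rw [h1]
  · intro h
    -- Equality of the logarithms of `1 + Nᴴ` and `1 + adjugate N` is undone by injectivity: the
    -- adjoint of `M` is its inverse.
    have h1 := logOneAdd_injOn (by norm_num) (norm_conjTranspose_le hM) (norm_adjugate_le hM) h
    refine ⟨?_, hd⟩
    have h2 : star (1 + N) = adjugate (1 + N) := by
      rw [adjugate_one_add, ← h1, star_eq_conjTranspose, conjTranspose_add, conjTranspose_one]
    rw [h2, adjugate_mul, hd, one_smul]

/-- A matrix near the identity is diagonal if and only if its logarithm is. -/
theorem isDiag_iff_log {M : Matrix (Fin 2) (Fin 2) ℂ} (hM : ‖M - 1‖ ≤ 1 / 8) :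
    M.IsDiag ↔ matLog M 0 1 = 0 ∧ matLog M 1 0 = 0 := by
  have hN1 : ‖M - 1‖ < 1 := hM.trans_lt (by norm_num)
  have h0 : M.IsDiag ↔ (M - 1) 0 1 = 0 ∧ (M - 1) 1 0 = 0 := by
    constructor
    · intro h
      exact ⟨by simpa using h (by decide : (0 : Fin 2) ≠ 1), by simpa using h (by decide : (1 : Fin 2) ≠ 0)⟩
    · rintro ⟨h1, h2⟩ i j hij
      fin_cases i <;> fin_cases j <;> simp_all
  -- A matrix is diagonal exactly when conjugation by `diag (1, -1)` fixes it, and the injective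
  -- logarithm commutes with this conjugation.
  rw [h0, ← flipSign_eq_self_iff, ← flipSign_eq_self_iff, matLog_eq, ← logOneAdd_flipSign hN1]
  constructor
  · intro h
    rw [h]
  · intro h
    exact logOneAdd_injOn (by norm_num) (norm_flipSign_le hM) (hM.trans (by norm_num)) h

/-- Meant for `M = M_0(μ)` and `M' = M_0(conj μ)`: it passes the reflection symmetry of the
monodromy on to its logarithm. -/
theorem matLog_eq_of_conj_eq_adjugate {M M' : Matrix (Fin 2) (Fin 2) ℂ} (hM : ‖M - 1‖ ≤ 1 / 8)
    (hM' : ‖M' - 1‖ ≤ 1 / 8) (hd : M.det = 1) (h : M'.map conj = adjugate M) :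
    (matLog M').map conj = -matLog M := by
  obtain ⟨N, rfl⟩ : ∃ N, M = 1 + N := ⟨M - 1, by simp⟩
  obtain ⟨N', rfl⟩ : ∃ N, M' = 1 + N := ⟨M' - 1, by simp⟩
  rw [add_sub_cancel_left] at hM hM'
  rw [matLog_eq, matLog_eq, add_sub_cancel_left, add_sub_cancel_left,
    ← logOneAdd_map_conj (hM'.trans_lt (by norm_num)), ← logOneAdd_adjugate_eq_neg hM hd]
  rw [adjugate_one_add] at h
  have h1 : N'.map conj = adjugate N := by
    rw [← add_right_inj 1, ← h]
    ext i j
    by_cases hij : i = j <;> simp [one_apply, hij]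
  rw [h1]

end DPW

namespace DPW

open Complex Set
open scoped ComplexConjugate

/-! ### The loops `γ_j` -/

theorem nn_pos (m : ℕ) : (0 : ℝ) < nn m := by
  rw [nn]
  positivity

theorem nn_ne (m : ℕ) : (nn m : ℂ) ≠ 0 := by
  have := (nn_pos m).ne'
  exact_mod_cast this

theorem p_zero (m : ℕ) : p m 0 = 1 := by simp [p]

theorem p_succ (m j : ℕ) : p m (j + 1) = p m 1 * p m j := by
  rw [p, p, p, ← Complex.exp_add]
  congr 1
  push_cast
  ring

theorem p_ne (m j : ℕ) : p m j ≠ 0 := exp_ne_zero _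

theorem p_nn (m : ℕ) : p m (nn m) = 1 := by
  rw [p, mul_div_assoc, div_self (nn_ne m), mul_one, exp_two_pi_mul_I]

theorem γ_eq (m j : ℕ) (s : ℝ) :
    γ m j s = p m j * γ m 0 s := by
  rw [γ, γ, p_zero]
  ring

theorem contDiff_γ (m j : ℕ) : ContDiff ℝ ⊤ (γ m j) := by
  unfold γ
  have h1 : ContDiff ℝ ⊤ fun s : ℝ => (s : ℂ) := ofRealCLM.contDiff
  have h2 : ContDiff ℝ ⊤ fun s : ℝ => ((Real.sin (Real.pi * s) : ℝ) : ℂ) :=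
    ofRealCLM.contDiff.comp (Real.contDiff_sin.comp (contDiff_const.mul contDiff_id))
  have h3 : ContDiff ℝ ⊤ fun s : ℝ => I * Real.pi * (2 * (s : ℂ) - 1) / nn m := by
    have h4 : ContDiff ℝ ⊤ fun s : ℝ => I * Real.pi * (2 * (s : ℂ) - 1) :=
      contDiff_const.mul ((contDiff_const.mul h1).sub contDiff_const)
    exact h4.div_const _
  exact (contDiff_const.mul (contDiff_const.mul h2)).mul h3.cexp

theorem hasDerivAt_γ (m j : ℕ) (s : ℝ) : HasDerivAt (γ m j) (deriv (γ m j) s) s :=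
  ((contDiff_γ m j).differentiable (by simp)).differentiableAt.hasDerivAt

theorem continuous_γ (m j : ℕ) : Continuous (γ m j) := (contDiff_γ m j).continuous

theorem continuous_deriv_γ (m j : ℕ) : Continuous (deriv (γ m j)) :=
  (contDiff_γ m j).continuous_deriv (by simp)

theorem γ_at_zero (m j : ℕ) : γ m j 0 = 0 := by simp [γ]

theorem γ_at_one (m j : ℕ) : γ m j 1 = 0 := by simp [γ]

theorem γ_at_half (m : ℕ) : γ m 0 (1 / 2) = 2 := by
  rw [γ, p_zero]
  have h : Real.pi * (1 / 2) = Real.pi / 2 := by ring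
  rw [h, Real.sin_pi_div_two]
  push_cast
  norm_num

theorem γ_succ (m j : ℕ) : γ m (j + 1) = fun s => p m 1 * γ m j s := by
  funext s
  rw [γ_eq, γ_eq m j, p_succ, mul_assoc]

theorem deriv_γ_succ (m j : ℕ) (s : ℝ) : deriv (γ m (j + 1)) s = p m 1 * deriv (γ m j) s := by
  rw [γ_succ]
  exact ((hasDerivAt_γ m j s).const_mul _).deriv

theorem conj_γ (m : ℕ) (s : ℝ) : conj (γ m 0 s) = γ m 0 (1 - s) := by
  have h : Real.pi * (1 - s) = Real.pi - Real.pi * s := by ring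
  rw [γ, γ, p_zero, h, Real.sin_pi_sub, map_mul, map_mul, map_mul, ← exp_conj, map_div₀, map_mul,
    map_mul, conj_I]
  simp only [map_one, map_ofNat, conj_ofReal, map_sub, map_mul, map_natCast]
  congr 2
  push_cast
  ring

theorem conj_deriv_γ (m : ℕ) (s : ℝ) : conj (deriv (γ m 0) s) = -deriv (γ m 0) (1 - s) := by
  have h1 : HasDerivAt (fun u => conj (γ m 0 u)) (conj (deriv (γ m 0) s)) s :=
    (hasDerivAt_γ m 0 s).star
  have h2 : HasDerivAt (fun u : ℝ => γ m 0 (1 - u)) (-deriv (γ m 0) (1 - s)) s := by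
    have h3 : HasDerivAt (fun u : ℝ => 1 - u) (-1) s := by
      simpa using (hasDerivAt_id s).const_sub 1
    have h4 := (hasDerivAt_γ m 0 (1 - s)).scomp s h3
    simpa [Function.comp_def] using h4
  have h5 : (fun u => conj (γ m 0 u)) = fun u : ℝ => γ m 0 (1 - u) := funext (conj_γ m)
  rw [h5] at h1
  exact h1.unique h2

theorem γ_polar (m j : ℕ) (s : ℝ) : γ m 0 s / p m j =
    ((2 * Real.sin (Real.pi * s) : ℝ) : ℂ) * exp (((Real.pi / nn m * (2 * s - 1 - 2 * j) : ℝ) : ℂ) * I) := by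
  rw [γ, p_zero, p, one_mul, div_eq_mul_inv, ← exp_neg, mul_assoc, ← exp_add]
  push_cast
  congr 2
  have := nn_ne m
  field_simp
  ring

theorem γ_polar_re (m j : ℕ) (s : ℝ) : (γ m 0 s / p m j).re =
    2 * Real.sin (Real.pi * s) * Real.cos (Real.pi / nn m * (2 * s - 1 - 2 * j)) := by
  rw [γ_polar, re_ofReal_mul, exp_ofReal_mul_I_re]

theorem γ_polar_im (m j : ℕ) (s : ℝ) : (γ m 0 s / p m j).im =
    2 * Real.sin (Real.pi * s) * Real.sin (Real.pi / nn m * (2 * s - 1 - 2 * j)) := by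
  rw [γ_polar, im_ofReal_mul, exp_ofReal_mul_I_im]

theorem sin_pi_mul_nonneg {s : ℝ} (hs : s ∈ Icc (0 : ℝ) 1) : 0 ≤ Real.sin (Real.pi * s) :=
  Real.sin_nonneg_of_nonneg_of_le_pi (mul_nonneg Real.pi_pos.le hs.1)
    (mul_le_of_le_one_right Real.pi_pos.le hs.2)

/-- For `j ≠ 0` the loop `γ_0` does not meet the ray from `p_j` to infinity. -/
theorem one_sub_γ_mem_slitPlane (m : ℕ) {j : ℕ} (hj : j ≠ 0) (hjn : j < nn m) {s : ℝ}
    (hs : s ∈ Icc (0 : ℝ) 1) : 1 - γ m 0 s / p m j ∈ slitPlane := by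
  rw [mem_slitPlane_iff]
  by_contra! h
  obtain ⟨h1, h2⟩ := h
  rw [sub_re, one_re] at h1
  rw [sub_im, one_im, zero_sub, neg_eq_zero, γ_polar_im] at h2
  rw [γ_polar_re] at h1
  have hn := nn_pos m
  rcases mul_eq_zero.1 h2 with h3 | h3
  · rw [h3] at h1
    linarith
  · obtain ⟨k, hk⟩ := Real.sin_eq_zero_iff.1 h3
    -- For `1 ≤ j ≤ n - 1` and `s` in `[0,1]` the right side lies strictly between `-2n` and `0`, so
    -- `k = -1` and the cosine is `-1`. The real part of `γ_0(s) / p_j` is then at most `0`, whereas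
    -- leaving the slit plane requires it to be at least `1`.
    have h4 : (k : ℝ) * nn m = 2 * s - 1 - 2 * j := by
      have hk' := hk
      field_simp at hk'
      exact hk'
    have hj1 : (1 : ℝ) ≤ j := by exact_mod_cast Nat.one_le_iff_ne_zero.2 hj
    have hj2 : (j : ℝ) + 1 ≤ nn m := by exact_mod_cast hjn
    have h5 : (k : ℝ) < 0 := by
      by_contra! h6
      nlinarith [hs.2]
    have h6 : (-2 : ℝ) < k := by
      by_contra! h7
      nlinarith [hs.1]
    have h7 : k = -1 := by
      have h8 : k < 0 := by exact_mod_cast h5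
      have h9 : -2 < k := by exact_mod_cast h6
      omega
    rw [← hk, h7] at h1
    simp only [Int.cast_neg, Int.cast_one, neg_mul, one_mul, Real.cos_neg, Real.cos_pi] at h1
    linarith [sin_pi_mul_nonneg hs]

theorem γ_im (m : ℕ) (s : ℝ) : (γ m 0 s).im =
    2 * Real.sin (Real.pi * s) * Real.sin (Real.pi / nn m * (2 * s - 1)) := by
  simpa [p_zero] using γ_polar_im m 0 s

theorem two_le_nn {m : ℕ} : (2 : ℝ) ≤ nn m := by
  rw [nn]
  push_cast
  linarith [(Nat.cast_nonneg m : (0 : ℝ) ≤ m)]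

/-- The loop `γ_0` crosses the real axis only at `0` and `2`. -/
theorem γ_im_eq_zero {m : ℕ} {s : ℝ} (hs : s ∈ Icc (0 : ℝ) 1) (h : (γ m 0 s).im = 0) :
    γ m 0 s = 0 ∨ γ m 0 s = 2 := by
  have hn := nn_pos m
  have hn2 := two_le_nn (m := m)
  rw [γ_im] at h
  rcases mul_eq_zero.1 h with h3 | h3
  · left
    have h4 : Real.sin (Real.pi * s) = 0 := by linarith
    rw [γ, h4]
    simp
  · right
    have h5 : Real.pi / nn m * (2 * s - 1) = 0 := by
      -- As `n ≥ 2`, the angle is at most `π / n < π` in absolute value, so the sine vanishes only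
      -- at angle `0`.
      refine (Real.sin_eq_zero_iff_of_lt_of_lt ?_ ?_).1 h3
      · have : -Real.pi < Real.pi / nn m * (-1) := by
          rw [div_mul_eq_mul_div, lt_div_iff₀ hn]
          nlinarith [Real.pi_pos]
        refine this.trans_le (mul_le_mul_of_nonneg_left (by linarith [hs.1]) (by positivity))
      · have : Real.pi / nn m * 1 < Real.pi := by
          rw [mul_one, div_lt_iff₀ hn]
          nlinarith [Real.pi_pos]
        exact (mul_le_mul_of_nonneg_left (by linarith [hs.2]) (by positivity)).trans_lt this
    have h6 : s = 1 / 2 := by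
      rcases mul_eq_zero.1 h5 with h7 | h7
      · exact absurd h7 (by positivity)
      · linarith
    rw [h6, γ_at_half]

theorem γ_im_nonpos {m : ℕ} {s : ℝ} (hs : s ∈ Icc (0 : ℝ) (1 / 2)) : (γ m 0 s).im ≤ 0 := by
  have hn := nn_pos m
  have hn2 := two_le_nn (m := m)
  rw [γ_im]
  refine mul_nonpos_of_nonneg_of_nonpos
    (mul_nonneg two_pos.le (sin_pi_mul_nonneg ⟨hs.1, hs.2.trans (by norm_num)⟩)) ?_
  refine Real.sin_nonpos_of_nonpos_of_neg_pi_le ?_ ?_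
  · exact mul_nonpos_of_nonneg_of_nonpos (by positivity) (by linarith [hs.2])
  · have : -Real.pi ≤ Real.pi / nn m * (-1) := by
      rw [div_mul_eq_mul_div, le_div_iff₀ hn]
      nlinarith [Real.pi_pos]
    exact this.trans (mul_le_mul_of_nonneg_left (by linarith [hs.1]) (by positivity))

theorem γ_im_nonneg {m : ℕ} {s : ℝ} (hs : s ∈ Icc (1 / 2 : ℝ) 1) : 0 ≤ (γ m 0 s).im := by
  have h := γ_im_nonpos (m := m) (s := 1 - s) ⟨by linarith [hs.2], by linarith [hs.1]⟩
  rw [← conj_γ, conj_im] at h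
  linarith

theorem γ_ne (m : ℕ) {j : ℕ} (hjn : j < nn m) {s : ℝ} (hs : s ∈ Icc (0 : ℝ) 1) :
    γ m 0 s - p m j ≠ 0 := by
  intro h
  rw [sub_eq_zero] at h
  by_cases hj : j = 0
  · subst hj
    rw [p_zero] at h
    rcases γ_im_eq_zero (m := m) hs (by rw [h]; simp) with h1 | h1 <;> rw [h1] at h <;> norm_num at h
  · have := one_sub_γ_mem_slitPlane m hj hjn hs
    rw [h, div_self (p_ne m j), sub_self] at this
    exact zero_notMem_slitPlane this

/-- The branch cut of `log (I (z - 1))` is the vertical ray going up from `1`. The first half of the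
loop stays in the closed lower half-plane and meets the real axis only in `0` and `2`. The second
half is treated with the downward ray. -/
theorem I_mul_γ_mem_slitPlane {m : ℕ} {s : ℝ} (hs : s ∈ Icc (0 : ℝ) (1 / 2)) :
    I * (γ m 0 s - 1) ∈ slitPlane := by
  rw [mem_slitPlane_iff]
  by_contra! h
  obtain ⟨h1, h2⟩ := h
  simp only [mul_re, I_re, zero_mul, I_im, sub_im, one_im, sub_zero, one_mul, zero_sub] at h1
  simp only [mul_im, I_re, zero_mul, I_im, one_mul, sub_re, one_re, zero_add] at h2
  rcases γ_im_eq_zero (m := m) ⟨hs.1, hs.2.trans (by norm_num)⟩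
    (le_antisymm (γ_im_nonpos hs) (by linarith)) with h3 | h3 <;> rw [h3] at h2 <;> norm_num at h2

theorem neg_I_mul_γ_mem_slitPlane {m : ℕ} {s : ℝ} (hs : s ∈ Icc (1 / 2 : ℝ) 1) :
    -I * (γ m 0 s - 1) ∈ slitPlane := by
  rw [mem_slitPlane_iff]
  by_contra! h
  obtain ⟨h1, h2⟩ := h
  simp only [neg_mul, neg_re, mul_re, I_re, zero_mul, I_im, sub_im, one_im, sub_zero,
    one_mul, zero_sub] at h1
  simp only [neg_mul, neg_im, mul_im, I_re, zero_mul, I_im, one_mul, sub_re, one_re,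
    zero_add] at h2
  rcases γ_im_eq_zero (m := m) ⟨(by norm_num : (0 : ℝ) ≤ 1 / 2).trans hs.1, hs.2⟩
    (le_antisymm (by linarith) (γ_im_nonneg hs)) with h3 | h3 <;> rw [h3] at h2 <;> norm_num at h2

/-- The coefficient of the pulled back form `z^k dz / (z - p_j)` along `γ_0`. -/
def ker (m j k : ℕ) (s : ℝ) : ℂ := deriv (γ m 0) s * (γ m 0 s ^ k / (γ m 0 s - p m j))

theorem continuousOn_ker (m : ℕ) {j : ℕ} (hj : j < nn m) (k : ℕ) :
    ContinuousOn (ker m j k) (Icc 0 1) := by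
  refine (continuous_deriv_γ m 0).continuousOn.mul (ContinuousOn.div ?_ ?_ fun s hs => γ_ne m hj hs)
  · exact ((continuous_γ m 0).pow k).continuousOn
  · exact ((continuous_γ m 0).sub continuous_const).continuousOn

/-- The factor `c` rotates the branch cut out of the way of the path; it drops out of the
logarithmic derivative. -/
theorem integral_log_deriv {m j : ℕ} (c q : ℂ) (a b : ℝ) (hab : a ≤ b) (hj : j < nn m)
    (ha : 0 ≤ a) (hb : b ≤ 1) (hc : c ≠ 0) (hq : q = p m j)
    (h : ∀ s ∈ Icc a b, c * (γ m 0 s - q) ∈ slitPlane) :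
    ∫ s in a..b, ker m j 0 s = log (c * (γ m 0 b - q)) - log (c * (γ m 0 a - q)) := by
  subst hq
  have hsub : uIcc a b ⊆ Icc 0 1 := by
    rw [uIcc_of_le hab]
    exact Icc_subset_Icc ha hb
  refine intervalIntegral.integral_eq_sub_of_hasDerivAt
    (f := fun s => log (c * (γ m 0 s - p m j))) (fun s hs => ?_)
    ((continuousOn_ker m hj 0).mono hsub).intervalIntegrable
  have h1 := (((hasDerivAt_γ m 0 s).sub_const (p m j)).const_mul c).clog_real
    (h s (by rwa [uIcc_of_le hab] at hs))
  refine h1.congr_deriv ?_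
  have h2 := γ_ne m hj (hsub hs)
  rw [ker, pow_zero]
  field_simp

/-- The loop winds around `1`, so it is cut at `z = 2` and each half gets its own branch. Either
half contributes `log I - log (-I) = πi`. -/
theorem integral_ker_zero_zero (m : ℕ) : ∫ s in (0 : ℝ)..1, ker m 0 0 s = 2 * Real.pi * I := by
  have h0 : 0 < nn m := by rw [nn]; omega
  have h1 := integral_log_deriv (m := m) (j := 0) I 1 0 (1 / 2) (by norm_num) h0 le_rfl (by norm_num)
    I_ne_zero (p_zero m).symm fun s hs => I_mul_γ_mem_slitPlane hs
  have h2 := integral_log_deriv (m := m) (j := 0) (-I) 1 (1 / 2) 1 (by norm_num) h0 (by norm_num) le_rfl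
    (neg_ne_zero.2 I_ne_zero) (p_zero m).symm fun s hs => neg_I_mul_γ_mem_slitPlane hs
  have hc := continuousOn_ker m h0 0
  rw [← intervalIntegral.integral_add_adjacent_intervals (b := 1 / 2), h1, h2, γ_at_zero, γ_at_half,
    γ_at_one]
  · have e1 : I * ((2 : ℂ) - 1) = I := by norm_num
    have e2 : I * ((0 : ℂ) - 1) = -I := by ring
    have e3 : -I * ((2 : ℂ) - 1) = -I := by norm_num
    have e4 : -I * ((0 : ℂ) - 1) = I := by ring
    rw [e1, e2, e3, e4, log_I, log_neg_I]
    ring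
  · refine (hc.mono ?_).intervalIntegrable
    rw [uIcc_of_le (by norm_num)]
    exact Icc_subset_Icc le_rfl (by norm_num)
  · refine (hc.mono ?_).intervalIntegrable
    rw [uIcc_of_le (by norm_num)]
    exact Icc_subset_Icc (by norm_num) le_rfl

/-- Along the whole loop `1 - z / p_j` avoids the cut, so `log (1 - z / p_j)` is a primitive with
equal end values. -/
theorem integral_ker_ne_zero {m j : ℕ} (hj : j ≠ 0) (hjn : j < nn m) :
    ∫ s in (0 : ℝ)..1, ker m j 0 s = 0 := by
  have hp := p_ne m j
  have h := integral_log_deriv (m := m) (j := j) (-(p m j)⁻¹) (p m j) 0 1 zero_le_one hjn le_rfl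
    le_rfl (neg_ne_zero.2 (inv_ne_zero hp)) rfl fun s hs => by
      have := one_sub_γ_mem_slitPlane m hj hjn hs
      convert! this using 1
      field_simp
      ring
  rw [h, γ_at_zero, γ_at_one, sub_self]

theorem integral_deriv_γ_mul_pow (m k : ℕ) :
    ∫ s in (0 : ℝ)..1, deriv (γ m 0) s * γ m 0 s ^ k = 0 := by
  have h : ∀ s ∈ uIcc (0 : ℝ) 1, HasDerivAt (fun u => γ m 0 u ^ (k + 1) / (k + 1))
      (deriv (γ m 0) s * γ m 0 s ^ k) s := fun s _ => by
    have h1 := ((hasDerivAt_γ m 0 s).pow (k + 1)).div_const ((k : ℂ) + 1)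
    refine h1.congr_deriv ?_
    have h2 : (k : ℂ) + 1 ≠ 0 := by exact_mod_cast k.succ_ne_zero
    push_cast
    field_simp
  rw [intervalIntegral.integral_eq_sub_of_hasDerivAt h, γ_at_zero, γ_at_one, sub_self]
  exact ((continuous_deriv_γ m 0).mul ((continuous_γ m 0).pow k)).intervalIntegrable _ _

/-- The residue theorem for `z^k / (z - p_j)` along `γ_0`. -/
theorem integral_ker (m : ℕ) {j : ℕ} (hj : j < nn m) (k : ℕ) :
    ∫ s in (0 : ℝ)..1, ker m j k s = if j = 0 then 2 * Real.pi * I else 0 := by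
  induction k with
  | zero =>
    split_ifs with h
    · subst h
      exact integral_ker_zero_zero m
    · exact integral_ker_ne_zero h hj
  | succ k ih =>
    -- Division with remainder: `z^(k+1) / (z - p) = z^k + p z^k / (z - p)`. The polynomial part
    -- integrates to zero, and the factor `p` is `1` in the only case with a residue, so the value
    -- does not depend on `k`.
    have h1 : ∀ s ∈ uIcc (0 : ℝ) 1, ker m j (k + 1) s
        = deriv (γ m 0) s * γ m 0 s ^ k + p m j * ker m j k s := fun s hs => by
      rw [uIcc_of_le zero_le_one] at hs
      have h2 := γ_ne m hj hs
      rw [ker, ker]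
      field_simp
      ring
    rw [intervalIntegral.integral_congr h1, intervalIntegral.integral_add,
      integral_deriv_γ_mul_pow, intervalIntegral.integral_const_mul, ih]
    · split_ifs with h
      · rw [h, p_zero]
        ring
      · simp
    · exact ((continuous_deriv_γ m 0).mul ((continuous_γ m 0).pow k)).intervalIntegrable _ _
    · refine ContinuousOn.intervalIntegrable ?_
      rw [uIcc_of_le zero_le_one]
      exact continuousOn_const.mul (continuousOn_ker m hj k)

end DPW

namespace DPW

open Complex Set Matrix
open scoped ComplexConjugate

/-! ### Uniqueness of the transport -/

/-- `X' = X B` on `[0,1]`. -/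
def IsSol (B X : ℝ → Matrix (Fin 2) (Fin 2) ℂ) : Prop :=
  ∀ s ∈ Icc (0 : ℝ) 1, ∀ i k : Fin 2,
    HasDerivWithinAt (fun u => X u i k) ((X s * B s) i k) (Icc 0 1) s

/-- For trace-free `B` one has `adjugate B = -B`, so `adjugate X` satisfies `W' = -B W` and `Z *
adjugate X` is constant. The adjugate replaces the inverse, so invertibility of `X` need not be
known beforehand. -/
theorem IsSol.mul_adjugate_eq {B X Z : ℝ → Matrix (Fin 2) (Fin 2) ℂ} (hX : IsSol B X)
    (hZ : IsSol B Z) (hB : ∀ s ∈ Icc (0 : ℝ) 1, (B s).trace = 0) {s : ℝ} (hs : s ∈ Icc (0 : ℝ) 1) :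
    Z s * adjugate (X s) = Z 0 * adjugate (X 0) := by
  have key : ∀ i k : Fin 2, ∀ u ∈ Icc (0 : ℝ) 1,
      HasDerivWithinAt (fun u => (Z u * adjugate (X u)) i k) 0 (Icc 0 1) u := by
    intro i k u hu
    have hb := hB u hu
    rw [trace_fin_two] at hb
    have z := hZ u hu i
    have x := hX u hu
    simp only [Matrix.mul_apply, Fin.sum_univ_two] at z x
    simp only [adjugate_fin_two, Matrix.mul_apply, Fin.sum_univ_two]
    fin_cases k
    · simp only [Fin.zero_eta, of_apply, cons_val', cons_val_zero, cons_val_one, cons_val_fin_one]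
      refine (((z 0).mul (x 1 1)).add ((z 1).mul (x 1 0).neg)).congr_deriv ?_
      simp only [Pi.neg_apply]
      linear_combination (Z u i 0 * X u 1 1 - Z u i 1 * X u 1 0) * hb
    · simp only [Fin.mk_one, of_apply, cons_val', cons_val_zero, cons_val_one, cons_val_fin_one]
      refine (((z 0).mul (x 0 1).neg).add ((z 1).mul (x 0 0))).congr_deriv ?_
      simp only [Pi.neg_apply]
      linear_combination (Z u i 1 * X u 0 0 - Z u i 0 * X u 0 1) * hb
  ext i k
  refine constant_of_derivWithin_zero (f := fun u => (Z u * adjugate (X u)) i k)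
    (fun u hu => (key i k u hu).differentiableWithinAt) (fun u hu => ?_) s hs
  exact (key i k u ⟨hu.1, hu.2.le⟩).derivWithin
    (uniqueDiffOn_Icc zero_lt_one u ⟨hu.1, hu.2.le⟩)

theorem IsSol.eq_of_eq {B X Z : ℝ → Matrix (Fin 2) (Fin 2) ℂ} (hX : IsSol B X)
    (hZ : IsSol B Z) (hB : ∀ s ∈ Icc (0 : ℝ) 1, (B s).trace = 0) (hX0 : X 0 = 1) (hZ0 : Z 0 = 1) :
    (X 1).det = 1 ∧ Z 1 = X 1 := by
  have h1 := hX.mul_adjugate_eq hX hB (right_mem_Icc.2 zero_le_one)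
  have h2 := hX.mul_adjugate_eq hZ hB (right_mem_Icc.2 zero_le_one)
  rw [hX0, hZ0, adjugate_one, mul_one] at h2
  rw [hX0, adjugate_one, mul_one, mul_adjugate] at h1
  have hd : (X 1).det = 1 := by simpa using congrFun₂ h1 0 0
  refine ⟨hd, ?_⟩
  have h3 := adjugate_mul (X 1)
  rw [hd, one_smul] at h3
  calc Z 1 = Z 1 * (adjugate (X 1) * X 1) := by rw [h3, mul_one]
    _ = X 1 := by rw [← mul_assoc, h2, one_mul]

/-! ### The symmetries of the residues and of the potential -/

/-- The multipliers of the entries under conjugation by `D`. -/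
def dmul (m : ℕ) (i k : Fin 2) : ℂ :=
  !![1, exp (-(2 * (I * Real.pi * m / nn m))); exp (2 * (I * Real.pi * m / nn m)), 1] i k

theorem D_inv (m : ℕ) : (D m)⁻¹ =
    !![exp (-(I * Real.pi * m / nn m)), 0; 0, exp (I * Real.pi * m / nn m)] := by
  refine Matrix.inv_eq_left_inv ?_
  ext i j
  fin_cases i <;> fin_cases j <;> simp [D, ← Complex.exp_add]

theorem conjD_apply (m : ℕ) (M : Matrix (Fin 2) (Fin 2) ℂ) (i k : Fin 2) :
    ((D m)⁻¹ * M * D m) i k = dmul m i k * M i k := by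
  rw [D_inv, D, Matrix.mul_apply, Fin.sum_univ_two, Matrix.mul_apply, Matrix.mul_apply,
    Fin.sum_univ_two, Fin.sum_univ_two]
  fin_cases i <;> fin_cases k <;> simp [dmul]
  · rw [mul_right_comm, ← Complex.exp_add]; simp
  · rw [mul_right_comm, ← Complex.exp_add]; congr 2; ring
  · rw [mul_right_comm, ← Complex.exp_add]; congr 2; ring
  · rw [mul_right_comm, ← Complex.exp_add]; simp

theorem D_inv_mul (m : ℕ) : (D m)⁻¹ * D m = 1 := by
  rw [D_inv]
  ext i j
  fin_cases i <;> fin_cases j <;> simp [D, ← Complex.exp_add]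

theorem D_mul_inv (m : ℕ) : D m * (D m)⁻¹ = 1 := by
  rw [D_inv]
  ext i j
  fin_cases i <;> fin_cases j <;> simp [D, ← Complex.exp_add]

theorem dmul_pow_nn (m : ℕ) (i k : Fin 2) : dmul m i k ^ nn m = 1 := by
  have hn := nn_ne m
  have h : (nn m : ℂ) * (2 * (I * Real.pi * m / nn m)) = m * (2 * Real.pi * I) := by
    field_simp
  fin_cases i <;> fin_cases k <;> simp only [dmul, Fin.zero_eta, Fin.mk_one, of_apply, cons_val',
    cons_val_zero, cons_val_one, cons_val_fin_one, one_pow]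
  · rw [← Complex.exp_nat_mul, mul_neg, h, Complex.exp_neg, Complex.exp_nat_mul_two_pi_mul_I, inv_one]
  · rw [← Complex.exp_nat_mul, h, Complex.exp_nat_mul_two_pi_mul_I]

theorem conj_dmul (m : ℕ) (i k : Fin 2) : conj (dmul m i k) * dmul m i k = 1 := by
  have h : conj (2 * (I * Real.pi * m / nn m)) = -(2 * (I * Real.pi * m / nn m)) := by
    rw [map_mul, map_div₀, map_mul, map_mul, conj_I, conj_ofReal, map_natCast, map_natCast,
      map_ofNat]
    ring
  fin_cases i <;> fin_cases k <;> simp only [dmul, Fin.zero_eta, Fin.mk_one, of_apply, cons_val',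
    cons_val_zero, cons_val_one, cons_val_fin_one, map_one, mul_one, ← Complex.exp_conj, map_neg, h,
    ← Complex.exp_add, neg_neg, add_neg_cancel, neg_add_cancel, Complex.exp_zero]

theorem conj_dmul_pow (m : ℕ) (i k : Fin 2) {j : ℕ} (hj : j ≤ nn m) :
    conj (dmul m i k ^ j) = dmul m i k ^ (nn m - j) := by
  have h1 : conj (dmul m i k ^ j) * dmul m i k ^ j = 1 := by
    rw [map_pow, ← mul_pow, conj_dmul, one_pow]
  have h2 : dmul m i k ^ (nn m - j) * dmul m i k ^ j = 1 := by
    rw [← pow_add, Nat.sub_add_cancel hj, dmul_pow_nn]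
  have h3 : dmul m i k ^ j ≠ 0 := right_ne_zero_of_mul_eq_one h2
  exact mul_right_cancel₀ h3 (h1.trans h2.symm)

variable {ρ : ℝ}

theorem A_apply (m : ℕ) (x : Param ρ) (j : ℕ) (μ : ℂ) (i k : Fin 2) :
    A m x j μ i k = dmul m i k ^ j * A m x 0 ((-1) ^ j * μ) i k := by
  induction j generalizing μ with
  | zero => simp
  | succ j ih =>
    have h : A m x (j + 1) μ = (D m)⁻¹ * A m x j (-μ) * D m := rfl
    rw [h, conjD_apply, ih, pow_succ', mul_assoc, pow_succ, mul_neg, mul_neg_one, neg_mul]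

theorem trace_A (m : ℕ) (x : Param ρ) (j : ℕ) (μ : ℂ) : (A m x j μ).trace = 0 := by
  rw [trace_fin_two, A_apply, A_apply m x j μ 1 1]
  simp [dmul, A]

/-- The recursion closes up after `n` steps because `n` is even and the multipliers are `n`-th roots
of unity. Hence the index `j` is cyclic in the potential. -/
theorem A_nn (m : ℕ) (x : Param ρ) (μ : ℂ) : A m x (nn m) μ = A m x 0 μ := by
  ext i k
  have h : (-1 : ℂ) ^ nn m = 1 := Even.neg_one_pow ⟨m + 1, by rw [nn]; ring⟩
  rw [A_apply, dmul_pow_nn, h, one_mul, one_mul]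

theorem trace_η (m : ℕ) (t : ℝ) (x : Param ρ) (z μ : ℂ) : (η m t x z μ).trace = 0 := by
  rw [η, trace_add, trace_smul, trace_sum]
  simp [trace_fin_two_of, trace_A]

/-- The factor that `z^(m-1) dz` acquires under `z ↦ p_1 z` is exactly the multiplier of the lower
left entry under conjugation by `D`. -/
theorem dmul_one_zero (m : ℕ) : dmul m 1 0 = p m 1 ^ m := by
  rw [p, ← Complex.exp_nat_mul]
  simp only [dmul, of_apply, cons_val', cons_val_zero, cons_val_one, cons_val_fin_one]
  congr 1
  push_cast
  ring

/-- The potential is equivariant under the rotation `z ↦ exp (2πi/n) z`. -/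
theorem η_rotate {m : ℕ} (hm : 1 ≤ m) (t : ℝ) (x : Param ρ) (z μ : ℂ) :
    p m 1 • η m t x (p m 1 * z) μ = (D m)⁻¹ * η m t x z (-μ) * D m := by
  have hsum : p m 1 • ∑ j ∈ Finset.range (nn m), (p m 1 * z - p m j)⁻¹ • A m x j μ
      = ∑ j ∈ Finset.range (nn m), (z - p m j)⁻¹ • A m x (j + 1) μ := by
    have h1 : ∀ j, p m 1 • (p m 1 * z - p m (j + 1))⁻¹ • A m x (j + 1) μ
        = (z - p m j)⁻¹ • A m x (j + 1) μ := fun j => by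
      rw [p_succ m j, ← mul_sub, mul_inv, smul_smul, mul_inv_cancel_left₀ (p_ne m 1)]
    -- The sum over `0, …, n` is split in two ways, at its last and at its first term. These two
    -- terms agree, which gives the cyclic shift.
    have h2 := Finset.sum_range_succ (fun j => (p m 1 * z - p m j)⁻¹ • A m x j μ) (nn m)
    rw [Finset.sum_range_succ', p_nn, A_nn, p_zero, add_left_inj] at h2
    rw [← h2, Finset.smul_sum]
    exact Finset.sum_congr rfl fun j _ => h1 j
  obtain ⟨l, rfl⟩ : ∃ l, m = l + 1 := ⟨m - 1, by omega⟩
  rw [η, smul_add, smul_comm, hsum]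
  ext i k
  rw [conjD_apply, η]
  simp only [Matrix.add_apply, Matrix.smul_apply, Matrix.sum_apply, smul_eq_mul]
  rw [mul_add, mul_left_comm (dmul _ i k)]
  congr 1
  · fin_cases i <;> fin_cases k <;> simp
    rw [dmul_one_zero]
    ring
  · rw [Finset.mul_sum, Finset.mul_sum, Finset.mul_sum]
    refine Finset.sum_congr rfl fun j _ => ?_
    have h : A (l + 1) x (j + 1) μ = (D (l + 1))⁻¹ * A (l + 1) x j (-μ) * D (l + 1) := rfl
    rw [h, conjD_apply]
    ring

theorem conj_ev (f : WienerPos ρ) (μ : ℂ) : conj (ev f (conj μ)) = ev f μ := by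
  rw [ev, ev, Complex.conj_tsum]
  refine tsum_congr fun k => ?_
  simp

theorem conj_A_zero (m : ℕ) (x : Param ρ) (μ : ℂ) (i k : Fin 2) :
    conj (A m x 0 (conj μ) i k) = A m x 0 μ i k := by
  fin_cases i <;> fin_cases k <;> simp [A, conj_ev]

/-- Conjugation inverts the multipliers, which are `n`-th roots of unity, so `j` goes to `n - j`;
the sign of `μ` is unaffected since `n` is even. -/
theorem conj_A (m : ℕ) (x : Param ρ) {j : ℕ} (hj : j ≤ nn m) (μ : ℂ) (i k : Fin 2) :
    conj (A m x j (conj μ) i k) = A m x (nn m - j) μ i k := by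
  have h1 : ((-1 : ℂ)) ^ (nn m - j) = (-1) ^ j := by
    have h2 : (-1 : ℂ) ^ nn m = 1 := Even.neg_one_pow ⟨m + 1, by rw [nn]; ring⟩
    have h3 : (-1 : ℂ) ^ (nn m - j) * (-1) ^ j = 1 := by
      rw [← pow_add, Nat.sub_add_cancel hj, h2]
    have h4 : (-1 : ℂ) ^ j * (-1) ^ j = 1 := by
      rw [← mul_pow]; simp
    exact mul_right_cancel₀ (pow_ne_zero j (by norm_num)) (h3.trans h4.symm)
  rw [A_apply, map_mul, conj_dmul_pow m i k hj, A_apply m x (nn m - j), h1]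
  congr 1
  rw [← conj_A_zero]
  simp

theorem conj_p (m : ℕ) {j : ℕ} (hj : j ≤ nn m) : conj (p m j) = p m (nn m - j) := by
  have h1 : conj (p m j) * p m j = 1 := by
    have h : conj (2 * Real.pi * I * j / nn m) = -(2 * Real.pi * I * j / nn m) := by
      rw [map_div₀, map_mul, map_mul, map_mul, conj_I, conj_ofReal, map_natCast, map_natCast,
        map_ofNat]
      ring
    rw [p, ← Complex.exp_conj, ← Complex.exp_add, h, neg_add_cancel, Complex.exp_zero]
  have h2 : p m (nn m - j) * p m j = 1 := by
    rw [p, p, ← Complex.exp_add, ← exp_two_pi_mul_I]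
    congr 1
    have := nn_ne m
    rw [Nat.cast_sub hj]
    field_simp
    ring
  exact mul_right_cancel₀ (p_ne m j) (h1.trans h2.symm)

theorem sum_range_nn_reflect {M : Type*} [AddCommMonoid M] (m : ℕ) (g : ℕ → M)
    (hg : g (nn m) = g 0) :
    ∑ j ∈ Finset.range (nn m), g (nn m - j) = ∑ j ∈ Finset.range (nn m), g j := by
  have hn : nn m = (2 * m + 1) + 1 := rfl
  rw [hn] at hg ⊢
  rw [Finset.sum_range_succ', Finset.sum_range_succ' (fun j => g j), Nat.sub_zero, hg]
  congr 1
  rw [← Finset.sum_range_reflect]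
  refine Finset.sum_congr rfl fun j hj => ?_
  congr 1
  have := Finset.mem_range.1 hj
  omega

/-- The potential is real with respect to complex conjugation. -/
theorem conj_η (m : ℕ) (t : ℝ) (x : Param ρ) (z μ : ℂ) (i k : Fin 2) :
    conj (η m t x z (conj μ) i k) = η m t x (conj z) μ i k := by
  have h := sum_range_nn_reflect m (fun j => (conj z - p m j)⁻¹ * A m x j μ i k)
    (by rw [p_nn, A_nn, p_zero])
  rw [η, η]
  simp only [Matrix.add_apply, Matrix.smul_apply, Matrix.sum_apply, smul_eq_mul, map_add, map_mul,
    map_sum]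
  rw [← h, conj_ofReal]
  congr 1
  · fin_cases i <;> fin_cases k <;> simp
  · congr 1
    refine Finset.sum_congr rfl fun j hj => ?_
    have hj' := (Finset.mem_range.1 hj).le
    rw [map_inv₀, map_sub, conj_p m hj', conj_A m x hj']

/-! ### The symmetries of the monodromy -/

theorem trace_transport (m : ℕ) (t : ℝ) (x : Param ρ) (j : ℕ) (μ : ℂ) (s : ℝ) :
    (deriv (γ m j) s • η m t x (γ m j s) μ).trace = 0 := by
  rw [trace_smul, trace_η, smul_zero]

theorem IsTransport.isSol {m : ℕ} {t : ℝ} {x : Param ρ} {j : ℕ} {μ : ℂ}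
    {X : ℝ → Matrix (Fin 2) (Fin 2) ℂ} (h : IsTransport m t x j μ X) :
    IsSol (fun s => deriv (γ m j) s • η m t x (γ m j s) μ) X := h.2

/-- The monodromy is defined by a choice; uniqueness of solutions lets any transport compute it. -/
theorem IsTransport.mon_eq {m : ℕ} {t : ℝ} {x : Param ρ} {j : ℕ} {μ : ℂ}
    {X : ℝ → Matrix (Fin 2) (Fin 2) ℂ} (h : IsTransport m t x j μ X) : Mon m t x j μ = X 1 := by
  have hex : ∃ X, IsTransport m t x j μ X := ⟨X, h⟩
  rw [Mon, dif_pos hex]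
  exact (h.isSol.eq_of_eq hex.choose_spec.isSol (fun s _ => trace_transport m t x j μ s) h.1
    hex.choose_spec.1).2

theorem IsTransport.det_mon {m : ℕ} {t : ℝ} {x : Param ρ} {j : ℕ} {μ : ℂ}
    {X : ℝ → Matrix (Fin 2) (Fin 2) ℂ} (h : IsTransport m t x j μ X) :
    (Mon m t x j μ).det = 1 := by
  rw [h.mon_eq]
  exact (h.isSol.eq_of_eq h.isSol (fun s _ => trace_transport m t x j μ s) h.1 h.1).1

theorem IsTransport.rotate {m : ℕ} (hm : 1 ≤ m) {t : ℝ} {x : Param ρ} {j : ℕ} {μ : ℂ}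
    {X : ℝ → Matrix (Fin 2) (Fin 2) ℂ} (h : IsTransport m t x j (-μ) X) :
    IsTransport m t x (j + 1) μ fun s => (D m)⁻¹ * X s * D m := by
  refine ⟨by simp only [h.1, mul_one, D_inv_mul], fun s hs i k => ?_⟩
  simp only [conjD_apply]
  refine ((h.2 s hs i k).const_mul (dmul m i k)).congr_deriv ?_
  rw [← conjD_apply, deriv_γ_succ, γ_succ, mul_comm (p m 1), mul_smul, η_rotate hm]
  have h1 : (D m)⁻¹ * (X s * (deriv (γ m j) s • η m t x (γ m j s) (-μ))) * D m
      = (D m)⁻¹ * X s * (D m * (D m)⁻¹) * (deriv (γ m j) s • η m t x (γ m j s) (-μ)) * D m := by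
    rw [D_mul_inv, mul_one, mul_assoc (D m)⁻¹ (X s)]
  rw [h1]
  simp only [mul_assoc, Matrix.mul_smul, Matrix.smul_mul]

theorem exists_transport_of_zero {m : ℕ} (hm : 1 ≤ m) {t : ℝ} {x : Param ρ}
    (h : ∀ μ : ℂ, ‖μ‖ = 1 → ∃ X, IsTransport m t x 0 μ X) (j : ℕ) (μ : ℂ) (hμ : ‖μ‖ = 1) :
    ∃ X, IsTransport m t x j μ X := by
  induction j generalizing μ with
  | zero => exact h μ hμ
  | succ j ih =>
    obtain ⟨X, hX⟩ := ih (-μ) (by rwa [norm_neg])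
    exact ⟨_, hX.rotate hm⟩

theorem mon_succ {m : ℕ} (hm : 1 ≤ m) {t : ℝ} {x : Param ρ}
    (h : ∀ μ : ℂ, ‖μ‖ = 1 → ∃ X, IsTransport m t x 0 μ X) (j : ℕ) (μ : ℂ) (hμ : ‖μ‖ = 1) :
    Mon m t x (j + 1) μ = (D m)⁻¹ * Mon m t x j (-μ) * D m := by
  obtain ⟨X, hX⟩ := exists_transport_of_zero hm h j (-μ) (by rwa [norm_neg])
  rw [hX.mon_eq, (hX.rotate hm).mon_eq]

/-- Conjugation reverses `γ_0`, so `s ↦ conj X(1 - s)` solves the same equation as `Y` and runs from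
`conj X(1)` to `1`. Constancy of `Z * adjugate Y` then says that the conjugate monodromy is the
inverse one. -/
theorem conj_mon {m : ℕ} {t : ℝ} {x : Param ρ} {μ : ℂ} {X Y : ℝ → Matrix (Fin 2) (Fin 2) ℂ}
    (hX : IsTransport m t x 0 (conj μ) X) (hY : IsTransport m t x 0 μ Y) :
    (Mon m t x 0 (conj μ)).map conj = adjugate (Mon m t x 0 μ) := by
  rw [hX.mon_eq, hY.mon_eq]
  have hZ : IsSol (fun s => deriv (γ m 0) s • η m t x (γ m 0 s) μ)
      (fun s => (X (1 - s)).map conj) := by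
    intro s hs i k
    have hs' : 1 - s ∈ Icc (0 : ℝ) 1 := ⟨by linarith [hs.2], by linarith [hs.1]⟩
    have h1 : HasDerivWithinAt (fun u : ℝ => 1 - u) (-1) (Icc 0 1) s := by
      simpa using ((hasDerivAt_id s).const_sub 1).hasDerivWithinAt
    have h2 := ((hX.2 (1 - s) hs' i k).star).scomp s h1
      (fun u hu => ⟨by linarith [hu.2], by linarith [hu.1]⟩)
    refine h2.congr_deriv ?_
    change (-1 : ℝ) • conj _ = ((X (1 - s)).map conj * (deriv (γ m 0) s • η m t x (γ m 0 s) μ)) i k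
    rw [Matrix.mul_apply, Matrix.mul_apply, map_sum, Finset.smul_sum]
    refine Finset.sum_congr rfl fun l _ => ?_
    rw [map_mul, Matrix.smul_apply, Matrix.smul_apply, smul_eq_mul, map_mul, conj_deriv_γ, conj_η,
      conj_γ, sub_sub_cancel, Matrix.map_apply, smul_eq_mul, Complex.real_smul]
    push_cast
    ring
  have h := hY.isSol.mul_adjugate_eq hZ (fun s _ => trace_transport m t x 0 μ s)
    (right_mem_Icc.2 zero_le_one)
  simp only [sub_self, sub_zero] at h
  rw [hX.1, hY.1, adjugate_one, mul_one] at h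
  rw [← h]
  ext i k
  simp [Matrix.map_one]

end DPW

namespace DPW

open Complex Set
open scoped ComplexConjugate

/-! ### The algebra of two by two matrices of Laurent series -/

section MatL

variable (ρ : ℝ) [hρ : Fact (1 < ρ)]

open scoped Matrix.Norms.Operator

/-- The Banach algebra of two by two matrices of Laurent series. -/
def MatL (ρ : ℝ) : Type := Matrix (Fin 2) (Fin 2) (Laurent ρ)

instance : NormedRing (MatL ρ) := inferInstanceAs (NormedRing (Matrix (Fin 2) (Fin 2) (Laurent ρ)))

instance : NormedAlgebra ℂ (MatL ρ) :=
  inferInstanceAs (NormedAlgebra ℂ (Matrix (Fin 2) (Fin 2) (Laurent ρ)))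

instance : CompleteSpace (MatL ρ) :=
  inferInstanceAs (CompleteSpace (Matrix (Fin 2) (Fin 2) (Laurent ρ)))

namespace MatL

variable {ρ}

/-- The entries of a matrix of Laurent series. -/
def entry (i k : Fin 2) : MatL ρ →L[ℂ] Laurent ρ :=
  LinearMap.mkContinuous
    { toFun := fun M => (show Matrix (Fin 2) (Fin 2) (Laurent ρ) from M) i k
      map_add' := fun _ _ => rfl
      map_smul' := fun _ _ => rfl } 1 fun M => by
    rw [one_mul]
    exact norm_entry_le (R := Laurent ρ) M i k

/-- The matrix with a single non-zero entry. -/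
def single (i k : Fin 2) : Laurent ρ →L[ℂ] MatL ρ :=
  LinearMap.mkContinuous
    { toFun := fun f => (Matrix.single i k f : Matrix (Fin 2) (Fin 2) (Laurent ρ))
      map_add' := fun f g => Matrix.single_add i k f g
      map_smul' := fun c f => (Matrix.smul_single c i k f).symm } 2 fun f => by
    refine norm_le_of_entry_le (R := Laurent ρ) (norm_nonneg f) fun i' k' => ?_
    by_cases h : i = i' ∧ k = k'
    · obtain ⟨rfl, rfl⟩ := h
      exact (congrArg norm (Matrix.single_apply_same i k f)).le
    · refine (congrArg norm (Matrix.single_apply_of_ne i k f i' k' h)).le.trans ?_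
      rw [norm_zero]
      exact norm_nonneg f

theorem entry_single (i k i' k' : Fin 2) (f : Laurent ρ) :
    entry i' k' (single i k f) = if i = i' ∧ k = k' then f else 0 := by
  split_ifs with h
  · obtain ⟨rfl, rfl⟩ := h
    exact Matrix.single_apply_same i k f
  · exact Matrix.single_apply_of_ne i k f i' k' h

theorem entry_mul (M N : MatL ρ) (i k : Fin 2) :
    entry i k (M * N) = entry i 0 M * entry 0 k N + entry i 1 M * entry 1 k N := by
  refine (Matrix.mul_apply (M := (show Matrix (Fin 2) (Fin 2) (Laurent ρ) from M)) (N := N)).trans ?_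
  rw [Fin.sum_univ_two]
  rfl

/-- Evaluation at a point of the unit circle. -/
def evalM (μ : ℂ) (hμ : ‖μ‖ = 1) : MatL ρ →+* Matrix (Fin 2) (Fin 2) ℂ :=
  (Laurent.evalHom μ hμ).mapMatrix

theorem evalM_apply (μ : ℂ) (hμ : ‖μ‖ = 1) (M : MatL ρ) (i k : Fin 2) :
    evalM μ hμ M i k = Laurent.evalL μ hμ (entry i k M) := rfl

theorem evalM_smul (μ : ℂ) (hμ : ‖μ‖ = 1) (c : ℂ) (M : MatL ρ) :
    evalM μ hμ (c • M) = c • evalM μ hμ M := by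
  ext i k
  rw [evalM_apply, map_smul, map_smul, Matrix.smul_apply, evalM_apply]

theorem norm_evalM_le (μ : ℂ) (hμ : ‖μ‖ = 1) (M : MatL ρ) : ‖evalM μ hμ M‖ ≤ 2 * ‖M‖ := by
  refine norm_le_of_entry_le (norm_nonneg M) fun i k => ?_
  rw [evalM_apply]
  exact (Laurent.norm_evalL_le μ hμ _).trans (norm_entry_le (R := Laurent ρ) M i k)

theorem continuous_evalM (μ : ℂ) (hμ : ‖μ‖ = 1) : Continuous (evalM (ρ := ρ) μ hμ) := by
  refine continuous_matrix fun i k => ?_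
  exact (Laurent.evalL (ρ := ρ) μ hμ).continuous.comp (entry i k).continuous

theorem evalM_log (μ : ℂ) (hμ : ‖μ‖ = 1) {N : MatL ρ} (h : ‖N‖ < 1) :
    evalM μ hμ (logOneAdd N) = logOneAdd (evalM μ hμ N) :=
  map_logOneAdd (evalM μ hμ).toAddMonoidHom (continuous_evalM μ hμ) h fun k => by
    change evalM μ hμ (_ • _) = _ • evalM μ hμ N ^ (k + 1)
    rw [evalM_smul, map_pow]

end MatL

end MatL

/-! ### The parameter space -/

/-- Summable real sequences. -/
abbrev PosSeq : Type := lp (fun _ : ℕ => ℝ) 1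

/-- The parameter space `ℝ × (W^{≥ 0}_ℝ)³` in normalised coordinates. -/
abbrev PSpace : Type := ℝ × PosSeq × PosSeq × PosSeq

section Param

variable {ρ : ℝ}

theorem wt_natCast (k : ℕ) : wt ρ (k : ℤ) = ρ ^ k := by simp [wt]

/-- The normalised coefficients of an element of `WienerPos ρ`. -/
def toSeq (f : WienerPos ρ) : PosSeq :=
  ⟨fun k => f.1 k * ρ ^ k, memℓp_gen (by
    refine (f.2 : Summable fun k => |f.1 k| * |ρ| ^ k).congr fun k => ?_
    simp)⟩

theorem toSeq_apply (f : WienerPos ρ) (k : ℕ) : toSeq f k = f.1 k * ρ ^ k := rfl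

theorem norm_toSeq_sub (f g : WienerPos ρ) : ‖toSeq f - toSeq g‖ = wienerNorm (f - g) := by
  rw [l1_norm_eq_tsum, wienerNorm]
  refine tsum_congr fun k => ?_
  rw [lp.coeFn_sub, Pi.sub_apply, toSeq_apply, toSeq_apply, ← sub_mul, norm_mul, norm_pow]
  rfl

/-- The normalised coordinates of a parameter. -/
def toP (x : Param ρ) : PSpace := (x.r, toSeq x.a, toSeq x.b, toSeq x.c)

theorem mem_nbhd_iff (x : Param ρ) (δ : ℝ) : x ∈ nbhd ρ δ ↔ toP x ∈ Metric.ball (toP (x₀ ρ)) δ := by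
  rw [mem_ball_iff_norm, nbhd, mem_ofPred_eq]
  simp only [toP, Prod.mk_sub_mk, Prod.norm_mk, norm_toSeq_sub, max_lt_iff, Real.norm_eq_abs]

variable [hρ : Fact (1 < ρ)]

theorem rho_pos : 0 < ρ := zero_lt_one.trans hρ.out

/-- The element of `WienerPos ρ` with given normalised coefficients. -/
def ofSeq (f : PosSeq) : WienerPos ρ :=
  ⟨fun k => f k / ρ ^ k, by
    refine (l1_summable_norm f).congr fun k => ?_
    have h := (pow_pos (abs_pos.2 (rho_pos (ρ := ρ)).ne') k).ne'
    rw [abs_div, abs_pow, div_mul_cancel₀ _ h, Real.norm_eq_abs]⟩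

theorem toSeq_ofSeq (f : PosSeq) : toSeq (ofSeq f : WienerPos ρ) = f := by
  ext k
  exact div_mul_cancel₀ _ (pow_pos (rho_pos (ρ := ρ)) k).ne'

theorem toSeq_injective : Function.Injective (toSeq : WienerPos ρ → PosSeq) := by
  intro f g h
  refine Subtype.ext (funext fun k => ?_)
  have h1 : f.1 k * ρ ^ k = g.1 k * ρ ^ k := congrArg (fun u : PosSeq => u k) h
  exact mul_right_cancel₀ (pow_pos (rho_pos (ρ := ρ)) k).ne' h1

/-- The parameter with given normalised coordinates. -/
def ofP (y : PSpace) : Param ρ := ⟨y.1, ofSeq y.2.1, ofSeq y.2.2.1, ofSeq y.2.2.2⟩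

theorem toP_ofP (y : PSpace) : toP (ofP y : Param ρ) = y := by
  simp [toP, ofP, toSeq_ofSeq]

theorem toP_injective : Function.Injective (toP : Param ρ → PSpace) := by
  rintro ⟨r, a, b, c⟩ ⟨r', a', b', c'⟩ h
  simp only [toP, Prod.mk.injEq] at h
  obtain ⟨h1, h2, h3, h4⟩ := h
  rw [h1, toSeq_injective h2, toSeq_injective h3, toSeq_injective h4]

/-- The embedding of power series into Laurent series. -/
def posL : PosSeq →L[ℝ] Laurent ρ :=
  l1lift (fun k : ℕ => Laurent.e (k : ℤ)) 1 fun _ => (Laurent.norm_e _).le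

theorem posL_hasSum (f : PosSeq) :
    HasSum (fun k : ℕ => f k • (Laurent.e (k : ℤ) : Laurent ρ)) (posL f) :=
  l1lift_hasSum _ _ _ f

theorem coef_posL_nat (f : PosSeq) (n : ℕ) :
    Laurent.coef (n : ℤ) (posL f : Laurent ρ) = ((f n / ρ ^ n : ℝ) : ℂ) := by
  have h := ((Laurent.coefL (ρ := ρ) (n : ℤ)).hasSum (posL_hasSum f))
  rw [Laurent.coefL_apply] at h
  refine h.unique ?_
  refine Eq.mp (congrArg (fun F => HasSum F _) (funext fun k => ?_))
    (hasSum_ite_eq n ((f n / ρ ^ n : ℝ) : ℂ))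
  rw [← Complex.coe_smul, map_smul, Laurent.coefL_apply, Laurent.coef_e, wt_natCast]
  by_cases hk : k = n
  · subst hk
    simp [div_eq_mul_inv]
  · simp [hk]

theorem coef_posL_neg (f : PosSeq) {k : ℤ} (hk : k < 0) :
    Laurent.coef k (posL f : Laurent ρ) = 0 := by
  have h := ((Laurent.coefL (ρ := ρ) k).hasSum (posL_hasSum f))
  rw [Laurent.coefL_apply] at h
  refine h.unique ?_
  refine Eq.mp (congrArg (fun F => HasSum F _) (funext fun j => ?_)) hasSum_zero
  rw [← Complex.coe_smul, map_smul, Laurent.coefL_apply, Laurent.coef_e, if_neg (by omega), smul_zero]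

theorem evalL_posL (f : WienerPos ρ) (μ : ℂ) (hμ : ‖μ‖ = 1) :
    Laurent.evalL μ hμ (posL (toSeq f) : Laurent ρ) = ev f μ := by
  have h := ((Laurent.evalL (ρ := ρ) μ hμ).hasSum (posL_hasSum (toSeq f)))
  rw [ev, ← h.tsum_eq]
  refine tsum_congr fun k => ?_
  have h1 : ((ρ : ℂ) ^ k) ≠ 0 := pow_ne_zero _ (by exact_mod_cast (rho_pos (ρ := ρ)).ne')
  rw [← Complex.coe_smul, map_smul, Laurent.evalL_e, wt_natCast, toSeq_apply, smul_eq_mul]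
  push_cast
  rw [zpow_natCast]
  field_simp

end Param

end DPW

namespace DPW

open Complex Set
open scoped ComplexConjugate

variable {ρ : ℝ} [hρ : Fact (1 < ρ)]

/-! ### The residues as matrices of Laurent series -/

/-- The residue `A_0` as a function of the parameter. -/
def residueZero : PSpace →L[ℝ] MatL ρ :=
  ((MatL.single (ρ := ρ) 0 0 - MatL.single 1 1).restrictScalars ℝ ∘L posL (ρ := ρ) ∘L
      .fst ℝ PosSeq (PosSeq × PosSeq)
    + (MatL.single (ρ := ρ) 0 1 ∘L Laurent.mulL ρ (Laurent.mono (-1))).restrictScalars ℝ ∘L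
      posL (ρ := ρ) ∘L .fst ℝ PosSeq PosSeq ∘L .snd ℝ PosSeq (PosSeq × PosSeq)
    + (MatL.single (ρ := ρ) 1 0 ∘L Laurent.mulL ρ (Laurent.mono 1)).restrictScalars ℝ ∘L
      posL (ρ := ρ) ∘L .snd ℝ PosSeq PosSeq ∘L .snd ℝ PosSeq (PosSeq × PosSeq)) ∘L
    .snd ℝ ℝ (PosSeq × PosSeq × PosSeq)

theorem residueZero_apply (y : PSpace) : (residueZero y : MatL ρ) =
    (MatL.single 0 0 (posL y.2.1) - MatL.single 1 1 (posL y.2.1))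
      + MatL.single 0 1 (Laurent.mono (-1) * posL y.2.2.1)
      + MatL.single 1 0 (Laurent.mono 1 * posL y.2.2.2) := rfl

theorem residueZero_00 (y : PSpace) : MatL.entry 0 0 (residueZero y : MatL ρ) = posL y.2.1 := by
  simp [residueZero_apply, MatL.entry_single]

theorem residueZero_01 (y : PSpace) : MatL.entry 0 1 (residueZero y : MatL ρ)
    = Laurent.mono (-1) * posL y.2.2.1 := by
  simp [residueZero_apply, MatL.entry_single]

theorem residueZero_10 (y : PSpace) : MatL.entry 1 0 (residueZero y : MatL ρ)
    = Laurent.mono 1 * posL y.2.2.2 := by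
  simp [residueZero_apply, MatL.entry_single]

theorem residueZero_11 (y : PSpace) : MatL.entry 1 1 (residueZero y : MatL ρ) = -posL y.2.1 := by
  simp [residueZero_apply, MatL.entry_single]

/-- The map `M(μ) ↦ D⁻¹ M(-μ) D`. -/
def twist (m : ℕ) : MatL ρ →L[ℂ] MatL ρ :=
  ∑ i : Fin 2, ∑ k : Fin 2, dmul m i k • (MatL.single (ρ := ρ) i k ∘L Laurent.negSubst (ρ := ρ) ∘L MatL.entry (ρ := ρ) i k)

theorem entry_twist (m : ℕ) (M : MatL ρ) (i k : Fin 2) :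
    MatL.entry i k (twist m M) = dmul m i k • Laurent.negSubst (MatL.entry i k M) := by
  simp only [twist, Fin.sum_univ_two, _root_.add_apply, _root_.smul_apply,
    ContinuousLinearMap.comp_apply, map_add, map_smul, MatL.entry_single]
  fin_cases i <;> fin_cases k <;> simp

/-- The residue `A_j` as a function of the parameter. -/
def residue (m : ℕ) : ℕ → PSpace →L[ℝ] MatL ρ
  | 0 => residueZero
  | j + 1 => (twist m).restrictScalars ℝ ∘L residue m j

theorem evalM_residue (m : ℕ) (x : Param ρ) (j : ℕ) (μ : ℂ) (hμ : ‖μ‖ = 1) :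
    MatL.evalM μ hμ (residue m j (toP x) : MatL ρ) = A m x j μ := by
  induction j generalizing μ with
  | zero =>
    have h : (residue m 0 (toP x) : MatL ρ) = residueZero (toP x) := rfl
    rw [h]
    ext i k
    rw [MatL.evalM_apply]
    fin_cases i <;> fin_cases k
    · exact (congrArg _ (residueZero_00 _)).trans (evalL_posL x.a μ hμ)
    · refine (congrArg _ (residueZero_01 _)).trans ?_
      rw [Laurent.evalL_mul, Laurent.evalL_mono, zpow_neg_one]
      exact congrArg _ (evalL_posL x.b μ hμ)
    · refine (congrArg _ (residueZero_10 _)).trans ?_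
      rw [Laurent.evalL_mul, Laurent.evalL_mono, zpow_one]
      exact congrArg _ (evalL_posL x.c μ hμ)
    · refine (congrArg _ (residueZero_11 _)).trans ?_
      rw [map_neg]
      exact congrArg _ (evalL_posL x.a μ hμ)
  | succ j ih =>
    have hμ' : ‖-μ‖ = 1 := by rwa [norm_neg]
    have h : (residue m (j + 1) (toP x) : MatL ρ) = twist m (residue m j (toP x)) := rfl
    have h' : A m x (j + 1) μ = (D m)⁻¹ * A m x j (-μ) * D m := rfl
    rw [h, h', ← ih (-μ) hμ']
    ext i k
    rw [conjD_apply, MatL.evalM_apply, entry_twist, map_smul, Laurent.evalL_negSubst μ hμ hμ',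
      MatL.evalM_apply, smul_eq_mul]

/-! ### The gauged potential along `γ_0` -/

/-- The path `s ↦ κ(s) a`. -/
def pathSmul (κ : C(Icc (0 : ℝ) 1, ℂ)) : MatL ρ →L[ℂ] PathAlg (MatL ρ) :=
  LinearMap.mkContinuous
    { toFun := fun a => .mk (fun s => κ s • a) (κ.continuous.smul continuous_const)
      map_add' := fun a b => by ext s; simp [smul_add]
      map_smul' := fun c a => by ext s; exact smul_comm _ _ _ } ‖κ‖ fun a => by
    refine PathAlg.norm_le (by positivity) fun s => ?_
    refine (norm_smul_le _ _).trans ?_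
    gcongr
    exact κ.norm_coe_le_norm s

theorem totalInt_pathSmul (κ : C(Icc (0 : ℝ) 1, ℂ)) (a : MatL ρ) :
    totalInt (pathSmul κ a) = (∫ u in (0 : ℝ)..1, κ (projIcc 0 1 zero_le_one u)) • a := by
  rw [totalInt_apply]
  exact intervalIntegral.integral_smul_const _ _

/-- The function `ker m j k` on `[0,1]`. -/
def kerC (m : ℕ) (j : Fin (nn m)) (k : ℕ) : C(Icc (0 : ℝ) 1, ℂ) :=
  ⟨fun s => ker m j k s, (continuousOn_ker m j.2 k).domRestrict⟩

theorem integral_kerC (m : ℕ) (j : Fin (nn m)) (k : ℕ) :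
    ∫ u in (0 : ℝ)..1, kerC m j k (projIcc 0 1 zero_le_one u)
      = if (j : ℕ) = 0 then 2 * Real.pi * I else 0 := by
  rw [← integral_ker m j.2 k]
  refine intervalIntegral.integral_congr fun u hu => ?_
  rw [uIcc_of_le zero_le_one] at hu
  simp only [kerC, projIcc_of_mem zero_le_one hu]
  rfl

/-- The nilpotent matrix `(0, 0; 1, 0)`. -/
def nilp : MatL ρ := MatL.single 1 0 1

/-- The commutator with the nilpotent matrix. -/
def bracket (a : MatL ρ) : MatL ρ := nilp * a - a * nilp

/-- The pull back to `[0,1]` of the potential `Φ₀ (∑ A_j dz / (z - p_j)) Φ₀⁻¹`, where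
`Φ₀ = (1, 0; r z^m, 1)`. -/
def gauged (m : ℕ) (y : PSpace) : PathAlg (MatL ρ) :=
  ∑ j : Fin (nn m), (pathSmul (kerC m j 0) (residue m j y)
    + (y.1 : ℂ) • pathSmul (kerC m j m) (bracket (residue m j y))
    - ((y.1 : ℂ) ^ 2) • pathSmul (kerC m j (2 * m)) (nilp * residue m j y * nilp))

theorem contDiff_gauged (m : ℕ) : ContDiff ℝ 1 (gauged (ρ := ρ) m) := by
  have hr : ContDiff ℝ 1 fun y : PSpace => ((y.1 : ℝ) : ℂ) := ofRealCLM.contDiff.comp contDiff_fst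
  refine ContDiff.sum fun j _ => ?_
  have hA : ContDiff ℝ 1 fun y : PSpace => (residue m j y : MatL ρ) := (residue (ρ := ρ) m j).contDiff
  have hp : ∀ κ : C(Icc (0 : ℝ) 1, ℂ), ContDiff ℝ 1 fun a : MatL ρ => pathSmul κ a := fun κ =>
    ((pathSmul (ρ := ρ) κ).restrictScalars ℝ).contDiff
  refine (((hp _).comp hA).add (hr.smul ((hp _).comp ?_))).sub ((hr.pow 2).smul ((hp _).comp ?_))
  · exact (contDiff_const.mul hA).sub (hA.mul contDiff_const)
  · exact (contDiff_const.mul hA).mul contDiff_const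

/-- The limit of the logarithm of the monodromy for `t → 0`, divided by `2πi`. -/
def central (y : PSpace) : MatL ρ :=
  residueZero y + (y.1 : ℂ) • bracket (residueZero y) - ((y.1 : ℂ) ^ 2) • (nilp * residueZero y * nilp)

theorem totalInt_gauged (m : ℕ) (y : PSpace) :
    totalInt (gauged (ρ := ρ) m y) = (2 * Real.pi * I : ℂ) • central y := by
  have h0 : 0 < nn m := by rw [nn]; omega
  rw [gauged, map_sum, Finset.sum_eq_single (⟨0, h0⟩ : Fin (nn m))]
  · simp only [map_sub, map_add, map_smul, totalInt_pathSmul, integral_kerC, if_true]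
    have h : (residue m 0 y : MatL ρ) = residueZero y := rfl
    rw [h, central, smul_sub, smul_add, smul_comm (y.1 : ℂ), smul_comm ((y.1 : ℂ) ^ 2)]
  · intro j _ hj
    have hj' : (j : ℕ) ≠ 0 := fun h => hj (Fin.ext h)
    simp only [map_sub, map_add, map_smul, totalInt_pathSmul, integral_kerC, if_neg hj', zero_smul,
      smul_zero, add_zero, sub_zero]
  · intro h
    exact absurd (Finset.mem_univ _) h

/-- The gauge `Φ₀ = (1, 0; r z^m, 1)`. -/
def gauge (m : ℕ) (r : ℝ) (z : ℂ) : Matrix (Fin 2) (Fin 2) ℂ := !![1, 0; r * z ^ m, 1]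

theorem evalM_nilp (μ : ℂ) (hμ : ‖μ‖ = 1) :
    MatL.evalM μ hμ (nilp : MatL ρ) = !![0, 0; 1, 0] := by
  ext i k
  rw [MatL.evalM_apply, nilp, MatL.entry_single]
  fin_cases i <;> fin_cases k <;> simp [Laurent.evalL_one]

/-- For `N = (0, 0; 1, 0)` and a scalar `w`, `(1 + wN) A (1 - wN) = A + w (NA - AN) - w² NAN`; with
`w = r z^m` this produces the kernels with `k = 0, m, 2m`. The relation is written as an
intertwining so that no inverse of the gauge occurs. -/
theorem evalM_gauged (m : ℕ) (x : Param ρ) (μ : ℂ) (hμ : ‖μ‖ = 1) (s : Icc (0 : ℝ) 1) :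
    MatL.evalM μ hμ (gauged (ρ := ρ) m (toP x) s) * gauge m x.r (γ m 0 s) =
      gauge m x.r (γ m 0 s) * (deriv (γ m 0) s •
        ∑ j ∈ Finset.range (nn m), (γ m 0 s - p m j)⁻¹ • A m x j μ) := by
  have h1 : gauged (ρ := ρ) m (toP x) s = (∑ j : Fin (nn m), (kerC m j 0 s • residue m j (toP x)
    + (x.r : ℂ) • kerC m j m s • bracket (residue m j (toP x))
    - ((x.r : ℂ) ^ 2) • kerC m j (2 * m) s • (nilp * residue m j (toP x) * nilp)) : MatL ρ) :=
    map_sum (PathAlg.evalAt s) _ _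
  rw [h1, map_sum, Finset.sum_mul, Finset.sum_range, Finset.smul_sum, Finset.mul_sum]
  refine Finset.sum_congr rfl fun j _ => ?_
  rw [map_sub, map_add, MatL.evalM_smul, MatL.evalM_smul, MatL.evalM_smul, MatL.evalM_smul,
    MatL.evalM_smul, bracket, map_sub, map_mul, map_mul, map_mul, map_mul, evalM_residue, evalM_nilp]
  have hk : ∀ k, kerC m j k s = deriv (γ m 0) s * (γ m 0 s ^ k * (γ m 0 s - p m j)⁻¹) := fun k => by
    rw [← div_eq_mul_inv]; rfl
  rw [hk, hk, hk, gauge, pow_zero, mul_comm 2 m, pow_mul]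
  generalize (γ m 0 s - p m j)⁻¹ = q
  generalize deriv (γ m 0) s = d
  generalize γ m 0 s ^ m = z
  generalize A m x j μ = a
  rw [Matrix.eta_fin_two a]
  ext i k
  fin_cases i <;> fin_cases k <;> simp [Matrix.mul_apply, Fin.sum_univ_two] <;> ring

/-- The gauge solves the equation at `t = 0`, so conjugating by it leaves a coefficient proportional
to `t`. -/
theorem hasDerivAt_gauge (m : ℕ) (r : ℝ) (s : ℝ) (l k : Fin 2) :
    HasDerivAt (fun u => gauge m r (γ m 0 u) l k)
      ((gauge m r (γ m 0 s) * (deriv (γ m 0) s •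
        !![0, 0; m * r * γ m 0 s ^ (m - 1), 0])) l k) s := by
  have h := ((hasDerivAt_γ m 0 s).pow m).const_mul (r : ℂ)
  fin_cases l <;> fin_cases k <;> simp [gauge, Matrix.mul_apply, Fin.sum_univ_two]
  · exact hasDerivAt_const _ _
  · exact hasDerivAt_const _ _
  · refine h.congr_deriv ?_
    ring
  · exact hasDerivAt_const _ _

/-- The transport along `γ_0` is the evaluation of the solution of the gauged equation. -/
theorem isTransport_evalM {m : ℕ} (hm : 1 ≤ m) (t : ℝ) (x : Param ρ) (μ : ℂ) (hμ : ‖μ‖ = 1)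
    (hB : ‖(t : ℂ) • gauged (ρ := ρ) m (toP x)‖ < 1) :
    IsTransport m t x 0 μ fun s =>
      MatL.evalM μ hμ (odeFun ((t : ℂ) • gauged (ρ := ρ) m (toP x)) s) * gauge m x.r (γ m 0 s) := by
  refine ⟨?_, fun s hs i k => ?_⟩
  · beta_reduce
    rw [odeFun_zero, map_one, one_mul, γ_at_zero, gauge, zero_pow (by omega), mul_zero]
    exact Matrix.one_fin_two.symm
  · set B := (t : ℂ) • gauged (ρ := ρ) m (toP x) with hBdef
    have hY := hasDerivAt_odeFun hB ⟨s, hs⟩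
    have hYe : ∀ l, HasDerivAt (fun u => MatL.evalM μ hμ (odeFun B u) i l)
        (MatL.evalM μ hμ (odeFun B s * B ⟨s, hs⟩) i l) s := fun l =>
      (((Laurent.evalL (ρ := ρ) μ hμ ∘L MatL.entry (ρ := ρ) i l).restrictScalars ℝ).hasFDerivAt).comp_hasDerivAt s hY
    have hG := fun l => hasDerivAt_gauge m x.r s l k
    have h := (((hYe 0).mul (hG 0)).add ((hYe 1).mul (hG 1))).hasDerivWithinAt (s := Icc 0 1)
    have hfun : (fun u => (MatL.evalM μ hμ (odeFun B u) * gauge m x.r (γ m 0 u)) i k)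
        = fun u => MatL.evalM μ hμ (odeFun B u) i 0 * gauge m x.r (γ m 0 u) 0 k
          + MatL.evalM μ hμ (odeFun B u) i 1 * gauge m x.r (γ m 0 u) 1 k := by
      funext u
      rw [Matrix.mul_apply, Fin.sum_univ_two]
    rw [hfun]
    refine h.congr_deriv ?_
    have hB' : MatL.evalM μ hμ (B ⟨s, hs⟩) * gauge m x.r (γ m 0 s) = gauge m x.r (γ m 0 s) *
        (deriv (γ m 0) s • (t : ℂ) •
          ∑ j ∈ Finset.range (nn m), (γ m 0 s - p m j)⁻¹ • A m x j μ) := by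
      rw [hBdef, PathAlg.smul_apply, MatL.evalM_smul, Matrix.smul_mul, evalM_gauged, smul_comm _ (t : ℂ),
        Matrix.mul_smul _ (t : ℂ)]
    -- Product rule for `Y Φ₀`: the intertwining moves `B` past the gauge, where it becomes the
    -- polar part of `η`, and the derivative of the gauge supplies the rest.
    have h2 : MatL.evalM μ hμ (odeFun B s * B ⟨s, hs⟩) * gauge m x.r (γ m 0 s)
        + MatL.evalM μ hμ (odeFun B s) * (gauge m x.r (γ m 0 s) * (deriv (γ m 0) s •
          !![0, 0; m * x.r * γ m 0 s ^ (m - 1), 0]))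
        = MatL.evalM μ hμ (odeFun B s) * gauge m x.r (γ m 0 s) *
          (deriv (γ m 0) s • η m t x (γ m 0 s) μ) := by
      rw [map_mul, mul_assoc, hB', η, smul_add, mul_add, mul_assoc, mul_assoc, add_comm, mul_assoc]
    rw [← h2, Matrix.add_apply, Matrix.mul_apply (M := MatL.evalM μ hμ (odeFun B s * _)),
      Matrix.mul_apply (M := MatL.evalM μ hμ (odeFun B s)), Fin.sum_univ_two, Fin.sum_univ_two]
    ring

/-- The loop begins and ends at `0`, and `0^m = 0` because `m ≥ 1`, so the gauge is the identity at
both ends. -/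
theorem mon_zero_eq {m : ℕ} (hm : 1 ≤ m) (t : ℝ) (x : Param ρ) (μ : ℂ) (hμ : ‖μ‖ = 1)
    (hB : ‖(t : ℂ) • gauged (ρ := ρ) m (toP x)‖ < 1) :
    Mon m t x 0 μ = MatL.evalM μ hμ (odeEnd ((t : ℂ) • gauged (ρ := ρ) m (toP x))) := by
  rw [(isTransport_evalM hm t x μ hμ hB).mon_eq, odeFun_one hB, γ_at_one, gauge,
    zero_pow (by omega), mul_zero, ← Matrix.one_fin_two, mul_one]

end DPW

namespace DPW

open Complex Set
open scoped ComplexConjugate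

variable {ρ : ℝ} [hρ : Fact (1 < ρ)]

/-! ### Coefficients of power series and Laurent series -/

/-- The substitution `μ ↦ μ⁻¹`. -/
def Laurent.rev : Laurent ρ →L[ℂ] Laurent ρ :=
  Laurent.lift (fun k => Laurent.e (-k)) 1 fun _ => (Laurent.norm_e _).le

theorem Laurent.coef_rev (k : ℤ) (f : Laurent ρ) :
    Laurent.coef k (Laurent.rev f) = Laurent.coef (-k) f := by
  have : Laurent.coefL (ρ := ρ) k ∘L Laurent.rev (ρ := ρ) = Laurent.coefL (-k) := by
    refine Laurent.ext_clm fun j => ?_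
    rw [ContinuousLinearMap.comp_apply, Laurent.rev, Laurent.lift_e, Laurent.coefL_apply,
      Laurent.coefL_apply, Laurent.coef_e, Laurent.coef_e]
    have h : wt ρ (-k) = wt ρ k := by simp [wt]
    by_cases hj : j = -k
    · rw [if_pos (by omega), if_pos hj, h]
    · rw [if_neg (by omega), if_neg hj]
  rw [← Laurent.coefL_apply, ← Laurent.coefL_apply, ← this]
  rfl

/-- The real part of the coefficient of `μ^k`. -/
def rcoef (k : ℤ) : Laurent ρ →L[ℝ] ℝ := reCLM ∘L (Laurent.coefL (ρ := ρ) k).restrictScalars ℝ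

theorem rcoef_apply (k : ℤ) (f : Laurent ρ) : rcoef k f = (Laurent.coef k f).re := by
  rw [← Laurent.coefL_apply]
  rfl

theorem rcoef_rev (k : ℤ) (f : Laurent ρ) : rcoef k (Laurent.rev f) = rcoef (-k) f := by
  rw [rcoef_apply, rcoef_apply, Laurent.coef_rev]

theorem rcoef_mono_mul (j k : ℤ) (f : Laurent ρ) :
    rcoef k (Laurent.mono j * f) = rcoef (k - j) f := by
  rw [rcoef_apply, rcoef_apply, Laurent.coef_mono_mul]

variable (ρ) in
/-- The coefficients of a power series. -/
def pcoef (n : ℕ) : PosSeq →L[ℝ] ℝ := rcoef (ρ := ρ) (n : ℤ) ∘L posL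

theorem pcoef_apply (n : ℕ) (f : PosSeq) : pcoef ρ n f = f n / ρ ^ n := by
  change rcoef (n : ℤ) (posL f : Laurent ρ) = _
  rw [rcoef_apply, coef_posL_nat, ofReal_re]

theorem rcoef_posL_nat (n : ℕ) (f : PosSeq) : rcoef (n : ℤ) (posL f : Laurent ρ) = pcoef ρ n f := rfl

theorem rcoef_posL_neg {k : ℤ} (hk : k < 0) (f : PosSeq) : rcoef k (posL f : Laurent ρ) = 0 := by
  rw [rcoef_apply, coef_posL_neg f hk, zero_re]

variable (ρ) in
theorem posSeq_ext {f g : PosSeq} (h : ∀ n, pcoef ρ n f = pcoef ρ n g) : f = g := by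
  ext n
  have h1 := h n
  rw [pcoef_apply, pcoef_apply, div_left_inj' (pow_pos (rho_pos (ρ := ρ)) n).ne'] at h1
  exact h1

theorem Laurent.norm_eq_tsum (f : Laurent ρ) : ‖f‖ = ∑' k, ‖Laurent.coef k f‖ * wt ρ k := by
  refine (l1_norm_eq_tsum (R := ℂ) f).trans (tsum_congr fun k => ?_)
  have h1 := Laurent.wt_pos hρ.out k
  rw [Laurent.coef, norm_div, Complex.norm_real, Real.norm_of_nonneg h1.le,
    div_mul_cancel₀ _ h1.ne']

theorem norm_trunc_le (N n : ℕ) (f : Laurent ρ) :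
    ‖if N ≤ n then rcoef (n : ℤ) f * ρ ^ n else 0‖
      ≤ ‖Laurent.coef (n : ℤ) f‖ * wt ρ (n : ℤ) := by
  have h := rho_pos (ρ := ρ)
  rw [wt_natCast]
  split_ifs
  · rw [norm_mul, norm_pow, Real.norm_of_nonneg h.le, rcoef_apply]
    gcongr
    exact abs_re_le_norm _
  · rw [norm_zero]
    positivity

theorem summable_coef_nat (f : Laurent ρ) :
    Summable fun n : ℕ => ‖Laurent.coef (n : ℤ) f‖ * wt ρ (n : ℤ) :=
  (Laurent.summable_norm_coef_mul f).comp_injective Nat.cast_injective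

/-- The power series of the real parts of the coefficients of `μ^n`, `n ≥ N`. -/
def posPart (N : ℕ) : Laurent ρ →L[ℝ] PosSeq :=
  LinearMap.mkContinuous
    { toFun := fun f => ⟨fun n => if N ≤ n then rcoef (n : ℤ) f * ρ ^ n else 0, memℓp_gen (by
        simp only [ENNReal.toReal_one, Real.rpow_one]
        exact Summable.of_nonneg_of_le (fun _ => norm_nonneg _) (fun n => norm_trunc_le N n f)
          (summable_coef_nat f))⟩
      map_add' := fun f g => by
        ext n
        change (if N ≤ n then rcoef (n : ℤ) (f + g) * ρ ^ n else 0)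
          = (if N ≤ n then rcoef (n : ℤ) f * ρ ^ n else 0)
            + (if N ≤ n then rcoef (n : ℤ) g * ρ ^ n else 0)
        split_ifs
        · rw [map_add, add_mul]
        · rw [add_zero]
      map_smul' := fun c f => by
        ext n
        change (if N ≤ n then rcoef (n : ℤ) (c • f) * ρ ^ n else 0)
          = c * (if N ≤ n then rcoef (n : ℤ) f * ρ ^ n else 0)
        split_ifs
        · rw [map_smul, smul_eq_mul, mul_assoc]
        · rw [mul_zero] } 1 fun f => by
    rw [one_mul, Laurent.norm_eq_tsum, l1_norm_eq_tsum]
    have h1 : Summable fun n : ℕ => ‖if N ≤ n then rcoef (n : ℤ) f * ρ ^ n else 0‖ :=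
      Summable.of_nonneg_of_le (fun _ => norm_nonneg _) (fun n => norm_trunc_le N n f)
        (summable_coef_nat f)
    refine (h1.tsum_le_tsum (fun n => norm_trunc_le N n f) (summable_coef_nat f)).trans ?_
    refine tsum_comp_le_tsum_of_inj (Laurent.summable_norm_coef_mul f) (fun k => ?_)
      (Nat.cast_injective (R := ℤ))
    exact mul_nonneg (norm_nonneg _) (Laurent.wt_pos hρ.out k).le

theorem pcoef_posPart (N n : ℕ) (f : Laurent ρ) :
    pcoef ρ n (posPart N f) = if N ≤ n then rcoef (n : ℤ) f else 0 := by
  rw [pcoef_apply]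
  change (if N ≤ n then rcoef (n : ℤ) f * ρ ^ n else 0) / _ = _
  have h := (pow_pos (rho_pos (ρ := ρ)) n).ne'
  split_ifs
  · rw [mul_div_cancel_right₀ _ h]
  · rw [zero_div]

variable (ρ) in
/-- The monomial `v μ^n`. -/
def pmono (n : ℕ) : ℝ →L[ℝ] PosSeq :=
  ContinuousLinearMap.toSpanSingleton ℝ (lp.single 1 n (ρ ^ n) : PosSeq)

theorem pcoef_pmono (j n : ℕ) (v : ℝ) : pcoef ρ n (pmono ρ j v) = if n = j then v else 0 := by
  rw [pcoef_apply]
  change (v * (lp.single 1 j (ρ ^ j) : PosSeq) n) / _ = _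
  have h := (pow_pos (rho_pos (ρ := ρ)) n).ne'
  split_ifs with hn
  · subst hn
    rw [lp.single_apply_self, mul_div_cancel_right₀ _ h]
  · rw [lp.single_apply_ne _ _ _ hn, mul_zero, zero_div]

/-- The real part of the value at `1`. -/
def valOne : Laurent ρ →L[ℝ] ℝ :=
  reCLM ∘L (Laurent.evalL (ρ := ρ) 1 norm_one).restrictScalars ℝ

/-- The real part of the value at `-1`. -/
def valNegOne : Laurent ρ →L[ℝ] ℝ :=
  reCLM ∘L (Laurent.evalL (ρ := ρ) (-1) (by rw [norm_neg, norm_one])).restrictScalars ℝ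

theorem valOne_apply (f : Laurent ρ) : valOne f = (Laurent.evalL 1 norm_one f).re := rfl

theorem valNegOne_apply (f : Laurent ρ) :
    valNegOne f = (Laurent.evalL (-1) (by rw [norm_neg, norm_one]) f).re := rfl

theorem posL_pmono (n : ℕ) (v : ℝ) : (posL (pmono ρ n v) : Laurent ρ) = (v : ℂ) • Laurent.mono n := by
  change posL (v • (lp.single 1 n (ρ ^ n) : PosSeq)) = _
  rw [map_smul, posL, l1lift_single, Laurent.mono, wt_natCast, ← Complex.coe_smul, ← Complex.coe_smul]

theorem valOne_pmono (n : ℕ) (v : ℝ) : valOne (posL (pmono ρ n v) : Laurent ρ) = v := by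
  rw [valOne_apply, posL_pmono, map_smul, Laurent.evalL_mono]
  simp

theorem valNegOne_pmono (n : ℕ) (v : ℝ) :
    valNegOne (posL (pmono ρ n v) : Laurent ρ) = (-1) ^ n * v := by
  rw [valNegOne_apply, posL_pmono, map_smul, Laurent.evalL_mono, zpow_natCast, smul_eq_mul,
    re_ofReal_mul, mul_comm]
  congr 1
  rw [show ((-1 : ℂ) ^ n) = (((-1 : ℝ) ^ n : ℝ) : ℂ) by push_cast; rfl, ofReal_re]

theorem valOne_mono_mul (f : Laurent ρ) : valOne (Laurent.mono (-1) * f) = valOne f := by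
  rw [valOne_apply, valOne_apply, Laurent.evalL_mul, Laurent.evalL_mono]
  simp

theorem valNegOne_mono_mul (f : Laurent ρ) : valNegOne (Laurent.mono (-1) * f) = -valNegOne f := by
  rw [valNegOne_apply, valNegOne_apply, Laurent.evalL_mul, Laurent.evalL_mono]
  simp

/-! ### The inverse of the linearised system -/

/-- The data of the system: a matrix of Laurent series and the defect of the normalisation. -/
abbrev Data (ρ : ℝ) : Type := MatL ρ × ℝ

section Inverse

/-- The entries of the matrix. -/
def ent (i k : Fin 2) : Data ρ →L[ℝ] Laurent ρ :=
  (MatL.entry (ρ := ρ) i k).restrictScalars ℝ ∘L .fst ℝ (MatL ρ) ℝ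

/-- The coefficients of `M₁₁ - M₁₁*`. -/
def fc (k : ℤ) : Data ρ →L[ℝ] ℝ := rcoef (ρ := ρ) k ∘L ent (ρ := ρ) 0 0 - rcoef (ρ := ρ) (-k) ∘L ent (ρ := ρ) 0 0

/-- The coefficients of `M₂₁ - M₁₂*`. -/
def gc (k : ℤ) : Data ρ →L[ℝ] ℝ := rcoef (ρ := ρ) k ∘L ent (ρ := ρ) 1 0 - rcoef (ρ := ρ) (-k) ∘L ent (ρ := ρ) 0 1

/-- The coefficients `b_n`, `n ≥ 3`, of the solution of the linearised system. -/
def bTail : Data ρ →L[ℝ] PosSeq :=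
  posPart (ρ := ρ) 3 ∘L (Laurent.mulL ρ (Laurent.mono 1)).restrictScalars ℝ ∘L
    (ent (ρ := ρ) 0 1 - (Laurent.rev (ρ := ρ)).restrictScalars ℝ ∘L ent (ρ := ρ) 1 0)

/-- The coefficients `a_n`, `n ≥ 2`, of the solution of the linearised system. -/
def aTail : Data ρ →L[ℝ] PosSeq :=
  posPart (ρ := ρ) 2 ∘L (ent (ρ := ρ) 0 0 - (Laurent.rev (ρ := ρ)).restrictScalars ℝ ∘L ent (ρ := ρ) 0 0
    - (Laurent.rev (ρ := ρ)).restrictScalars ℝ ∘L ent (ρ := ρ) 1 0 + ent (ρ := ρ) 0 1)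

/-- The coefficients `c_n`, `n ≥ 1`, of the solution of the linearised system. -/
def cTail : Data ρ →L[ℝ] PosSeq :=
  posPart (ρ := ρ) 1 ∘L (Laurent.mulL ρ (Laurent.mono (-1))).restrictScalars ℝ ∘L
    (ent (ρ := ρ) 1 0 - (Laurent.rev (ρ := ρ)).restrictScalars ℝ ∘L ent (ρ := ρ) 0 1
      - (2 : ℝ) • (ent (ρ := ρ) 0 0 - (Laurent.rev (ρ := ρ)).restrictScalars ℝ ∘L ent (ρ := ρ) 0 0)
      + (Laurent.rev (ρ := ρ)).restrictScalars ℝ ∘L ent (ρ := ρ) 1 0 - ent (ρ := ρ) 0 1)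

/-- The value of `b_0 + b_2`. -/
def bEven : Data ρ →L[ℝ] ℝ :=
  -- On the linearised data the upper right entry is `μ⁻¹ b`, with values `b(1)` and `-b(-1)`. Half
  -- their difference is the sum of the even coefficients of `b`; the known tail is subtracted, and
  -- half the sum of the values similarly gives the odd ones.
  (1 / 2 : ℝ) • (valOne (ρ := ρ) ∘L ent (ρ := ρ) 0 1 - valNegOne (ρ := ρ) ∘L ent (ρ := ρ) 0 1
    - valOne (ρ := ρ) ∘L posL (ρ := ρ) ∘L bTail (ρ := ρ) - valNegOne (ρ := ρ) ∘L posL (ρ := ρ) ∘L bTail (ρ := ρ))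

/-- The value of `b_1`. -/
def bOne : Data ρ →L[ℝ] ℝ :=
  (1 / 2 : ℝ) • (valOne (ρ := ρ) ∘L ent (ρ := ρ) 0 1 + valNegOne (ρ := ρ) ∘L ent (ρ := ρ) 0 1
    - valOne (ρ := ρ) ∘L posL (ρ := ρ) ∘L bTail (ρ := ρ) + valNegOne (ρ := ρ) ∘L posL (ρ := ρ) ∘L bTail (ρ := ρ))

/-- The value of `r`. -/
def rVal : Data ρ →L[ℝ] ℝ := gc (ρ := ρ) (-1) + bEven (ρ := ρ)

/-- The value of `b_0`. -/
def bZero : Data ρ →L[ℝ] ℝ :=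
  -- Three relations remain: `fc 1 = a_1 - b_2 + b_0 - r`, `gc 1 = c_0 + 2 a_1 - b_2 - b_0 + r`, and
  -- `κ = -2 b_0 - c_0 / 2` for the normalisation. Eliminating `a_1`, `c_0` and `b_2 = bEven - b_0`
  -- leaves the coefficient `8` at `b_0`.
  (1 / 8 : ℝ) • ((2 : ℝ) • fc (ρ := ρ) 1 + bEven (ρ := ρ) + (3 : ℝ) • rVal (ρ := ρ) - (2 : ℝ) • ContinuousLinearMap.snd ℝ (MatL ρ) ℝ - gc (ρ := ρ) 1)

/-- The inverse of the linearisation of the system at the central value. -/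
def linInv : Data ρ →L[ℝ] PSpace :=
  (rVal (ρ := ρ)).prod <|
    (aTail (ρ := ρ) + pmono ρ 0 ∘L (bOne (ρ := ρ) + (1 / 2 : ℝ) • gc (ρ := ρ) 0)
      + pmono ρ 1 ∘L (fc (ρ := ρ) 1 + (bEven (ρ := ρ) - bZero (ρ := ρ)) - bZero (ρ := ρ) + rVal (ρ := ρ))).prod <|
    (bTail (ρ := ρ) + pmono ρ 0 ∘L bZero (ρ := ρ) + pmono ρ 1 ∘L bOne (ρ := ρ) + pmono ρ 2 ∘L (bEven (ρ := ρ) - bZero (ρ := ρ))).prod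
    (cTail (ρ := ρ) + pmono ρ 0 ∘L ((-2 : ℝ) • ContinuousLinearMap.snd ℝ (MatL ρ) ℝ - (4 : ℝ) • bZero (ρ := ρ)))

theorem fc_apply (k : ℤ) (w : Data ρ) : fc k w = rcoef k (ent 0 0 w) - rcoef (-k) (ent 0 0 w) := rfl

theorem gc_apply (k : ℤ) (w : Data ρ) : gc k w = rcoef k (ent 1 0 w) - rcoef (-k) (ent 0 1 w) := rfl

/-- High modes of the linearised system are triangular. For `k ≥ 2`, `gc (-k)` is `-b_{k+1}`, then
`fc k` is `a_k - b_{k+1}`, and `gc k` is `c_{k-1} + 2 a_k - b_{k+1}`. Solving in this order gives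
the formulas for `bTail`, `aTail` and `cTail`. -/
theorem pcoef_bTail (w : Data ρ) (n : ℕ) :
    pcoef ρ n (bTail w) = if 3 ≤ n then -gc (1 - n) w else 0 := by
  have h : bTail w = posPart 3 (Laurent.mono 1 * (ent 0 1 w - Laurent.rev (ent 1 0 w))) := rfl
  rw [h, pcoef_posPart, rcoef_mono_mul, map_sub, rcoef_rev, gc_apply, neg_sub (rcoef _ _),
    neg_sub (1 : ℤ), neg_sub (n : ℤ)]

theorem pcoef_aTail (w : Data ρ) (n : ℕ) :
    pcoef ρ n (aTail w) = if 2 ≤ n then fc n w - gc (-n) w else 0 := by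
  have h : aTail w = posPart 2 (ent 0 0 w - Laurent.rev (ent 0 0 w) - Laurent.rev (ent 1 0 w)
    + ent 0 1 w) := rfl
  rw [h, pcoef_posPart, map_add, map_sub, map_sub, rcoef_rev, rcoef_rev, gc_apply, fc_apply, neg_neg]
  congr 1
  ring

theorem pcoef_cTail (w : Data ρ) (n : ℕ) : pcoef ρ n (cTail w) =
    if 1 ≤ n then gc (n + 1) w - 2 * fc (n + 1) w + gc (-(n + 1)) w else 0 := by
  have h : cTail w = posPart 1 (Laurent.mono (-1) * (ent 1 0 w - Laurent.rev (ent 0 1 w)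
    - (2 : ℝ) • (ent 0 0 w - Laurent.rev (ent 0 0 w)) + Laurent.rev (ent 1 0 w) - ent 0 1 w)) := rfl
  rw [h, pcoef_posPart, rcoef_mono_mul, map_sub, map_add, map_sub, map_sub, map_smul, map_sub,
    rcoef_rev, rcoef_rev, rcoef_rev, gc_apply, gc_apply, fc_apply, neg_neg, sub_neg_eq_add, smul_eq_mul]
  congr 1
  ring

theorem bEven_apply (w : Data ρ) : bEven w = (1 / 2 : ℝ) * (valOne (ent 0 1 w)
    - valNegOne (ent 0 1 w) - valOne (posL (bTail w) : Laurent ρ)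
    - valNegOne (posL (bTail w) : Laurent ρ)) := rfl

theorem bOne_apply (w : Data ρ) : bOne w = (1 / 2 : ℝ) * (valOne (ent 0 1 w)
    + valNegOne (ent 0 1 w) - valOne (posL (bTail w) : Laurent ρ)
    + valNegOne (posL (bTail w) : Laurent ρ)) := rfl

theorem rVal_apply (w : Data ρ) : rVal w = gc (-1) w + bEven w := rfl

theorem bZero_apply (w : Data ρ) :
    bZero w = (1 / 8 : ℝ) * (2 * fc 1 w + bEven w + 3 * rVal w - 2 * w.2 - gc 1 w) := rfl

theorem linInv_apply (w : Data ρ) : linInv w = (rVal w,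
    aTail w + pmono ρ 0 (bOne w + 1 / 2 * gc 0 w) + pmono ρ 1 (fc 1 w + (bEven w - bZero w) - bZero w + rVal w),
    bTail w + pmono ρ 0 (bZero w) + pmono ρ 1 (bOne w) + pmono ρ 2 (bEven w - bZero w),
    cTail w + pmono ρ 0 (-2 * w.2 - 4 * bZero w)) := rfl

/-- `linInv` vanishes exactly on the data that satisfy the system. -/
theorem linInv_eq_zero_iff (w : Data ρ) : linInv w = 0 ↔
    (∀ k : ℕ, 1 ≤ k → fc (k : ℤ) w = 0) ∧ (∀ k : ℤ, gc k w = 0) ∧ valOne (ent 0 1 w) = 0 ∧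
      valNegOne (ent 0 1 w) = 0 ∧ w.2 = 0 := by
  constructor
  · intro h
    rw [linInv_apply] at h
    have h1 : rVal w = 0 := congrArg (fun y : PSpace => y.1) h
    have ha := congrArg (fun y : PSpace => y.2.1) h
    have hb := congrArg (fun y : PSpace => y.2.2.1) h
    have hc := congrArg (fun y : PSpace => y.2.2.2) h
    replace ha := fun n => congrArg (pcoef ρ n) ha
    replace hb := fun n => congrArg (pcoef ρ n) hb
    replace hc := fun n => congrArg (pcoef ρ n) hc
    simp only [map_add, pcoef_aTail, pcoef_bTail, pcoef_cTail, pcoef_pmono, Prod.fst_zero,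
      Prod.snd_zero, map_zero] at ha hb hc
    have b0 : bZero w = 0 := by simpa using hb 0
    have b1 : bOne w = 0 := by simpa using hb 1
    have b2 : bEven w = 0 := by simpa [b0] using hb 2
    have bt : bTail w = 0 := by
      refine posSeq_ext ρ fun n => ?_
      rw [pcoef_bTail, map_zero]
      split_ifs with hn
      · have := hb n
        rwa [if_pos hn, if_neg (by omega), if_neg (by omega), if_neg (by omega), add_zero,
          add_zero, add_zero] at this
      · rfl
    -- The coefficient of index `n + 1` in `bTail` carries `gc (-n)`.
    have gneg : ∀ n : ℕ, 2 ≤ n → gc (-n) w = 0 := fun n hn => by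
      have := pcoef_bTail w (n + 1)
      rw [bt, map_zero, if_pos (by omega), zero_eq_neg] at this
      rw [← this]
      congr 1
      push_cast
      ring_nf
    -- With the tail gone, `b2` and `b1` say that the difference and the sum of the values at `1`
    -- and `-1` vanish.
    rw [bEven_apply, bt, map_zero, map_zero, map_zero] at b2
    rw [bOne_apply, bt, map_zero, map_zero, map_zero] at b1
    have h2 : bEven w = 0 := by rw [bEven_apply, bt, map_zero, map_zero, map_zero]; exact b2
    have h3 : bOne w = 0 := by rw [bOne_apply, bt, map_zero, map_zero, map_zero]; exact b1
    have g1 : gc (-1) w = 0 := by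
      rw [rVal_apply, h2, add_zero] at h1
      exact h1
    have a0 : gc 0 w = 0 := by simpa [h3] using ha 0
    have a1 : fc 1 w = 0 := by simpa [h2, b0, h1] using ha 1
    have fpos : ∀ n : ℕ, 2 ≤ n → fc n w = 0 := fun n hn => by
      simpa [hn, show n ≠ 0 by omega, show n ≠ 1 by omega, gneg n hn] using ha n
    have c0 : w.2 = 0 := by simpa [b0] using hc 0
    have gp1 : gc 1 w = 0 := by
      rw [bZero_apply, a1, h2, h1, c0] at b0
      linarith
    have gpos : ∀ n : ℕ, 2 ≤ n → gc n w = 0 := fun n hn => by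
      obtain ⟨l, rfl⟩ : ∃ l, n = l + 1 := ⟨n - 1, by omega⟩
      have h4 := hc l
      have h5 := fpos (l + 1) hn
      have h6 := gneg (l + 1) hn
      push_cast at h5 h6 ⊢
      rw [if_pos (by omega), if_neg (by omega), h5, h6, mul_zero, sub_zero, add_zero, add_zero] at h4
      exact h4
    refine ⟨fun k hk => ?_, fun k => ?_, by linarith, by linarith, c0⟩
    · rcases hk.eq_or_lt with rfl | hk
      · exact_mod_cast a1
      · exact fpos k hk
    · obtain ⟨n, rfl | rfl⟩ := k.eq_nat_or_neg
      · rcases n with _ | _ | n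
        · exact_mod_cast a0
        · exact_mod_cast gp1
        · exact gpos _ (by omega)
      · rcases n with _ | _ | n
        · simpa using a0
        · exact_mod_cast g1
        · exact gneg _ (by omega)
  · rintro ⟨hf, hg, h1, h2, hκ⟩
    have bt : bTail w = 0 := by
      refine posSeq_ext ρ fun n => ?_
      rw [pcoef_bTail, hg, map_zero]
      simp
    have at' : aTail w = 0 := by
      refine posSeq_ext ρ fun n => ?_
      rw [pcoef_aTail, hg, map_zero]
      split_ifs with hn
      · rw [hf n (by omega), sub_zero]
      · rfl
    have ct : cTail w = 0 := by
      refine posSeq_ext ρ fun n => ?_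
      have h3 := hf (n + 1) (by omega)
      push_cast at h3
      rw [pcoef_cTail, hg, hg, h3, map_zero]
      simp
    have be : bEven w = 0 := by rw [bEven_apply, bt, h1, h2]; simp
    have bo : bOne w = 0 := by rw [bOne_apply, bt, h1, h2]; simp
    have rv : rVal w = 0 := by rw [rVal_apply, hg, be, add_zero]
    have f1 : fc 1 w = 0 := by exact_mod_cast hf 1 le_rfl
    have bz : bZero w = 0 := by rw [bZero_apply, be, rv, hg, f1, hκ]; simp
    rw [linInv_apply, bt, at', ct, be, bo, rv, bz, f1, hg, hκ]
    simp

end Inverse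

end DPW

namespace DPW

open Complex Set
open scoped ComplexConjugate

variable {ρ : ℝ} [hρ : Fact (1 < ρ)]

/-! ### The linearisation of the central value -/

theorem rcoef_posL (k : ℤ) (f : PosSeq) :
    rcoef k (posL f : Laurent ρ) = if 0 ≤ k then pcoef ρ k.toNat f else 0 := by
  split_ifs with h
  · conv_lhs => rw [← Int.toNat_of_nonneg h]
    exact rcoef_posL_nat _ _
  · exact rcoef_posL_neg (not_le.1 h) f

theorem pcoef_toSeq (f : WienerPos ρ) (n : ℕ) : pcoef ρ n (toSeq f) = f.1 n := by
  rw [pcoef_apply, toSeq_apply, mul_div_cancel_right₀ _ (pow_pos (rho_pos (ρ := ρ)) n).ne']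

variable (ρ) in
/-- The central value in normalised coordinates. -/
def centre : PSpace := toP (x₀ ρ)

theorem rcoef_centre_a (k : ℤ) :
    rcoef k (posL (centre ρ).2.1 : Laurent ρ) = if k = 1 then 1 else 0 := by
  rw [rcoef_posL, centre, toP, pcoef_toSeq, x₀]
  dsimp only
  split_ifs <;> first | rfl | omega

theorem rcoef_centre_b (k : ℤ) : rcoef k (posL (centre ρ).2.2.1 : Laurent ρ)
    = if k = 0 then -1 / 2 else if k = 2 then 1 / 2 else 0 := by
  rw [rcoef_posL, centre, toP, pcoef_toSeq, x₀]
  dsimp only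
  split_ifs <;> first | rfl | omega

theorem rcoef_centre_c (k : ℤ) :
    rcoef k (posL (centre ρ).2.2.2 : Laurent ρ) = if k = 0 then -2 else 0 := by
  rw [rcoef_posL, centre, toP, pcoef_toSeq, x₀]
  dsimp only
  split_ifs <;> first | rfl | omega

theorem centre_b : (centre ρ).2.2.1 = pmono ρ 0 (-1 / 2) + pmono ρ 2 (1 / 2) := by
  refine posSeq_ext ρ fun n => ?_
  rw [map_add, pcoef_pmono, pcoef_pmono, ← rcoef_posL_nat, rcoef_centre_b]
  split_ifs <;> first | omega | norm_num

theorem entry_nilp (i k : Fin 2) :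
    MatL.entry i k (nilp : MatL ρ) = if 1 = i ∧ 0 = k then 1 else 0 :=
  MatL.entry_single 1 0 i k 1

theorem entry_bracket_00 (M : MatL ρ) : MatL.entry 0 0 (bracket M) = -MatL.entry 0 1 M := by
  simp [bracket, MatL.entry_mul, entry_nilp]

theorem entry_bracket_01 (M : MatL ρ) : MatL.entry 0 1 (bracket M) = 0 := by
  simp [bracket, MatL.entry_mul, entry_nilp]

theorem entry_bracket_10 (M : MatL ρ) :
    MatL.entry 1 0 (bracket M) = MatL.entry 0 0 M - MatL.entry 1 1 M := by
  simp [bracket, MatL.entry_mul, entry_nilp]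

theorem entry_nilp_mul_nilp (M : MatL ρ) (i k : Fin 2) :
    MatL.entry i k (nilp * M * nilp) = if 1 = i ∧ 0 = k then MatL.entry 0 1 M else 0 := by
  fin_cases i <;> fin_cases k <;> simp [MatL.entry_mul, entry_nilp]

/-- The derivative of `central` at the central value. -/
def centralDeriv (v : PSpace) : MatL ρ :=
  residueZero v + (bracket (residueZero v) + v.1 • bracket (residueZero (centre ρ)))
    - (nilp * residueZero v * nilp + (2 * v.1) • (nilp * residueZero (centre ρ) * nilp))

theorem contDiff_central : ContDiff ℝ 1 (central (ρ := ρ)) := by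
  have hr : ContDiff ℝ 1 fun y : PSpace => ((y.1 : ℝ) : ℂ) := ofRealCLM.contDiff.comp contDiff_fst
  have hA : ContDiff ℝ 1 fun y : PSpace => (residueZero y : MatL ρ) :=
    (residueZero (ρ := ρ)).contDiff
  refine (hA.add (hr.smul ?_)).sub ((hr.pow 2).smul ?_)
  · exact (contDiff_const.mul hA).sub (hA.mul contDiff_const)
  · exact (contDiff_const.mul hA).mul contDiff_const

theorem central_eq (y : PSpace) : (central y : MatL ρ) =
    residueZero y + y.1 • bracket (residueZero y) - (y.1 ^ 2) • (nilp * residueZero y * nilp) := by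
  rw [central, ← ofReal_pow, Complex.coe_smul, Complex.coe_smul]

theorem hasDerivAt_central_line (v : PSpace) :
    HasDerivAt (fun s : ℝ => central (ρ := ρ) (centre ρ + s • v)) (centralDeriv v) 0 := by
  have hl : HasDerivAt (fun s : ℝ => centre ρ + s • v) v 0 := by
    simpa using ((hasDerivAt_id (0 : ℝ)).smul_const v).const_add (centre ρ)
  have h0 : centre ρ + (0 : ℝ) • v = centre ρ := by rw [zero_smul, add_zero]
  have hr : HasDerivAt (fun s : ℝ => (centre ρ + s • v).1) v.1 0 :=
    (ContinuousLinearMap.fst ℝ ℝ (PosSeq × PosSeq × PosSeq)).hasFDerivAt.comp_hasDerivAt 0 hl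
  have hA : HasDerivAt (fun s : ℝ => residueZero (ρ := ρ) (centre ρ + s • v)) (residueZero v) 0 :=
    (residueZero (ρ := ρ)).hasFDerivAt.comp_hasDerivAt 0 hl
  have hb : HasDerivAt (fun s : ℝ => bracket (residueZero (ρ := ρ) (centre ρ + s • v)))
      (bracket (residueZero v)) 0 := (hA.const_mul nilp).sub (hA.mul_const nilp)
  have h := (hA.add (hr.smul hb)).sub ((hr.pow 2).smul ((hA.const_mul nilp).mul_const nilp))
  simp only [central_eq]
  refine h.congr_deriv ?_
  have h1 : (centre ρ).1 = 1 := rfl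
  simp only [h0, h1, centralDeriv, Pi.pow_apply, one_smul, one_pow]
  norm_num

variable (ρ) in
/-- The defect of the normalisation. -/
def normDefect (y : PSpace) : ℝ := pcoef ρ 0 y.2.1 ^ 2 + pcoef ρ 0 y.2.2.1 * pcoef ρ 0 y.2.2.2 - 1

theorem contDiff_normDefect : ContDiff ℝ 1 (normDefect ρ) := by
  have h := (pcoef ρ 0).contDiff (n := 1)
  refine (((h.comp contDiff_snd.fst).pow 2).add ?_).sub contDiff_const
  exact (h.comp contDiff_snd.snd.fst).mul (h.comp contDiff_snd.snd.snd)

theorem pcoef_centre_a : pcoef ρ 0 (centre ρ).2.1 = 0 := by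
  rw [← rcoef_posL_nat, rcoef_centre_a]; simp

theorem pcoef_centre_b : pcoef ρ 0 (centre ρ).2.2.1 = -1 / 2 := by
  rw [← rcoef_posL_nat, rcoef_centre_b]; simp

theorem pcoef_centre_c : pcoef ρ 0 (centre ρ).2.2.2 = -2 := by
  rw [← rcoef_posL_nat, rcoef_centre_c]; simp

theorem normDefect_centre : normDefect ρ (centre ρ) = 0 := by
  rw [normDefect, pcoef_centre_a, pcoef_centre_b, pcoef_centre_c]
  norm_num

theorem hasDerivAt_normDefect_line (v : PSpace) :
    HasDerivAt (fun s : ℝ => normDefect ρ (centre ρ + s • v))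
      (-2 * pcoef ρ 0 v.2.2.1 - 1 / 2 * pcoef ρ 0 v.2.2.2) 0 := by
  have hl : ∀ f : PSpace →L[ℝ] ℝ, HasDerivAt (fun s : ℝ => f (centre ρ + s • v)) (f v) 0 := by
    intro f
    have h : HasDerivAt (fun s : ℝ => centre ρ + s • v) v 0 := by
      simpa using ((hasDerivAt_id (0 : ℝ)).smul_const v).const_add (centre ρ)
    exact f.hasFDerivAt.comp_hasDerivAt 0 h
  have ha := hl (pcoef ρ 0 ∘L .fst ℝ _ _ ∘L .snd ℝ _ _)
  have hb := hl (pcoef ρ 0 ∘L .fst ℝ _ _ ∘L .snd ℝ _ _ ∘L .snd ℝ _ _)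
  have hc := hl (pcoef ρ 0 ∘L .snd ℝ _ _ ∘L .snd ℝ _ _ ∘L .snd ℝ _ _)
  refine (((ha.pow 2).add (hb.mul hc)).sub_const 1).congr_deriv ?_
  simp only [zero_smul, add_zero, ContinuousLinearMap.comp_apply, ContinuousLinearMap.coe_fst',
    ContinuousLinearMap.coe_snd', pcoef_centre_a, pcoef_centre_b, pcoef_centre_c]
  norm_num
  ring

theorem ent_apply (i k : Fin 2) (M : MatL ρ) (s : ℝ) : ent i k (M, s) = MatL.entry i k M := rfl

theorem rcoef_real_smul (k : ℤ) (c : ℝ) (f : Laurent ρ) : rcoef k (c • f) = c * rcoef k f :=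
  map_smul _ _ _

theorem entry_real_smul (i k : Fin 2) (c : ℝ) (M : MatL ρ) :
    MatL.entry i k (c • M) = c • MatL.entry i k M := by
  rw [← Complex.coe_smul, map_smul, Complex.coe_smul]

theorem rcoef_entry_central_00 (k : ℤ) (y : PSpace) :
    rcoef k (MatL.entry 0 0 (central y : MatL ρ)) =
      rcoef k (posL y.2.1 : Laurent ρ) - y.1 * rcoef (k + 1) (posL y.2.2.1 : Laurent ρ) := by
  rw [central_eq, map_sub, map_add, entry_real_smul, entry_real_smul, entry_bracket_00,
    entry_nilp_mul_nilp, residueZero_00, residueZero_01, map_sub, map_add, rcoef_real_smul,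
    rcoef_real_smul, map_neg, rcoef_mono_mul]
  simp
  ring

theorem entry_central_01 (y : PSpace) :
    MatL.entry 0 1 (central y : MatL ρ) = Laurent.mono (-1) * posL y.2.2.1 := by
  rw [central_eq, map_sub, map_add, entry_real_smul, entry_real_smul, entry_bracket_01,
    entry_nilp_mul_nilp, residueZero_01]
  simp

theorem rcoef_entry_central_10 (k : ℤ) (y : PSpace) :
    rcoef k (MatL.entry 1 0 (central y : MatL ρ)) =
      rcoef (k - 1) (posL y.2.2.2 : Laurent ρ) + 2 * y.1 * rcoef k (posL y.2.1 : Laurent ρ)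
        - y.1 ^ 2 * rcoef (k + 1) (posL y.2.2.1 : Laurent ρ) := by
  rw [central_eq, map_sub, map_add, entry_real_smul, entry_real_smul, entry_bracket_10,
    entry_nilp_mul_nilp, residueZero_10, residueZero_00, residueZero_11, residueZero_01, map_sub,
    map_add, rcoef_real_smul, rcoef_real_smul, map_sub, map_neg, rcoef_mono_mul]
  simp [rcoef_mono_mul]
  ring

/-- The entries of `central` at the centre are `(μ + μ⁻¹)/2` on the diagonal, up to sign, and `±(μ -
μ⁻¹)/2` off it. This is hermitian on the circle, with off-diagonal entries vanishing at `±1`. -/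
theorem linInv_central_centre : linInv (ρ := ρ) (central (centre ρ), 0) = 0 := by
  rw [linInv_eq_zero_iff]
  have h1 : (centre ρ).1 = 1 := rfl
  refine ⟨fun k _ => ?_, fun k => ?_, ?_, ?_, rfl⟩
  · rw [fc_apply, ent_apply, rcoef_entry_central_00, rcoef_entry_central_00, rcoef_centre_a,
      rcoef_centre_b, rcoef_centre_a, rcoef_centre_b, h1]
    split_ifs <;> first | omega | norm_num
  · rw [gc_apply, ent_apply, ent_apply, rcoef_entry_central_10, entry_central_01, rcoef_mono_mul,
      rcoef_centre_a, rcoef_centre_b, rcoef_centre_b, rcoef_centre_c, h1]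
    split_ifs <;> first | omega | norm_num
  · rw [ent_apply, entry_central_01, valOne_mono_mul, centre_b, map_add, map_add, valOne_pmono,
      valOne_pmono]
    norm_num
  · rw [ent_apply, entry_central_01, valNegOne_mono_mul, centre_b, map_add, map_add,
      valNegOne_pmono, valNegOne_pmono]
    norm_num

theorem rcoef_entry_centralDeriv_00 (k : ℤ) (v : PSpace) :
    rcoef k (MatL.entry 0 0 (centralDeriv v : MatL ρ)) =
      rcoef k (posL v.2.1 : Laurent ρ) - rcoef (k + 1) (posL v.2.2.1 : Laurent ρ)
        - v.1 * rcoef (k + 1) (posL (centre ρ).2.2.1 : Laurent ρ) := by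
  rw [centralDeriv, map_sub, map_add, map_add, map_add, entry_real_smul, entry_real_smul,
    entry_bracket_00, entry_bracket_00, entry_nilp_mul_nilp, entry_nilp_mul_nilp, residueZero_00,
    residueZero_01, residueZero_01, map_sub, map_add, map_add, rcoef_real_smul, map_neg, map_neg,
    rcoef_mono_mul, rcoef_mono_mul]
  simp
  ring

theorem entry_centralDeriv_01 (v : PSpace) :
    MatL.entry 0 1 (centralDeriv v : MatL ρ) = Laurent.mono (-1) * posL v.2.2.1 := by
  rw [centralDeriv, map_sub, map_add, map_add, map_add, entry_real_smul, entry_real_smul,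
    entry_bracket_01, entry_bracket_01, entry_nilp_mul_nilp, entry_nilp_mul_nilp, residueZero_01]
  simp

theorem rcoef_entry_centralDeriv_10 (k : ℤ) (v : PSpace) :
    rcoef k (MatL.entry 1 0 (centralDeriv v : MatL ρ)) =
      rcoef (k - 1) (posL v.2.2.2 : Laurent ρ) + 2 * rcoef k (posL v.2.1 : Laurent ρ)
        - rcoef (k + 1) (posL v.2.2.1 : Laurent ρ)
        + 2 * v.1 * (rcoef k (posL (centre ρ).2.1 : Laurent ρ)
          - rcoef (k + 1) (posL (centre ρ).2.2.1 : Laurent ρ)) := by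
  rw [centralDeriv, map_sub, map_add, map_add, map_add, entry_real_smul, entry_real_smul,
    entry_bracket_10, entry_bracket_10, entry_nilp_mul_nilp, entry_nilp_mul_nilp, residueZero_10,
    residueZero_00, residueZero_11, residueZero_00, residueZero_11, residueZero_01, residueZero_01,
    map_sub, map_add, map_add, rcoef_real_smul, map_sub, map_sub, map_neg, map_neg, rcoef_mono_mul]
  simp [rcoef_mono_mul]
  ring

/-- `linInv` inverts the linearisation of the system at the central value. -/
theorem linInv_centralDeriv (v : PSpace) :
    linInv (ρ := ρ) (centralDeriv v, -2 * pcoef ρ 0 v.2.2.1 - 1 / 2 * pcoef ρ 0 v.2.2.2) = v := by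
  set κ := -2 * pcoef ρ 0 v.2.2.1 - 1 / 2 * pcoef ρ 0 v.2.2.2 with hκ
  set w : Data ρ := (centralDeriv v, κ) with hw
  have hw2 : w.2 = κ := rfl
  have hf : ∀ k : ℤ, fc k w = rcoef k (posL v.2.1 : Laurent ρ)
      - rcoef (k + 1) (posL v.2.2.1 : Laurent ρ)
      - v.1 * (if k + 1 = 0 then -1 / 2 else if k + 1 = 2 then 1 / 2 else 0)
      - (rcoef (-k) (posL v.2.1 : Laurent ρ) - rcoef (-k + 1) (posL v.2.2.1 : Laurent ρ)
        - v.1 * (if -k + 1 = 0 then -1 / 2 else if -k + 1 = 2 then 1 / 2 else 0)) := fun k => by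
    rw [fc_apply, ent_apply, rcoef_entry_centralDeriv_00, rcoef_entry_centralDeriv_00,
      rcoef_centre_b, rcoef_centre_b]
  have hg : ∀ k : ℤ, gc k w = rcoef (k - 1) (posL v.2.2.2 : Laurent ρ)
      + 2 * rcoef k (posL v.2.1 : Laurent ρ) - rcoef (k + 1) (posL v.2.2.1 : Laurent ρ)
      + 2 * v.1 * ((if k = 1 then 1 else 0)
        - (if k + 1 = 0 then -1 / 2 else if k + 1 = 2 then 1 / 2 else 0))
      - rcoef (-k + 1) (posL v.2.2.1 : Laurent ρ) := fun k => by
    rw [gc_apply, ent_apply, ent_apply, rcoef_entry_centralDeriv_10, entry_centralDeriv_01,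
      rcoef_mono_mul, rcoef_centre_a, rcoef_centre_b, sub_neg_eq_add]
  -- `b` is recovered from its tail and three low modes; the values at `±1` then determine `b_0 +
  -- b_2` and `b_1`.
  have hbt : bTail w + pmono ρ 0 (pcoef ρ 0 v.2.2.1) + pmono ρ 1 (pcoef ρ 1 v.2.2.1)
      + pmono ρ 2 (pcoef ρ 2 v.2.2.1) = v.2.2.1 := by
    refine posSeq_ext ρ fun n => ?_
    rw [map_add, map_add, map_add, pcoef_bTail, pcoef_pmono, pcoef_pmono, pcoef_pmono]
    rcases n with _ | _ | _ | n
    · simp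
    · simp
    · simp
    · rw [if_pos (by omega), if_neg (by omega), if_neg (by omega), if_neg (by omega), hg,
        rcoef_posL_neg (by push_cast; omega), rcoef_posL_neg (by push_cast; omega),
        rcoef_posL_neg (by push_cast; omega), if_neg (by push_cast; omega),
        if_neg (by push_cast; omega), if_neg (by push_cast; omega),
        show (-(1 - ((n + 1 + 1 + 1 : ℕ) : ℤ)) + 1) = ((n + 1 + 1 + 1 : ℕ) : ℤ) by ring,
        rcoef_posL_nat]
      ring
  have h01 : ent 0 1 w = Laurent.mono (-1) * posL v.2.2.1 := entry_centralDeriv_01 v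
  have hv1 : valOne (posL v.2.2.1 : Laurent ρ) = valOne (posL (bTail w) : Laurent ρ)
      + pcoef ρ 0 v.2.2.1 + pcoef ρ 1 v.2.2.1 + pcoef ρ 2 v.2.2.1 := by
    conv_lhs => rw [← hbt]
    simp only [map_add, valOne_pmono]
  have hv2 : valNegOne (posL v.2.2.1 : Laurent ρ) = valNegOne (posL (bTail w) : Laurent ρ)
      + pcoef ρ 0 v.2.2.1 - pcoef ρ 1 v.2.2.1 + pcoef ρ 2 v.2.2.1 := by
    conv_lhs => rw [← hbt]
    simp only [map_add, valNegOne_pmono]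
    ring
  have hE : bEven w = pcoef ρ 0 v.2.2.1 + pcoef ρ 2 v.2.2.1 := by
    rw [bEven_apply, h01, valOne_mono_mul, valNegOne_mono_mul, hv1, hv2]
    ring
  have hO : bOne w = pcoef ρ 1 v.2.2.1 := by
    rw [bOne_apply, h01, valOne_mono_mul, valNegOne_mono_mul, hv1, hv2]
    ring
  have hR : rVal w = v.1 := by
    rw [rVal_apply, hE, hg]
    simp [rcoef_posL]
    ring
  have hf1 : fc 1 w = pcoef ρ 1 v.2.1 - pcoef ρ 2 v.2.2.1 + pcoef ρ 0 v.2.2.1 - v.1 := by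
    rw [hf]
    simp [rcoef_posL]
    ring
  have hg0 : gc 0 w = 2 * pcoef ρ 0 v.2.1 - 2 * pcoef ρ 1 v.2.2.1 := by
    rw [hg]
    simp [rcoef_posL]
    ring
  have hg1 : gc 1 w = pcoef ρ 0 v.2.2.2 + 2 * pcoef ρ 1 v.2.1 + v.1 - pcoef ρ 2 v.2.2.1
      - pcoef ρ 0 v.2.2.1 := by
    rw [hg]
    simp [rcoef_posL]
    ring
  have hZ : bZero w = pcoef ρ 0 v.2.2.1 := by
    rw [bZero_apply, hE, hR, hf1, hg1, hw2, hκ]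
    ring
  rw [linInv_apply, hE, hO, hR, hf1, hg0, hZ, hw2]
  refine Prod.ext rfl (Prod.ext ?_ (Prod.ext ?_ ?_))
  · refine posSeq_ext ρ fun n => ?_
    dsimp only
    rw [map_add, map_add, pcoef_aTail, pcoef_pmono, pcoef_pmono]
    rcases n with _ | _ | n
    · simp
      ring
    · simp
      ring
    · rw [if_pos (by omega), if_neg (by omega), if_neg (by omega), hf, hg, rcoef_posL_nat,
        rcoef_posL_neg (k := -((n + 1 + 1 : ℕ) : ℤ)) (by push_cast; omega),
        rcoef_posL_neg (k := -((n + 1 + 1 : ℕ) : ℤ) + 1) (by push_cast; omega),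
        rcoef_posL_neg (k := -((n + 1 + 1 : ℕ) : ℤ) - 1) (by push_cast; omega), neg_neg,
        if_neg (by push_cast; omega), if_neg (by push_cast; omega), if_neg (by push_cast; omega),
        if_neg (by push_cast; omega), if_neg (by push_cast; omega)]
      ring
  · dsimp only
    rw [add_sub_cancel_left]
    exact hbt
  · refine posSeq_ext ρ fun n => ?_
    dsimp only
    rw [map_add, pcoef_cTail, pcoef_pmono]
    rcases n with _ | n
    · simp [hκ]
      ring
    · rw [if_pos (by omega), if_neg (by omega), hf, hg, hg]
      set l : ℤ := ((n + 1 : ℕ) : ℤ) with hl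
      have hl1 : 1 ≤ l := by rw [hl]; push_cast; omega
      rw [show l + 1 - 1 = (n + 1 : ℕ) by omega, rcoef_posL_nat,
        rcoef_posL_neg (k := -(l + 1) - 1) (by omega), rcoef_posL_neg (k := -(l + 1)) (by omega),
        rcoef_posL_neg (k := -(l + 1) + 1) (by omega), neg_neg,
        if_neg (show ¬ l + 1 + 1 = 0 by omega), if_neg (show ¬ l + 1 + 1 = 2 by omega),
        if_neg (show ¬ -(l + 1) + 1 = 0 by omega), if_neg (show ¬ -(l + 1) + 1 = 2 by omega),
        if_neg (show ¬ l + 1 = 1 by omega), if_neg (show ¬ -(l + 1) = 1 by omega)]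
      ring

/-- The system in the limit `t → 0`, composed with the inverse of its linearisation. -/
def limitMap (ρ : ℝ) [Fact (1 < ρ)] (y : PSpace) : PSpace :=
  linInv (ρ := ρ) (central y, normDefect ρ y)

theorem limitMap_centre : limitMap ρ (centre ρ) = 0 := by
  rw [limitMap, normDefect_centre, linInv_central_centre]

/-- The map is continuously differentiable, so its strict derivative exists and is determined by
derivatives along lines. These are the linearisation followed by `linInv`, that is, the identity. -/
theorem hasStrictFDerivAt_limitMap :
    HasStrictFDerivAt (limitMap ρ) (ContinuousLinearMap.id ℝ PSpace) (centre ρ) := by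
  have h1 : ContDiff ℝ 1 (limitMap ρ) :=
    (linInv (ρ := ρ)).contDiff.comp (contDiff_central.prodMk contDiff_normDefect)
  have h2 := h1.contDiffAt.hasStrictFDerivAt (x := centre ρ) one_ne_zero
  suffices h : fderiv ℝ (limitMap ρ) (centre ρ) = ContinuousLinearMap.id ℝ PSpace by
    rwa [h] at h2
  refine ContinuousLinearMap.ext fun v => ?_
  have h3 : HasDerivAt (fun s : ℝ => centre ρ + s • v) v 0 := by
    simpa using ((hasDerivAt_id (0 : ℝ)).smul_const v).const_add (centre ρ)
  have h4 : HasFDerivAt (limitMap ρ) (fderiv ℝ (limitMap ρ) (centre ρ))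
      (centre ρ + (0 : ℝ) • v) := by
    rw [zero_smul, add_zero]
    exact h2.hasFDerivAt
  have h5 := h4.comp_hasDerivAt 0 h3
  have h6 := (linInv (ρ := ρ)).hasFDerivAt.comp_hasDerivAt 0
    ((hasDerivAt_central_line (ρ := ρ) v).prodMk (hasDerivAt_normDefect_line (ρ := ρ) v))
  rw [linInv_centralDeriv] at h6
  exact h5.unique h6

end DPW

namespace DPW

open Complex Set
open scoped ComplexConjugate

variable {ρ : ℝ} [hρ : Fact (1 < ρ)]

/-! ### Existence and uniqueness of the solution -/

/-- A map that differs from the identity by a contraction and is small at the centre of a ball has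
exactly one zero in this ball. -/
theorem existsUnique_zero_of_approx_id {E : Type*} [NormedAddCommGroup E] [CompleteSpace E]
    {f : E → E} {x : E} {δ : ℝ} (hδ : 0 < δ)
    (h : ∀ y ∈ Metric.ball x δ, ∀ z ∈ Metric.ball x δ, ‖f y - f z - (y - z)‖ ≤ 1 / 2 * ‖y - z‖)
    (hx : ‖f x‖ < δ / 4) : ∃! y, y ∈ Metric.ball x δ ∧ f y = 0 := by
  -- A closed ball is complete; the radius `3δ/4` works because `y ↦ y - f y` moves points to
  -- distance at most `(1/2)(3δ/4) + δ/4 = 5δ/8` from `x`.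
  set s := Metric.closedBall x (3 / 4 * δ) with hs
  have hsub : s ⊆ Metric.ball x δ := Metric.closedBall_subset_ball (by linarith)
  have hxs : x ∈ s := Metric.mem_closedBall_self (by linarith)
  have key : ∀ y ∈ Metric.ball x δ, ∀ z ∈ Metric.ball x δ,
      dist (y - f y) (z - f z) ≤ 1 / 2 * dist y z := by
    intro y hy z hz
    rw [dist_eq_norm, dist_eq_norm]
    refine le_of_eq_of_le ?_ (h y hy z hz)
    rw [← norm_neg]
    congr 1
    abel
  have hmaps : MapsTo (fun y => y - f y) s s := by
    intro y hy
    have h1 := key y (hsub hy) x (hsub hxs)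
    have h2 : dist (x - f x) x = ‖f x‖ := by rw [dist_eq_norm, sub_sub_cancel_left, norm_neg]
    have h3 := dist_triangle (y - f y) (x - f x) x
    rw [hs, Metric.mem_closedBall] at hy ⊢
    linarith
  have hcon : ContractingWith (1 / 2) (hmaps.restrict (fun y => y - f y) s s) := by
    refine ⟨by norm_num, LipschitzWith.of_dist_le_mul fun y z => ?_⟩
    rw [show ((1 / 2 : NNReal) : ℝ) = 1 / 2 by norm_num]
    exact key y (hsub y.2) z (hsub z.2)
  obtain ⟨y, hys, hy, -⟩ := hcon.exists_fixedPoint' Metric.isClosed_closedBall.isComplete hmaps hxs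
    (edist_ne_top _ _)
  have hy0 : f y = 0 := by
    have h4 : y - f y = y := hy
    rwa [sub_eq_self] at h4
  refine ⟨y, ⟨hsub hys, hy0⟩, fun z hz => ?_⟩
  have h5 := h z hz.1 y (hsub hys)
  rw [hz.2, hy0, sub_zero, zero_sub, norm_neg] at h5
  have h6 : ‖z - y‖ = 0 := by linarith [norm_nonneg (z - y)]
  exact sub_eq_zero.1 (norm_eq_zero.1 h6)

variable (ρ) in
/-- The logarithm of the monodromy along `γ_0`, divided by `2πit`. -/
def monLog (m : ℕ) (t : ℝ) (y : PSpace) : MatL ρ :=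
  (2 * Real.pi * I * t : ℂ)⁻¹ • odeLog ((t : ℂ) • gauged (ρ := ρ) m y)

variable (ρ) in
/-- The system, composed with the inverse of its linearisation at the central value. -/
def systemMap (m : ℕ) (t : ℝ) (y : PSpace) : PSpace :=
  linInv (ρ := ρ) (monLog ρ m t y, normDefect ρ y)

/-- The error of the linear approximation is Lipschitz in `t B`, so the factor `t` cancels on
division by `2πit` and the constant `c` is uniform in `t`. Taking for `B` the coefficient at a
second parameter gives the contraction estimate; taking `B = 0` gives the smallness at the centre.
-/
theorem norm_monLog_sub_le {m : ℕ} {t : ℝ} (ht : 0 < t) {y : PSpace} {c : ℝ} (hc : 0 ≤ c)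
    {B : PathAlg (MatL ρ)} {N : MatL ρ} (hN : totalInt B = (2 * Real.pi * I : ℂ) • N)
    (h : ‖odeLog ((t : ℂ) • gauged (ρ := ρ) m y) - odeLog ((t : ℂ) • B)
      - totalInt ((t : ℂ) • gauged (ρ := ρ) m y - (t : ℂ) • B)‖
        ≤ c * ‖(t : ℂ) • gauged (ρ := ρ) m y - (t : ℂ) • B‖) :
    ‖monLog ρ m t y - (2 * Real.pi * I * t : ℂ)⁻¹ • odeLog ((t : ℂ) • B) - (central y - N)‖
      ≤ c * ‖gauged (ρ := ρ) m y - B‖ := by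
  have hne : (2 * Real.pi * I * t : ℂ) ≠ 0 := by
    simp [Real.pi_ne_zero, ht.ne']
  have hn : ‖(2 * Real.pi * I * t : ℂ)‖ = 2 * Real.pi * t := by
    simp [abs_of_pos Real.pi_pos, abs_of_pos ht]
  have e1 : monLog ρ m t y - (2 * Real.pi * I * t : ℂ)⁻¹ • odeLog ((t : ℂ) • B) - (central y - N)
      = (2 * Real.pi * I * t : ℂ)⁻¹ • (odeLog ((t : ℂ) • gauged (ρ := ρ) m y)
        - odeLog ((t : ℂ) • B) - totalInt ((t : ℂ) • gauged (ρ := ρ) m y - (t : ℂ) • B)) := by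
    rw [map_sub, map_smul, map_smul, totalInt_gauged, hN, smul_smul, smul_smul, ← smul_sub,
      mul_comm (t : ℂ), smul_sub, smul_sub, smul_smul, inv_mul_cancel₀ hne, one_smul, monLog]
  rw [e1, norm_smul, norm_inv, hn]
  rw [← smul_sub, norm_smul, Complex.norm_real, Real.norm_of_nonneg ht.le] at h
  rw [inv_mul_le_iff₀ (by positivity)]
  rw [← smul_sub]
  refine h.trans ?_
  have h1 : 0 ≤ c * ‖gauged (ρ := ρ) m y - B‖ := mul_nonneg hc (norm_nonneg _)
  have h2 : 1 ≤ 2 * Real.pi := by linarith [Real.pi_gt_three]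
  calc c * (t * ‖gauged (ρ := ρ) m y - B‖) = t * (c * ‖gauged (ρ := ρ) m y - B‖) := by ring
    _ ≤ (2 * Real.pi) * (t * (c * ‖gauged (ρ := ρ) m y - B‖)) :=
      le_mul_of_one_le_left (by positivity) h2
    _ = _ := by ring

variable (ρ) in
-- The limiting map is within Lipschitz distance `1/4` of the identity near the centre, which fixes
-- `δ₀`. For `t` small depending on `δ` the passage from the limit to time `t` costs at most another
-- `1/4` and moves the value at the centre by less than `δ/4`.
theorem exists_unique_zero_systemMap (m : ℕ) : ∃ δ₀ > 0, ∀ δ : ℝ, 0 < δ → δ ≤ δ₀ →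
    ∃ ε > 0, ∀ t : ℝ, 0 < t → t < ε →
      (∃! y, y ∈ Metric.ball (centre ρ) δ ∧ systemMap ρ m t y = 0) ∧
      ∀ y ∈ Metric.ball (centre ρ) δ, ‖(t : ℂ) • gauged (ρ := ρ) m y‖ < 1 ∧
        ‖odeEnd ((t : ℂ) • gauged (ρ := ρ) m y) - 1‖ < 1 / 16 := by
  obtain ⟨s, hs, hlim⟩ := (hasStrictFDerivAt_limitMap (ρ := ρ)).approximates_deriv_on_nhds
    (c := 1 / 4) (Or.inr (by norm_num))
  obtain ⟨K, u, hu, hlip⟩ := ((contDiff_gauged (ρ := ρ) m).contDiffAt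
    (x := centre ρ)).exists_lipschitzOnWith
  obtain ⟨δ₀, hδ₀, hball⟩ := Metric.mem_nhds_iff.1 (Filter.inter_mem hs hu)
  refine ⟨δ₀, hδ₀, fun δ hδ hδδ₀ => ?_⟩
  have hsub : Metric.ball (centre ρ) δ ⊆ s ∩ u := (Metric.ball_subset_ball hδδ₀).trans hball
  set C : ℝ := ‖gauged (ρ := ρ) m (centre ρ)‖ + K * δ with hC
  have hcen : centre ρ ∈ Metric.ball (centre ρ) δ := Metric.mem_ball_self hδ
  have hlip' : ∀ y ∈ Metric.ball (centre ρ) δ, ∀ z ∈ Metric.ball (centre ρ) δ,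
      ‖gauged (ρ := ρ) m y - gauged (ρ := ρ) m z‖ ≤ K * ‖y - z‖ := fun y hy z hz =>
    hlip.norm_sub_le (hsub hy).2 (hsub hz).2
  have hbd : ∀ y ∈ Metric.ball (centre ρ) δ, ‖gauged (ρ := ρ) m y‖ ≤ C := by
    intro y hy
    have h1 := hlip' y hy _ hcen
    have h2 : (K : ℝ) * ‖y - centre ρ‖ ≤ K * δ := by
      gcongr
      exact (mem_ball_iff_norm.1 hy).le
    have h3 := norm_sub_norm_le (gauged (ρ := ρ) m y) (gauged (ρ := ρ) m (centre ρ))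
    linarith
  have hC0 : 0 ≤ C := (norm_nonneg _).trans (hbd _ hcen)
  set N := ‖linInv (ρ := ρ)‖ with hN
  have hN0 : 0 ≤ N := norm_nonneg (linInv (ρ := ρ))
  -- `N * K * c` bounds the Lipschitz constant of the error and `N * C * c` its size at the centre;
  -- the sum `K + C` serves both bounds.
  obtain ⟨c, hc, hc'⟩ := exists_pos_mul_lt (lt_min (show (0 : ℝ) < 1 / 4 by norm_num)
    (show 0 < δ / 4 by linarith)) (N * (K + C))
  obtain ⟨r, hr, hr1, happ⟩ := exists_odeLog_approx (𝔸 := MatL ρ) hc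
    (show (0 : ℝ) < 1 / 16 by norm_num)
  -- `ε C < r` places every coefficient `t B(y)` of the ball in the range of the linear
  -- approximation.
  obtain ⟨ε, hε, hε'⟩ := exists_pos_mul_lt hr C
  refine ⟨ε, hε, fun t ht htε => ?_⟩
  have hsmall : ∀ y ∈ Metric.ball (centre ρ) δ, ‖(t : ℂ) • gauged (ρ := ρ) m y‖ < r := by
    intro y hy
    rw [norm_smul, Complex.norm_real, Real.norm_of_nonneg ht.le]
    calc t * ‖gauged (ρ := ρ) m y‖ ≤ ε * C := by gcongr; exact hbd y hy
      _ < r := by rwa [mul_comm]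
  have hsplit : ∀ (M M' : MatL ρ) (a : ℝ), linInv (ρ := ρ) (M, a) - linInv (M', a)
      = linInv (M - M', 0) := by
    intro M M' a
    rw [← map_sub, Prod.mk_sub_mk, sub_self]
  have hle : ∀ M : MatL ρ, ‖linInv (ρ := ρ) (M, 0)‖ ≤ N * ‖M‖ := by
    intro M
    refine ((linInv (ρ := ρ)).le_opNorm _).trans_eq ?_
    rw [Prod.norm_mk, norm_zero, max_eq_left (norm_nonneg _)]
  refine ⟨existsUnique_zero_of_approx_id hδ (fun y hy z hz => ?_) ?_, fun y hy =>
    ⟨(hsmall y hy).trans_le hr1, (happ _ _ (hsmall y hy) (hsmall y hy)).1⟩⟩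
  · have h1 := hlim y (hsub hy).1 z (hsub hz).1
    have h2 := norm_monLog_sub_le ht hc.le (totalInt_gauged m z)
      (happ _ _ (hsmall y hy) (hsmall z hz)).2
    have e1 : systemMap ρ m t y - systemMap ρ m t z - (y - z)
        = (limitMap ρ y - limitMap ρ z - ContinuousLinearMap.id ℝ PSpace (y - z))
          + linInv (monLog ρ m t y - monLog ρ m t z - (central y - central z), 0) := by
      rw [show monLog ρ m t y - monLog ρ m t z - (central y - central z)
        = (monLog ρ m t y - central y) - (monLog ρ m t z - central z) by abel, ← hsplit _ _ 0,
        ← hsplit _ _ (normDefect ρ y), ← hsplit _ _ (normDefect ρ z), systemMap, systemMap,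
        limitMap, limitMap, ContinuousLinearMap.id_apply]
      abel
    rw [e1]
    refine (norm_add_le _ _).trans ?_
    have h3 : N * (c * ‖gauged (ρ := ρ) m y - gauged (ρ := ρ) m z‖) ≤ 1 / 4 * ‖y - z‖ := by
      calc N * (c * ‖gauged (ρ := ρ) m y - gauged (ρ := ρ) m z‖)
          ≤ N * (c * (K * ‖y - z‖)) := by gcongr; exact hlip' y hy z hz
        _ = N * K * c * ‖y - z‖ := by ring
        _ ≤ N * (K + C) * c * ‖y - z‖ := by gcongr; linarith
        _ ≤ 1 / 4 * ‖y - z‖ := by gcongr; exact hc'.le.trans (min_le_left _ _)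
    have h4 := (hle _).trans (mul_le_mul_of_nonneg_left h2 hN0)
    rw [← monLog] at h4
    have h5 : (((1 / 4 : NNReal) : ℝ)) = 1 / 4 := by norm_num
    rw [h5] at h1
    linarith
  · have h0 : totalInt (0 : PathAlg (MatL ρ)) = (2 * Real.pi * I : ℂ) • (0 : MatL ρ) := by
      rw [map_zero, smul_zero]
    have h2 := norm_monLog_sub_le (m := m) (y := centre ρ) ht hc.le h0
      (happ _ _ (hsmall _ hcen) (by rwa [smul_zero, norm_zero])).2
    rw [smul_zero, odeLog_zero, smul_zero, sub_zero, sub_zero, sub_zero] at h2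
    have e1 : systemMap ρ m t (centre ρ)
        = linInv (monLog ρ m t (centre ρ) - central (centre ρ), 0) := by
      have h := limitMap_centre (ρ := ρ)
      rw [limitMap] at h
      rw [← hsplit _ _ (normDefect ρ (centre ρ)), h, sub_zero, systemMap]
    rw [e1]
    calc _ ≤ N * (c * ‖gauged (ρ := ρ) m (centre ρ)‖) :=
          (hle _).trans (mul_le_mul_of_nonneg_left h2 hN0)
      _ ≤ N * (c * C) := by gcongr; exact hbd _ hcen
      _ = N * C * c := by ring
      _ ≤ N * (K + C) * c := by gcongr; exact le_add_of_nonneg_left K.2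
      _ < δ / 4 := hc'.trans_le (min_le_right _ _)

end DPW

namespace DPW

open Complex Set
open scoped ComplexConjugate

variable {ρ : ℝ} [hρ : Fact (1 < ρ)]

/-! ### Laurent series with real coefficients -/

theorem Laurent.eq_zero_of_evalL {f : Laurent ρ}
    (h : ∀ (μ : ℂ) (hμ : ‖μ‖ = 1), Laurent.evalL μ hμ f = 0) : f = 0 := by
  have h1 : (fun k => Laurent.coef k f) = 0 :=
    eq_zero_of_laurent_eq_zero (Laurent.summable_norm_coef f) fun μ hμ => by
      rw [← h μ hμ]
      exact Laurent.evalL_hasSum μ hμ f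
  refine Laurent.ext_coef fun k => ?_
  rw [← Laurent.coefL_apply, ← Laurent.coefL_apply, map_zero, Laurent.coefL_apply]
  exact congrFun h1 k

theorem norm_conj_eq_one {μ : ℂ} (hμ : ‖μ‖ = 1) : ‖conj μ‖ = 1 := by
  rw [RCLike.norm_conj, hμ]

/-- `μ ↦ conj (f (conj μ))` has the conjugate coefficients, so uniqueness of Fourier coefficients
applies. -/
theorem Laurent.conj_coef {f : Laurent ρ}
    (h : ∀ (μ : ℂ) (hμ : ‖μ‖ = 1),
      conj (Laurent.evalL (conj μ) (norm_conj_eq_one hμ) f) = Laurent.evalL μ hμ f) (k : ℤ) :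
    conj (Laurent.coef k f) = Laurent.coef k f := by
  have h1 : (fun k => conj (Laurent.coef k f) - Laurent.coef k f) = 0 := by
    refine eq_zero_of_laurent_eq_zero ?_ fun μ hμ => ?_
    · refine Summable.of_nonneg_of_le (fun _ => norm_nonneg _) (fun k => norm_sub_le _ _) ?_
      simp only [RCLike.norm_conj]
      exact (Laurent.summable_norm_coef f).add (Laurent.summable_norm_coef f)
    · have h2 := (Laurent.evalL_hasSum (conj μ) (norm_conj_eq_one hμ) f).map (starRingEnd ℂ)
        continuous_conj
      rw [h μ hμ] at h2
      have h3 := h2.sub (Laurent.evalL_hasSum μ hμ f)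
      rw [sub_self] at h3
      refine Eq.mp (congrArg (fun F => HasSum F _) (funext fun j => ?_)) h3
      simp only [Function.comp_apply]
      rw [map_mul, map_zpow₀, conj_conj, sub_mul]
  exact sub_eq_zero.1 (congrFun h1 k)

theorem Laurent.conj_evalL {f : Laurent ρ} (h : ∀ k, conj (Laurent.coef k f) = Laurent.coef k f)
    (μ : ℂ) (hμ : ‖μ‖ = 1) :
    conj (Laurent.evalL μ hμ f) = Laurent.evalL μ hμ (Laurent.rev f) := by
  have h1 := (Laurent.evalL_hasSum μ hμ f).map (starRingEnd ℂ) continuous_conj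
  refine h1.unique ?_
  have h2 := (Equiv.neg ℤ).hasSum_iff.2 (Laurent.evalL_hasSum μ hμ (Laurent.rev f))
  refine Eq.mp (congrArg (fun F => HasSum F _) (funext fun j => ?_)) h2
  simp only [Function.comp_apply, Equiv.neg_apply]
  rw [Laurent.coef_rev, neg_neg, map_mul, h, map_zpow₀, ← Complex.inv_eq_conj hμ, inv_zpow, zpow_neg]

theorem Laurent.ofReal_rcoef {f : Laurent ρ} {k : ℤ}
    (h : conj (Laurent.coef k f) = Laurent.coef k f) : (rcoef k f : ℂ) = Laurent.coef k f := by
  rw [rcoef_apply]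
  exact conj_eq_iff_re.1 h

/-- Two Laurent series with real coefficients are conjugate on the circle if and only if their
coefficients are mirror images. -/
theorem Laurent.evalL_eq_conj_iff {f g : Laurent ρ}
    (hf : ∀ k, conj (Laurent.coef k f) = Laurent.coef k f)
    (hg : ∀ k, conj (Laurent.coef k g) = Laurent.coef k g) :
    (∀ (μ : ℂ) (hμ : ‖μ‖ = 1), Laurent.evalL μ hμ f = conj (Laurent.evalL μ hμ g)) ↔
      ∀ k, rcoef k f - rcoef (-k) g = 0 := by
  constructor
  · intro h k
    have h1 : f - Laurent.rev g = 0 := Laurent.eq_zero_of_evalL fun μ hμ => by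
      rw [map_sub, h μ hμ, Laurent.conj_evalL hg, sub_self]
    rw [← rcoef_rev, ← map_sub, h1, map_zero]
  · intro h μ hμ
    rw [Laurent.conj_evalL hg]
    congr 1
    refine Laurent.ext_coef fun k => ?_
    rw [Laurent.coef_rev, ← Laurent.ofReal_rcoef (hf k), ← Laurent.ofReal_rcoef (hg (-k)),
      sub_eq_zero.1 (h k)]

/-! ### The monodromy on the unit circle -/

open scoped Matrix.Norms.Operator in
-- Evaluating a matrix of Laurent series may double the norm, hence `1/16` above and `1/8` here.
theorem norm_mon_sub_one_le {m : ℕ} (hm : 1 ≤ m) {t : ℝ} {x : Param ρ}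
    (hB : ‖(t : ℂ) • gauged (ρ := ρ) m (toP x)‖ < 1)
    (hE : ‖odeEnd ((t : ℂ) • gauged (ρ := ρ) m (toP x)) - 1‖ < 1 / 16) (μ : ℂ) (hμ : ‖μ‖ = 1) :
    ‖Mon m t x 0 μ - 1‖ ≤ 1 / 8 := by
  rw [mon_zero_eq hm t x μ hμ hB, ← map_one (MatL.evalM (ρ := ρ) μ hμ), ← map_sub]
  refine (MatL.norm_evalM_le μ hμ _).trans ?_
  linarith

theorem Mt_eq {m : ℕ} (hm : 1 ≤ m) {t : ℝ} (ht : t ≠ 0) {x : Param ρ}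
    (hB : ‖(t : ℂ) • gauged (ρ := ρ) m (toP x)‖ < 1)
    (hE : ‖odeEnd ((t : ℂ) • gauged (ρ := ρ) m (toP x)) - 1‖ < 1 / 16) (μ : ℂ) (hμ : ‖μ‖ = 1)
    (i k : Fin 2) : Mt m t x μ i k
      = 2 * Real.pi * I * Laurent.evalL μ hμ (MatL.entry i k (monLog ρ m t (toP x))) := by
  have h1 : (t : ℂ) ≠ 0 := ofReal_ne_zero.2 ht
  have h2 : (Real.pi : ℂ) ≠ 0 := ofReal_ne_zero.2 Real.pi_ne_zero
  have h3 := MatL.evalM_log μ hμ (hE.trans (by norm_num))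
  rw [map_sub, map_one, ← mon_zero_eq hm t x μ hμ hB, ← matLog_eq, ← odeLog] at h3
  rw [Mt, ← h3, monLog, map_smul, map_smul, Matrix.smul_apply, MatL.evalM_apply, smul_eq_mul,
    smul_eq_mul]
  field_simp [I_ne_zero]

theorem conj_Mt {m : ℕ} (hm : 1 ≤ m) {t : ℝ} {x : Param ρ}
    (hB : ‖(t : ℂ) • gauged (ρ := ρ) m (toP x)‖ < 1)
    (hE : ‖odeEnd ((t : ℂ) • gauged (ρ := ρ) m (toP x)) - 1‖ < 1 / 16) (μ : ℂ) (hμ : ‖μ‖ = 1)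
    (i k : Fin 2) : conj (Mt m t x (conj μ) i k) = -Mt m t x μ i k := by
  have hY := isTransport_evalM hm t x μ hμ hB
  have h := matLog_eq_of_conj_eq_adjugate (norm_mon_sub_one_le hm hB hE μ hμ)
    (norm_mon_sub_one_le hm hB hE (conj μ) (norm_conj_eq_one hμ)) hY.det_mon
    (conj_mon (isTransport_evalM hm t x (conj μ) (norm_conj_eq_one hμ) hB) hY)
  have h1 := congrFun (congrFun h i) k
  rw [Matrix.map_apply, Matrix.neg_apply] at h1
  rw [Mt, Mt, Matrix.smul_apply, Matrix.smul_apply, smul_eq_mul, smul_eq_mul, map_mul, h1,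
    map_div₀, map_one, conj_ofReal, mul_neg]

/-- The sign from inverting the monodromy cancels against `conj (2πi) = -2πi`. So `monLog` has real
coefficients, and equations for real parts are the full equations. -/
theorem conj_evalL_monLog {m : ℕ} (hm : 1 ≤ m) {t : ℝ} (ht : t ≠ 0) {x : Param ρ}
    (hB : ‖(t : ℂ) • gauged (ρ := ρ) m (toP x)‖ < 1)
    (hE : ‖odeEnd ((t : ℂ) • gauged (ρ := ρ) m (toP x)) - 1‖ < 1 / 16) (i k : Fin 2) (μ : ℂ)
    (hμ : ‖μ‖ = 1) :
    conj (Laurent.evalL (conj μ) (norm_conj_eq_one hμ) (MatL.entry i k (monLog ρ m t (toP x))))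
      = Laurent.evalL μ hμ (MatL.entry i k (monLog ρ m t (toP x))) := by
  have h := conj_Mt hm hB hE μ hμ i k
  rw [Mt_eq hm ht hB hE μ hμ, Mt_eq hm ht hB hE _ (norm_conj_eq_one hμ), map_mul, map_mul, map_mul,
    conj_I, conj_ofReal, map_ofNat, mul_neg, neg_mul, neg_inj] at h
  refine mul_left_cancel₀ ?_ h
  simp [Real.pi_ne_zero]

theorem normDefect_toP (x : Param ρ) : normDefect ρ (toP x) = K x - 1 := by
  rw [normDefect, toP, pcoef_toSeq, pcoef_toSeq, pcoef_toSeq, K]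

theorem loopStar_of_norm_eq_one (f : ℂ → ℂ) {μ : ℂ} (hμ : ‖μ‖ = 1) :
    loopStar f μ = conj (f μ) := by
  rw [loopStar, ← Complex.inv_eq_conj hμ, one_div, inv_inv]

/-- The system in terms of the coefficients of the logarithm of the monodromy. -/
theorem iftSystem_iff_systemMap {m : ℕ} (hm : 1 ≤ m) {t : ℝ} (ht : t ≠ 0) {x : Param ρ}
    (hB : ‖(t : ℂ) • gauged (ρ := ρ) m (toP x)‖ < 1)
    (hE : ‖odeEnd ((t : ℂ) • gauged (ρ := ρ) m (toP x)) - 1‖ < 1 / 16) :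
    IFTSystem m t x ↔ systemMap ρ m t (toP x) = 0 := by
  have hMt := Mt_eq hm ht hB hE
  have hre := conj_evalL_monLog hm ht hB hE
  have hco : ∀ i k j, _ := fun i k => Laurent.conj_coef (hre i k)
  have hpi : (2 * Real.pi * I : ℂ) ≠ 0 := by simp [Real.pi_ne_zero]
  have hstar : ∀ z : ℂ, conj (2 * Real.pi * I * z) = -(2 * Real.pi * I * conj z) := fun z => by
    rw [map_mul, map_mul, map_mul, conj_I, conj_ofReal, map_ofNat, mul_neg, neg_mul]
  rw [systemMap, linInv_eq_zero_iff, IFTSystem]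
  set M := monLog ρ m t (toP x) with hM
  have hF : ∀ (μ : ℂ) (hμ : ‖μ‖ = 1), F m t x μ = Laurent.evalL μ hμ (MatL.entry 0 0 M)
      - conj (Laurent.evalL μ hμ (MatL.entry 0 0 M)) := fun μ hμ => by
    rw [F, loopStar_of_norm_eq_one _ hμ, hMt μ hμ, hstar]
    field_simp
    ring
  have hG : ∀ (μ : ℂ) (hμ : ‖μ‖ = 1), G m t x μ = Laurent.evalL μ hμ (MatL.entry 1 0 M)
      - conj (Laurent.evalL μ hμ (MatL.entry 0 1 M)) := fun μ hμ => by
    rw [G, loopStar_of_norm_eq_one _ hμ, hMt μ hμ, hMt μ hμ, hstar]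
    field_simp
    ring
  have hH : ∀ (μ : ℂ) (hμ : ‖μ‖ = 1), 1 / (2 * Real.pi * I) * Mt m t x μ 0 1
      = Laurent.evalL μ hμ (MatL.entry 0 1 M) := fun μ hμ => by
    rw [hMt μ hμ]
    field_simp
  have hneg : ‖(-1 : ℂ)‖ = 1 := by rw [norm_neg, norm_one]
  refine and_congr ?_ (and_congr ?_ (and_congr ?_ (and_congr ?_ ?_)))
  · have h1 := Laurent.evalL_eq_conj_iff (hco 0 0) (hco 0 0)
    have h2 : (∀ μ : ℂ, ‖μ‖ = 1 → F m t x μ = 0) ↔ ∀ k : ℤ, fc k (M, normDefect ρ (toP x)) = 0 := by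
      refine Iff.trans ?_ h1
      refine forall_congr' fun μ => forall_congr' fun hμ => ?_
      rw [hF μ hμ, sub_eq_zero]
    rw [h2]
    -- `fc` is odd in `k`, so the positive indices suffice.
    refine ⟨fun h k _ => h k, fun h k => ?_⟩
    obtain ⟨n, rfl | rfl⟩ := k.eq_nat_or_neg
    · rcases n with _ | n
      · rw [fc_apply]
        simp
      · exact h _ (by omega)
    · rcases n with _ | n
      · rw [fc_apply]
        simp
      · have h3 := h (n + 1) (by omega)
        rw [fc_apply] at h3 ⊢
        rw [neg_neg]
        linarith
  · have h1 := Laurent.evalL_eq_conj_iff (hco 1 0) (hco 0 1)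
    refine Iff.trans ?_ h1
    refine forall_congr' fun μ => forall_congr' fun hμ => ?_
    rw [hG μ hμ, sub_eq_zero]
  · rw [H₁, hH 1 norm_one, valOne_apply, ent_apply]
    have h1 : conj (Laurent.evalL 1 norm_one (MatL.entry 0 1 M))
        = Laurent.evalL 1 norm_one (MatL.entry 0 1 M) := by
      simpa only [map_one] using hre 0 1 1 norm_one
    rw [← conj_eq_iff_re.1 h1, ofReal_eq_zero, ofReal_re]
  · rw [H₂, hH (-1) hneg, valNegOne_apply, ent_apply]
    have h1 : conj (Laurent.evalL (-1) hneg (MatL.entry 0 1 M))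
        = Laurent.evalL (-1) hneg (MatL.entry 0 1 M) := by
      simpa only [map_neg, map_one] using hre 0 1 (-1) hneg
    rw [← conj_eq_iff_re.1 h1, ofReal_eq_zero, ofReal_re]
  · dsimp only
    rw [normDefect_toP, sub_eq_zero]

/-! ### The constant coefficient of the determinant -/

theorem ev_zero {ρ : ℝ} (f : WienerPos ρ) : ev f 0 = f.1 0 := by
  rw [ev, tsum_eq_single 0 fun k hk => by rw [zero_pow hk, mul_zero], pow_zero, mul_one]

theorem diffContOnCl_ev (f : WienerPos ρ) : DiffContOnCl ℂ (ev f) (Metric.ball 0 |1|) := by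
  have hr := rho_pos (ρ := ρ)
  have h : DifferentiableOn ℂ (ev f) (Metric.ball 0 ρ) := by
    refine differentiableOn_tsum_of_summable_norm (f.2 : Summable fun k => |f.1 k| * |ρ| ^ k)
      (fun k => ((differentiable_id.pow k).const_mul _).differentiableOn) Metric.isOpen_ball
      fun k w hw => ?_
    rw [norm_mul, norm_pow, Complex.norm_real, Real.norm_eq_abs, abs_of_pos hr]
    gcongr
    exact (mem_ball_zero_iff.1 hw).le
  rw [abs_one]
  exact h.diffContOnCl_ball (Metric.closedBall_subset_ball hρ.out)

/-- On the circle the factors `μ⁻¹` and `μ` cancel and the determinant is `-(a² + bc)`, which is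
holomorphic inside; its mean is its value at `0`. -/
theorem circleAverage_det (m : ℕ) (x : Param ρ) :
    Real.circleAverage (fun μ => (A m x 0 μ).det) 0 1 = -(K x : ℂ) := by
  have h1 : EqOn (fun μ => (A m x 0 μ).det)
      (fun μ => -(ev x.a μ * ev x.a μ + ev x.b μ * ev x.c μ)) (Metric.sphere 0 |1|) := by
    intro μ hμ
    have h0 : μ ≠ 0 := by
      rintro rfl
      simp at hμ
    simp only [A, Matrix.det_fin_two_of]
    field_simp
    ring
  rw [Real.circleAverage_congr_sphere h1]
  have h2 : DiffContOnCl ℂ (fun μ => -(ev x.a μ * ev x.a μ + ev x.b μ * ev x.c μ))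
      (Metric.ball 0 |1|) :=
    (((diffContOnCl_ev x.a).smul (diffContOnCl_ev x.a)).add
      ((diffContOnCl_ev x.b).smul (diffContOnCl_ev x.c))).neg
  rw [h2.circleAverage, ev_zero, ev_zero, ev_zero, K]
  push_cast
  ring

/-! ### The system and the monodromy problem -/

theorem D_mem (m : ℕ) : D m ∈ Matrix.specialUnitaryGroup (Fin 2) ℂ := by
  have h : conj (I * Real.pi * m / nn m) = -(I * Real.pi * m / nn m) := by
    rw [map_div₀, map_mul, map_mul, conj_I, conj_ofReal, map_natCast, map_natCast]
    ring
  rw [Matrix.mem_specialUnitaryGroup_iff, Matrix.mem_unitaryGroup_iff']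
  constructor
  · have h1 : star (D m) = (D m)⁻¹ := by
      rw [D_inv, D, Matrix.star_eq_conjTranspose]
      ext i k
      fin_cases i <;> fin_cases k <;>
        simp [Matrix.conjTranspose_apply, -map_mul, -map_div₀, ← Complex.exp_conj, h]
    rw [h1, D_inv_mul]
  · rw [D, Matrix.det_fin_two_of, ← Complex.exp_add, add_neg_cancel, Complex.exp_zero]
    ring

theorem conj_D_mem {m : ℕ} {M : Matrix (Fin 2) (Fin 2) ℂ}
    (h : M ∈ Matrix.specialUnitaryGroup (Fin 2) ℂ) :
    (D m)⁻¹ * M * D m ∈ Matrix.specialUnitaryGroup (Fin 2) ℂ := by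
  have h1 : (D m)⁻¹ ∈ Matrix.specialUnitaryGroup (Fin 2) ℂ := by
    have h2 := ((⟨D m, D_mem m⟩ : Matrix.specialUnitaryGroup (Fin 2) ℂ)⁻¹).2
    have h3 := congrArg Subtype.val
      (inv_mul_cancel (⟨D m, D_mem m⟩ : Matrix.specialUnitaryGroup (Fin 2) ℂ))
    rwa [Matrix.inv_eq_left_inv h3]
  exact mul_mem (mul_mem h1 h) (D_mem m)

open scoped Matrix.Norms.Operator in
/-- The system is equivalent to the monodromy problem. -/
theorem iftSystem_iff_solvesMonodromyProblem {m : ℕ} (hm : 1 ≤ m) {t : ℝ} (ht : t ≠ 0)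
    {x : Param ρ} (hX : ∀ μ : ℂ, ‖μ‖ = 1 → ∃ X, IsTransport m t x 0 μ X)
    (hnear : ∀ μ : ℂ, ‖μ‖ = 1 → ‖Mon m t x 0 μ - 1‖ ≤ 1 / 8) :
    IFTSystem m t x ↔ SolvesMonodromyProblem m t x := by
  have ht' : (t : ℂ) ≠ 0 := ofReal_ne_zero.2 ht
  have hpi : (2 * Real.pi * I : ℂ) ≠ 0 := by simp [Real.pi_ne_zero]
  have hdet : ∀ μ : ℂ, ‖μ‖ = 1 → (Mon m t x 0 μ).det = 1 := fun μ hμ => (hX μ hμ).choose_spec.det_mon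
  have hneg : ‖(-1 : ℂ)‖ = 1 := by rw [norm_neg, norm_one]
  have htr : ∀ μ : ℂ, ‖μ‖ = 1 → matLog (Mon m t x 0 μ) 1 1 = -matLog (Mon m t x 0 μ) 0 0 := by
    intro μ hμ
    have h := trace_logOneAdd (hnear μ hμ) (by rw [add_sub_cancel, hdet μ hμ])
    rw [← matLog_eq, Matrix.trace_fin_two] at h
    exact eq_neg_of_add_eq_zero_right h
  have hMt : ∀ μ i k, Mt m t x μ i k = 1 / t * matLog (Mon m t x 0 μ) i k := fun μ i k => rfl
  have hF : ∀ μ : ℂ, ‖μ‖ = 1 → (F m t x μ = 0 ↔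
      conj (matLog (Mon m t x 0 μ) 0 0) = -matLog (Mon m t x 0 μ) 0 0) := by
    intro μ hμ
    rw [F, loopStar_of_norm_eq_one _ hμ, hMt, map_mul, map_div₀, map_one, conj_ofReal, ← mul_add,
      mul_eq_zero_iff_left (one_div_ne_zero hpi), mul_eq_zero_iff_left (one_div_ne_zero ht'),
      add_comm, add_eq_zero_iff_eq_neg]
  have hG : ∀ μ : ℂ, ‖μ‖ = 1 → (G m t x μ = 0 ↔
      conj (matLog (Mon m t x 0 μ) 0 1) = -matLog (Mon m t x 0 μ) 1 0) := by
    intro μ hμ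
    rw [G, loopStar_of_norm_eq_one _ hμ, hMt, hMt, map_mul, map_div₀, map_one, conj_ofReal,
      ← mul_add, mul_eq_zero_iff_left (one_div_ne_zero hpi),
      mul_eq_zero_iff_left (one_div_ne_zero ht'), add_comm, add_eq_zero_iff_eq_neg]
  have hH : ∀ μ : ℂ, (1 / (2 * Real.pi * I) * Mt m t x μ 0 1 = 0 ↔
      matLog (Mon m t x 0 μ) 0 1 = 0) := by
    intro μ
    rw [hMt, mul_eq_zero_iff_left (one_div_ne_zero hpi),
      mul_eq_zero_iff_left (one_div_ne_zero ht')]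
  have hSU : ∀ μ : ℂ, ‖μ‖ = 1 → (Mon m t x 0 μ ∈ Matrix.specialUnitaryGroup (Fin 2) ℂ ↔
      F m t x μ = 0 ∧ G m t x μ = 0) := by
    intro μ hμ
    rw [mem_specialUnitary_iff_log (hnear μ hμ) (hdet μ hμ), hF μ hμ, hG μ hμ]
    constructor
    · intro h
      exact ⟨congrFun (congrFun h 0) 0, congrFun (congrFun h 1) 0⟩
    -- `F` and `G` give two of the four skew-hermitian relations. The upper right one is the
    -- conjugate of the lower left one, and the last follows from vanishing trace.
    · rintro ⟨h1, h2⟩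
      ext i k
      rw [Matrix.conjTranspose_apply, Matrix.neg_apply]
      fin_cases i <;> fin_cases k
      · exact h1
      · change conj _ = -matLog (Mon m t x 0 μ) 0 1
        rw [← conj_conj (matLog (Mon m t x 0 μ) 0 1), h2, map_neg, neg_neg]
        rfl
      · exact h2
      · change conj (matLog (Mon m t x 0 μ) 1 1) = -matLog (Mon m t x 0 μ) 1 1
        rw [htr μ hμ, map_neg, h1]
  -- `G = 0` ties the two off-diagonal entries together, so one `H` equation at each of `±1` is
  -- enough.
  have hdiag : ∀ μ : ℂ, ‖μ‖ = 1 → G m t x μ = 0 → ((Mon m t x 0 μ).IsDiag ↔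
      1 / (2 * Real.pi * I) * Mt m t x μ 0 1 = 0) := by
    intro μ hμ hg
    rw [isDiag_iff_log (hnear μ hμ), hH]
    refine ⟨fun h => h.1, fun h => ⟨h, ?_⟩⟩
    have h1 := (hG μ hμ).1 hg
    rw [h, map_zero, zero_eq_neg] at h1
    exact h1
  have hK : K x = 1 ↔ Real.circleAverage (fun μ => (A m x 0 μ).det) 0 1 = -1 := by
    rw [circleAverage_det, neg_inj]
    exact ofReal_eq_one.symm
  rw [IFTSystem, SolvesMonodromyProblem, hK]
  constructor
  · rintro ⟨h1, h2, h3, h4, h5⟩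
    refine ⟨fun j _ => ?_, fun j _ => ?_, h5⟩
    · induction j with
      | zero => exact fun μ hμ => (hSU μ hμ).2 ⟨h1 μ hμ, h2 μ hμ⟩
      | succ j ih =>
        intro μ hμ
        rw [mon_succ hm hX j μ hμ]
        exact conj_D_mem (ih (by omega) (-μ) (by rwa [norm_neg]))
    · induction j with
      | zero =>
        exact ⟨(hdiag 1 norm_one (h2 1 norm_one)).2 h3, (hdiag (-1) hneg (h2 (-1) hneg)).2 h4⟩
      | succ j ih =>
        -- Passing from `γ_j` to `γ_{j+1}` replaces `μ` by `-μ`, which exchanges the conditions at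
        -- `1` and `-1`.
        obtain ⟨ih1, ih2⟩ := ih (by omega)
        rw [mon_succ hm hX j 1 norm_one, mon_succ hm hX j (-1) hneg, neg_neg]
        constructor
        · intro i k hik
          rw [conjD_apply, ih2 hik, mul_zero]
        · intro i k hik
          rw [conjD_apply, ih1 hik, mul_zero]
  · rintro ⟨h1, h2, h5⟩
    have h0 : 0 < nn m := by rw [nn]; omega
    have h3 := fun μ hμ => (hSU μ hμ).1 (h1 0 h0 μ hμ)
    obtain ⟨h6, h7⟩ := h2 0 h0
    exact ⟨fun μ hμ => (h3 μ hμ).1, fun μ hμ => (h3 μ hμ).2,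
      (hdiag 1 norm_one (h3 1 norm_one).2).1 h6, (hdiag (-1) hneg (h3 (-1) hneg).2).1 h7, h5⟩

end DPW

end

/-! ### The main theorem -/

/-- Because `δ` may be any number in `(0, δ₀]`, the convergence of the solution to `x₀` as `t → 0`
is included: for small `t` the unique solution in the ball of radius `δ₀` already lies in that of
radius `δ`. -/
theorem mainTheorem4 (m : ℕ) (hm : 1 ≤ m) (ρ : ℝ) (hρ : 1 < ρ) :
    ∃ δ₀ > 0, ∀ δ : ℝ, 0 < δ → δ ≤ δ₀ → ∃ ε > 0, ∀ t : ℝ, 0 < t → t < ε →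
      (∃! x : DPW.Param ρ, x ∈ DPW.nbhd ρ δ ∧ DPW.IFTSystem m t x) ∧
      (∀ x ∈ DPW.nbhd ρ δ, DPW.IFTSystem m t x ↔ DPW.SolvesMonodromyProblem m t x) := by
  have : Fact (1 < ρ) := ⟨hρ⟩
  obtain ⟨δ₀, hδ₀, h⟩ := DPW.exists_unique_zero_systemMap ρ m
  refine ⟨δ₀, hδ₀, fun δ hδ hδδ₀ => ?_⟩
  obtain ⟨ε, hε, h⟩ := h δ hδ hδδ₀
  refine ⟨ε, hε, fun t ht htε => ?_⟩
  obtain ⟨⟨y, ⟨hy, hy0⟩, huniq⟩, hsmall⟩ := h t ht htε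
  have hiff : ∀ x ∈ DPW.nbhd ρ δ, DPW.IFTSystem m t x ↔ DPW.systemMap ρ m t (DPW.toP x) = 0 := by
    intro x hx
    obtain ⟨hB, hE⟩ := hsmall _ ((DPW.mem_nbhd_iff x δ).1 hx)
    exact DPW.iftSystem_iff_systemMap hm ht.ne' hB hE
  refine ⟨⟨DPW.ofP y, ?_, ?_⟩, fun x hx => ?_⟩
  · have hmem : DPW.ofP y ∈ DPW.nbhd ρ δ := by
      rw [DPW.mem_nbhd_iff, DPW.toP_ofP]
      exact hy
    refine ⟨hmem, (hiff _ hmem).2 ?_⟩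
    rw [DPW.toP_ofP]
    exact hy0
  · rintro x ⟨hx, hsys⟩
    refine DPW.toP_injective ?_
    rw [DPW.toP_ofP]
    exact huniq _ ⟨(DPW.mem_nbhd_iff x δ).1 hx, (hiff x hx).1 hsys⟩
  · obtain ⟨hB, hE⟩ := hsmall _ ((DPW.mem_nbhd_iff x δ).1 hx)
    exact DPW.iftSystem_iff_solvesMonodromyProblem hm ht.ne'
      (fun μ hμ => ⟨_, DPW.isTransport_evalM hm t x μ hμ hB⟩)
      (DPW.norm_mon_sub_one_le hm hB hE)
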